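/- Let $\mathcal F^*$ be the set of all $C^\infty$ functions $f:\,]0,\infty[\,\to\mathbb R$ with the following two properties, where $F:\,]0,\infty[\,\to\mathbb R$ is any function with $F'(s)=sf(s)-1$: * $f(s)f'(s)F''(s)\neq 0$ for all $s>0$ (so $F''$ has a constant sign $\epsilon_f\in\{-1,1\}$); * $\lim_{s\to0}\epsilon_f s f(s)<1<\lim_{s\to\infty}\epsilon_f s f(s)$ (limits in the extended real line). For $f\in\mathcal F^*$ let $s_f>0$ be the unique solution of $s f(s)=\epsilon_f$. *Net winding.* For $p\in\mathbb C\setminus\{0\}$ let $\Phi_f(\cdot,p)$ be the solution of $\dot z=izf(|z|)-i$ with $z(0)=p$. If it is periodic and avoids $0$, let $T_f(p)$ be its minimal period (equal to $0$ if $p$ is a fixed point) and $$\omega_f(p)=\pm\frac1{2\pi}\int_0^{T_f(p)}f(|\Phi_f(t,p)|)\,dt,$$ with $+$ if the orbit is traversed counter-clockwise and $-$ if it is traversed clockwise. This applies to every $p=\epsilon_f s$ with $0<s<s_f$. *Solutions.* A solution of $\kappa=f(r)$ is (represented by) a $C^\infty$ path $c:J\to\mathbb C$, with $J\ni0$ an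 open interval, such that $\dot c=e^{i\vartheta}$ for some smooth $\vartheta:J\to\mathbb R$, and $\dot\vartheta(t)=f(|c(t)|)$ for all $t\in J$ with $c(t)\ne0$. It is maximal if its set of points $c(J)$ is not a proper subset of the set of points of another solution. A Jordan solution is a maximal solution for which $c(J)$ is homeomorphic to the unit circle; it is non-circular if $c(J)$ is not a circle. Two Jordan solutions are the same modulo rotations if their sets of points are mapped onto each other by a rotation about $0$. **Theorem.** Let $f\in\mathcal F^*$, and assume that $s\mapsto\omega_f(\epsilon_f s)$ is (strictly) decreasing on $]0,s_f[$. Then the limit $\omega_f(0+)=\lim_{s\to0+}\omega_f(\epsilon_f s)$ exists in $]0,\infty]$, and the number of different non-circular Jordan solutions of $\kappa=f(r)$, modulo rotations, is precisely the number of integers $n\ge2$ with $$\frac1{\omega_f(0+)}<n<\sqrt{\epsilon_f\,s_f\,F''(s_f)},$$ where $1/\infty=0$. -/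

import Mathlib

open Filter Topology Set
open scoped ContDiff

noncomputable section

namespace PlanarCurvature

/-! Functions `f : ℝ⁺ → ℝ` are represented by functions `ℝ → ℝ` of which only the values on
`]0, ∞[` are ever used. -/

/-- A primitive `F` of `s ↦ s f(s) - 1` on `]0, ∞[`. Only derivatives of `F` are used below, so
the additive constant is immaterial. -/
def primF (f : ℝ → ℝ) (s : ℝ) : ℝ := ∫ u in (1 : ℝ)..s, (u * f u - 1)

/-- The class of smooth `f : ℝ⁺ → ℝ` with `f(s) f'(s) F''(s) ≠ 0` for all `s > 0`. -/
structure ClassF (f : ℝ → ℝ) : Prop where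
  smooth : ContDiffOn ℝ ∞ f (Ioi 0)
  ne_zero : ∀ s, 0 < s → f s * deriv f s * iteratedDeriv 2 (primF f) s ≠ 0

/-- The constant sign `ε_f ∈ {-1, 1}` of `F''`, for `f` in the class above. -/
def epsF (f : ℝ → ℝ) : ℝ := Real.sign (iteratedDeriv 2 (primF f) 1)

/-- The open interval `I_f` between `lim_{s → 0} ε_f s f(s)` and `lim_{s → ∞} ε_f s f(s)`, the
limits being taken in the extended real line. -/
def intervalI (f : ℝ → ℝ) : Set ℝ :=
  {x | ∃ a b : EReal,
    Tendsto (fun s : ℝ => ((epsF f * s * f s : ℝ) : EReal)) (𝓝[>] 0) (𝓝 a) ∧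
    Tendsto (fun s : ℝ => ((epsF f * s * f s : ℝ) : EReal)) atTop (𝓝 b) ∧
    a < (x : EReal) ∧ (x : EReal) < b}

/-- The class `F*`. -/
def ClassFStar (f : ℝ → ℝ) : Prop := ClassF f ∧ (1 : ℝ) ∈ intervalI f

/-- The radius `s_f`: for `f` in `F*`, the unique `s > 0` with `s f(s) = ε_f`. -/
def radS (f : ℝ → ℝ) : ℝ := sInf {s : ℝ | 0 < s ∧ s * f s = epsF f}

/-! ### The auxiliary planar flow and net winding -/

/-- `u : ℝ → ℂ ∖ {0}` is a global solution of `ż = i z f(|z|) - i`. -/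
def IsFlowLine (f : ℝ → ℝ) (u : ℝ → ℂ) : Prop :=
  ∀ t, u t ≠ 0 ∧
    HasDerivAt u (Complex.I * u t * ((f ‖u t‖ : ℝ) : ℂ) - Complex.I) t

/-- `t ↦ Φ_f(t, p)`, for a point `p` whose orbit does not contain `0`. Such a solution is unique. -/
def flowLine (f : ℝ → ℝ) (p : ℂ) : ℝ → ℂ :=
  Classical.epsilon (fun u : ℝ → ℂ => u 0 = p ∧ IsFlowLine f u)

/-- The minimal period `T_f(p)` of a periodic point `p`. -/
def minPer (f : ℝ → ℝ) (p : ℂ) : ℝ := sInf {t : ℝ | 0 < t ∧ flowLine f p t = p}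

/-- The orientation of a path `u` that is simple closed on `[0, T]`: `1` if counter-clockwise and
`-1` if clockwise, that is, the sign of the enclosed signed area `½ ∫ Im (ū u̇) dt`. -/
def orientationSign (u : ℝ → ℂ) (T : ℝ) : ℝ :=
  Real.sign (∫ t in (0 : ℝ)..T, ((starRingEnd ℂ) (u t) * deriv u t).im)

/-- The net winding `ω_f(p) = ± (1 / 2π) ∫_0^{T_f(p)} f(|Φ_f(t, p)|) dt` of a periodic point `p`
whose orbit does not contain `0`, with the sign given by the orientation of the orbit. -/
def netWinding (f : ℝ → ℝ) (p : ℂ) : ℝ :=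
  orientationSign (flowLine f p) (minPer f p) *
    ((2 * Real.pi)⁻¹ * ∫ t in (0 : ℝ)..(minPer f p), f ‖flowLine f p t‖)

/-! ### Solutions of `κ = f(r)` -/

/-- The smooth path `c : J → ℂ`, parametrized by arc length on an open interval `J ∋ 0`, with
tangent angle `ϑ` and curvature `κ = ϑ̇`, is a solution of `κ = f(r)`. -/
structure IsSolution (f : ℝ → ℝ) (J : Set ℝ) (c : ℝ → ℂ) : Prop where
  isOpen : IsOpen J
  ordConnected : J.OrdConnected
  zero_mem : (0 : ℝ) ∈ J
  smooth : ContDiffOn ℝ ∞ c J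
  curvature : ∃ ϑ : ℝ → ℝ, ContDiffOn ℝ ∞ ϑ J ∧
    (∀ t ∈ J, deriv c t = Complex.exp ((ϑ t : ℂ) * Complex.I)) ∧
    (∀ t ∈ J, c t ≠ 0 → deriv ϑ t = f ‖c t‖)

/-- A solution is maximal if the set of its points cannot be enlarged. -/
def IsMaximalSolution (f : ℝ → ℝ) (J : Set ℝ) (c : ℝ → ℂ) : Prop :=
  IsSolution f J c ∧
    ∀ (J' : Set ℝ) (c' : ℝ → ℂ), IsSolution f J' c' → c '' J ⊆ c' '' J' → c '' J = c' '' J'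

/-- `Γ` is the set of points of a Jordan solution, i.e. of a maximal solution whose set of points
is homeomorphic to the unit circle. -/
def IsJordanTrace (f : ℝ → ℝ) (Γ : Set ℂ) : Prop :=
  (∃ (J : Set ℝ) (c : ℝ → ℂ), IsMaximalSolution f J c ∧ c '' J = Γ) ∧
    Nonempty (Γ ≃ₜ Circle)

/-- `Γ` is a (Euclidean) circle, with any centre. -/
def IsCircle (Γ : Set ℂ) : Prop := ∃ (a : ℂ) (r : ℝ), 0 < r ∧ Γ = Metric.sphere a r

/-- All rotated copies `e^{iϑ} Γ` of `Γ`. -/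
def rotationClass (Γ : Set ℂ) : Set (Set ℂ) :=
  {Γ' | ∃ ϑ : ℝ, Γ' = (fun z : ℂ => Complex.exp ((ϑ : ℂ) * Complex.I) * z) '' Γ}

/-- The non-circular Jordan solutions of `κ = f(r)`, modulo rotations. -/
def nonCircularJordanModRot (f : ℝ → ℝ) : Set (Set (Set ℂ)) :=
  rotationClass '' {Γ | IsJordanTrace f Γ ∧ ¬ IsCircle Γ}

end PlanarCurvature

end

/-!
After multiplying `f` by `ε_f` and conjugating the plane one may assume `ε_f = 1`: then `f` is
positive, strictly monotone, and `s ↦ s f(s)` is strictly increasing with value `1` at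
`σ = s_f` (`Admissible`, `ClassFStar.admissible`). Below, `g` stands for this function, `G` is the
primitive of `s g(s)` and `F(s) = G(s) - s`.

The position vector of a solution `c` in its moving frame, `u = -i c̄ e^{iϑ}`, solves
`u̇ = i u g(|u|) - i` away from `0`, with first integral `G(|u|) - Re u`. So a solution is
determined up to rotation by its energy, which is at least `F(σ)`, and by a shift of time. The energy levels
between `F(σ)` and `0` are closed orbits around the fixed point `σ`. They are parametrized
explicitly: in the coordinate `v = ± √(F(r) - F(σ))` such a level is the circle `v = -A cos θ`.
This makes the periodicity of the orbit plain and writes the net winding as an integral that is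
continuous up to the fixed point, where its value is `(s_f F''(s_f)) ^ (-1/2)`
(`tendsto_netWinding_rad`).

A solution with trace homeomorphic to the circle continues to a periodic simple closed curve
(`exists_closedSolution`). Every solution is symmetric about the line through `0` and a point where
the distance to `0` is stationary, and it meets itself where it crosses such a line
(`Admissible.reflection`, `Admissible.crossing`). On the other hand, an arc of monotone curvature
that turns by at least `π` does cross the line of one of its ends
(`Admissible.exists_tangComp_zero`). This excludes simple closed curves through `0`
(`ne_zero_at_zero`) and of nonnegative energy (`energy_neg_of_ne_zero`). For negative energy above
`F(σ)` it bounds the turning `Δ` between consecutive extrema of the distance by `π`, and a further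
crossing argument gives `n Δ = π` for some `n ≥ 2` (`exists_turn_eq`). As the net winding equals
`Δ / π`, it is `1 / n`.

Conversely, if the net winding is `1 / n`, the solution closes up, and it is simple because its
polar angle is strictly increasing. It is maximal: apart from the points at one exceptional distance
to `0`, solutions of other energies meet it in countably many points (`countable_crossings`), and two
rotated copies that are graphs in polar coordinates and of which one contains the other coincide.

Finally, as the net winding is continuous and, by assumption, strictly decreasing in the minimal
distance `s` to `0`, each `1 / n` strictly between its two limits is taken exactly once
(`Admissible.count`).
-/

namespace PlanarCurvature

/-! ### The potentials -/

/-- The normalised hypotheses on the curvature function: `g` is smooth and positive on `]0, ∞[`,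
strictly monotone, `s ↦ s g(s)` has positive derivative, and `σ` is the radius of the circular
solution about `0`. Every `f` in `F*`, or its negative, satisfies them. -/
structure Admissible (g : ℝ → ℝ) (σ : ℝ) : Prop where
  smooth : ContDiffOn ℝ ∞ g (Ioi 0)
  pos : ∀ s, 0 < s → 0 < g s
  deriv_ne : ∀ s, 0 < s → deriv g s ≠ 0
  convex : ∀ s, 0 < s → 0 < g s + s * deriv g s
  rad_pos : 0 < σ
  rad_eq : σ * g σ = 1

/-- The primitive `G` of `s ↦ s g(s)` that vanishes at `0`. -/
noncomputable def potG (g : ℝ → ℝ) (s : ℝ) : ℝ := ∫ u in (0 : ℝ)..s, u * g u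

/-- The primitive `F` of `s ↦ s g(s) - 1` that vanishes at `0`. -/
noncomputable def potF (g : ℝ → ℝ) (s : ℝ) : ℝ := potG g s - s

namespace Admissible

variable {g : ℝ → ℝ} {σ : ℝ}

lemma hasDerivAt (h : Admissible g σ) {s : ℝ} (hs : 0 < s) : HasDerivAt g (deriv g s) s :=
  ((h.smooth.contDiffAt (Ioi_mem_nhds hs)).differentiableAt (by simp)).hasDerivAt

lemma continuousOn_deriv (h : Admissible g σ) : ContinuousOn (deriv g) (Ioi 0) :=
  h.smooth.continuousOn_deriv_of_isOpen isOpen_Ioi (by simp)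

lemma hasDerivAt_mul (h : Admissible g σ) {s : ℝ} (hs : 0 < s) :
    HasDerivAt (fun s => s * g s) (g s + s * deriv g s) s := by
  simpa using (hasDerivAt_id' s).fun_mul (h.hasDerivAt hs)

lemma mul_strictMonoOn (h : Admissible g σ) : StrictMonoOn (fun s => s * g s) (Ioi 0) := by
  apply strictMonoOn_of_deriv_pos (convex_Ioi 0)
  · exact fun s hs => (h.hasDerivAt_mul hs).continuousAt.continuousWithinAt
  · intro s hs
    rw [interior_Ioi] at hs
    rw [(h.hasDerivAt_mul hs).deriv]
    exact h.convex s hs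

lemma strictMonoOn_or_strictAntiOn (h : Admissible g σ) :
    StrictMonoOn g (Ioi 0) ∨ StrictAntiOn g (Ioi 0) := by
  have hc : ContinuousOn g (Ioi 0) := h.smooth.continuousOn
  have hsign : (∀ s ∈ Ioi (0 : ℝ), 0 < deriv g s) ∨ (∀ s ∈ Ioi (0 : ℝ), deriv g s < 0) := by
    by_contra hcon
    push Not at hcon
    obtain ⟨⟨a, ha, ha'⟩, b, hb, hb'⟩ := hcon
    obtain ⟨c, hc, hc'⟩ := isPreconnected_Ioi.intermediate_value ha hb h.continuousOn_deriv
      (show (0 : ℝ) ∈ Icc _ _ from ⟨ha', hb'⟩)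
    exact h.deriv_ne c hc hc'
  rcases hsign with hp | hn
  · exact Or.inl (strictMonoOn_of_deriv_pos (convex_Ioi 0) hc (by simpa using hp))
  · exact Or.inr (strictAntiOn_of_deriv_neg (convex_Ioi 0) hc (by simpa using hn))

lemma injOn (h : Admissible g σ) : InjOn g (Ioi 0) :=
  h.strictMonoOn_or_strictAntiOn.elim StrictMonoOn.injOn StrictAntiOn.injOn

lemma intervalIntegrable_mul (h : Admissible g σ) {a b : ℝ} (ha : 0 ≤ a) (hb : 0 ≤ b) :
    IntervalIntegrable (fun u => u * g u) MeasureTheory.volume a b := by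
  apply MonotoneOn.intervalIntegrable
  intro x hx y hy hxy
  have hx0 : 0 ≤ x := le_trans (le_min ha hb) hx.1
  rcases hx0.eq_or_lt with rfl | hx0
  · rcases hxy.eq_or_lt with rfl | hy0
    · exact le_rfl
    · simpa using (mul_pos hy0 (h.pos y hy0)).le
  · exact h.mul_strictMonoOn.monotoneOn hx0 (lt_of_lt_of_le hx0 hxy) hxy

lemma hasDerivAt_potG (h : Admissible g σ) {s : ℝ} (hs : 0 < s) :
    HasDerivAt (potG g) (s * g s) s := by
  apply intervalIntegral.integral_hasDerivAt_right (h.intervalIntegrable_mul le_rfl hs.le)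
  · refine ContinuousOn.stronglyMeasurableAtFilter isOpen_Ioi (s := Ioi 0) ?_ s hs
    exact fun s hs => (h.hasDerivAt_mul hs).continuousAt.continuousWithinAt
  · exact (h.hasDerivAt_mul hs).continuousAt

lemma hasDerivAt_potF (h : Admissible g σ) {s : ℝ} (hs : 0 < s) :
    HasDerivAt (potF g) (s * g s - 1) s :=
  (h.hasDerivAt_potG hs).sub (hasDerivAt_id s)

lemma potG_zero : potG g 0 = 0 := by simp [potG]

lemma potF_zero : potF g 0 = 0 := by simp [potF, potG_zero]

lemma continuousOn_potG (h : Admissible g σ) : ContinuousOn (potG g) (Ici 0) := by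
  intro s hs
  have hs : 0 ≤ s := hs
  have hint := h.intervalIntegrable_mul (le_refl (0 : ℝ)) (by linarith : 0 ≤ s + 1)
  have h1 := intervalIntegral.continuousOn_primitive_interval' hint
    (show (0 : ℝ) ∈ uIcc 0 (s + 1) from left_mem_uIcc)
  rw [uIcc_of_le (by linarith)] at h1
  refine (h1 s ⟨hs, by linarith⟩).mono_of_mem_nhdsWithin ?_
  rw [mem_nhdsWithin]
  exact ⟨Iio (s + 1), isOpen_Iio, by simp, fun x hx => ⟨hx.2, le_of_lt hx.1⟩⟩

lemma continuousOn_potF (h : Admissible g σ) : ContinuousOn (potF g) (Ici 0) :=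
  h.continuousOn_potG.sub continuousOn_id

lemma potG_strictMonoOn (h : Admissible g σ) : StrictMonoOn (potG g) (Ici 0) := by
  apply strictMonoOn_of_deriv_pos (convex_Ici 0) h.continuousOn_potG
  intro s hs
  rw [interior_Ici] at hs
  rw [(h.hasDerivAt_potG hs).deriv]
  exact mul_pos hs (h.pos s hs)

lemma potG_pos (h : Admissible g σ) {s : ℝ} (hs : 0 < s) : 0 < potG g s := by
  rw [← potG_zero (g := g)]
  exact h.potG_strictMonoOn (le_refl (0 : ℝ)) hs.le hs

lemma mul_lt_one_iff (h : Admissible g σ) {s : ℝ} (hs : 0 < s) : s * g s < 1 ↔ s < σ := by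
  rw [← h.rad_eq]
  exact h.mul_strictMonoOn.lt_iff_lt hs h.rad_pos

lemma one_lt_mul_iff (h : Admissible g σ) {s : ℝ} (hs : 0 < s) : 1 < s * g s ↔ σ < s := by
  rw [← h.rad_eq]
  exact h.mul_strictMonoOn.lt_iff_lt h.rad_pos hs

lemma potF_strictAntiOn (h : Admissible g σ) : StrictAntiOn (potF g) (Icc 0 σ) := by
  apply strictAntiOn_of_deriv_neg (convex_Icc 0 σ) (h.continuousOn_potF.mono fun x hx => hx.1)
  intro s hs
  rw [interior_Icc] at hs
  rw [(h.hasDerivAt_potF hs.1).deriv]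
  linarith [(h.mul_lt_one_iff hs.1).2 hs.2]

lemma potF_strictMonoOn (h : Admissible g σ) : StrictMonoOn (potF g) (Ici σ) := by
  apply strictMonoOn_of_deriv_pos (convex_Ici σ)
    (h.continuousOn_potF.mono fun x hx => h.rad_pos.le.trans hx)
  intro s hs
  rw [interior_Ici] at hs
  have hs0 : 0 < s := h.rad_pos.trans hs
  rw [(h.hasDerivAt_potF hs0).deriv]
  linarith [(h.one_lt_mul_iff hs0).2 hs]

lemma potF_rad_neg (h : Admissible g σ) : potF g σ < 0 := by
  rw [← potF_zero (g := g)]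
  exact h.potF_strictAntiOn ⟨le_rfl, h.rad_pos.le⟩ ⟨h.rad_pos.le, le_rfl⟩ h.rad_pos

lemma potF_neg_of_le (h : Admissible g σ) {s : ℝ} (hs : 0 < s) (hs' : s ≤ σ) : potF g s < 0 := by
  rw [← potF_zero (g := g)]
  exact h.potF_strictAntiOn ⟨le_rfl, h.rad_pos.le⟩ ⟨hs.le, hs'⟩ hs

lemma potF_rad_lt (h : Admissible g σ) {s : ℝ} (hs : 0 ≤ s) (hne : s ≠ σ) :
    potF g σ < potF g s := by
  rcases lt_or_gt_of_ne hne with h1 | h1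
  · exact h.potF_strictAntiOn ⟨hs, h1.le⟩ ⟨h.rad_pos.le, le_rfl⟩ h1
  · exact h.potF_strictMonoOn (le_refl σ) h1.le h1

lemma potF_rad_le (h : Admissible g σ) {s : ℝ} (hs : 0 ≤ s) : potF g σ ≤ potF g s := by
  rcases eq_or_ne s σ with rfl | hne
  · exact le_rfl
  · exact (h.potF_rad_lt hs hne).le

lemma exists_potF_gt (h : Admissible g σ) (M : ℝ) : ∃ s, σ < s ∧ M < potF g s := by
  -- Beyond `σ + 1` the slope of `F` is at least the positive slope `d` there.
  set a := σ + 1 with ha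
  have ha0 : 0 < a := by linarith [h.rad_pos]
  set d := a * g a - 1 with hd
  have hd0 : 0 < d := by linarith [(h.one_lt_mul_iff ha0).2 (by linarith : σ < a)]
  have key : ∀ s ∈ Ici a, potF g a + d * (s - a) ≤ potF g s := by
    have hm : MonotoneOn (fun s => potF g s - d * s) (Ici a) := by
      have hder : ∀ s, a ≤ s → HasDerivAt (fun s => potF g s - d * s) (s * g s - 1 - d) s := by
        intro s hs
        simpa using (h.hasDerivAt_potF (ha0.trans_le hs)).fun_sub ((hasDerivAt_id' s).const_mul d)
      apply monotoneOn_of_deriv_nonneg (convex_Ici a)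
      · exact fun s hs => (hder s hs).continuousAt.continuousWithinAt
      · intro s hs
        rw [interior_Ici] at hs
        exact (hder s (le_of_lt hs)).differentiableAt.differentiableWithinAt
      · intro s hs
        rw [interior_Ici] at hs
        rw [(hder s (le_of_lt hs)).deriv]
        have : a * g a ≤ s * g s :=
          h.mul_strictMonoOn.monotoneOn ha0 (ha0.trans hs) (le_of_lt hs)
        linarith
    intro s hs
    have := hm (le_refl a) hs hs
    simp only at this
    linarith
  refine ⟨max a ((M + 1 - potF g a) / d + a), lt_max_of_lt_left (by linarith), ?_⟩
  have h1 := key _ (le_max_left a ((M + 1 - potF g a) / d + a))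
  have h2 : (M + 1 - potF g a) / d ≤ max a ((M + 1 - potF g a) / d + a) - a := by
    linarith [le_max_right a ((M + 1 - potF g a) / d + a)]
  have h3 := mul_le_mul_of_nonneg_left h2 hd0.le
  rw [mul_div_cancel₀ _ hd0.ne'] at h3
  linarith

end Admissible

end PlanarCurvature

namespace PlanarCurvature

/-! ### A coordinate in which the potential is a square -/

/-- The signed square root `v(r) = ±√(F(r) - F(σ))`, negative for `r < σ` and positive for
`r > σ`. It is a `C¹` coordinate on `]0, ∞[` in which `F` becomes `F(σ) + v²`. -/
noncomputable def rootV (g : ℝ → ℝ) (σ r : ℝ) : ℝ :=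
  Real.sign (r - σ) * √(potF g r - potF g σ)

/-- The radius as a function of the coordinate `v`: the inverse of `rootV` on `]0, ∞[`. -/
noncomputable def radR (g : ℝ → ℝ) (σ : ℝ) : ℝ → ℝ := Function.invFunOn (rootV g σ) (Ioi 0)

/-- The amplitude `√(-F(σ))` of the orbit through `0`; `rootV` maps `]0, ∞[` onto
`]-maxAmp, ∞[`. -/
noncomputable def maxAmp (g : ℝ → ℝ) (σ : ℝ) : ℝ := √(-potF g σ)

namespace Admissible

variable {g : ℝ → ℝ} {σ : ℝ}

lemma rootV_of_gt {r : ℝ} (hr : σ < r) : rootV g σ r = √(potF g r - potF g σ) := by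
  rw [rootV, Real.sign_of_pos (by linarith), one_mul]

lemma rootV_of_lt {r : ℝ} (hr : r < σ) : rootV g σ r = -√(potF g r - potF g σ) := by
  rw [rootV, Real.sign_of_neg (by linarith), neg_one_mul]

lemma rootV_rad : rootV g σ σ = 0 := by simp [rootV]

lemma rootV_sq (h : Admissible g σ) {r : ℝ} (hr : 0 < r) :
    rootV g σ r ^ 2 = potF g r - potF g σ := by
  have h0 : 0 ≤ potF g r - potF g σ := by linarith [h.potF_rad_le hr.le]
  rcases lt_trichotomy r σ with h1 | rfl | h1
  · rw [rootV_of_lt h1, neg_sq, Real.sq_sqrt h0]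
  · simp [rootV_rad]
  · rw [rootV_of_gt h1, Real.sq_sqrt h0]

lemma rootV_pos (h : Admissible g σ) {r : ℝ} (hr : σ < r) : 0 < rootV g σ r := by
  rw [rootV_of_gt hr]
  exact Real.sqrt_pos.2 (by linarith [h.potF_rad_lt (h.rad_pos.trans hr).le hr.ne'])

lemma rootV_neg (h : Admissible g σ) {r : ℝ} (hr0 : 0 < r) (hr : r < σ) : rootV g σ r < 0 := by
  rw [rootV_of_lt hr, neg_lt_zero]
  exact Real.sqrt_pos.2 (by linarith [h.potF_rad_lt hr0.le hr.ne])

/-- Twice differentiability of `F` at its minimum, in the form of a second-order quotient. -/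
lemma tendsto_potF_sub_div_sq (h : Admissible g σ) :
    Tendsto (fun r => (potF g r - potF g σ) / (r - σ) ^ 2) (𝓝[≠] σ)
      (𝓝 ((g σ + σ * deriv g σ) / 2)) := by
  have hpos : ∀ᶠ r in 𝓝[≠] σ, 0 < r :=
    nhdsWithin_le_nhds (Ioi_mem_nhds h.rad_pos)
  apply HasDerivAt.lhopital_zero_nhdsNE (f' := fun r => r * g r - 1) (g' := fun r => 2 * (r - σ))
  · filter_upwards [hpos] with r hr
    simpa using (h.hasDerivAt_potF hr).sub_const (potF g σ)
  · filter_upwards with r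
    simpa using ((hasDerivAt_id' r).sub_const σ).fun_pow 2
  · filter_upwards [self_mem_nhdsWithin] with r hr
    exact mul_ne_zero two_ne_zero (sub_ne_zero.2 hr)
  · have : ContinuousAt (fun r => potF g r - potF g σ) σ :=
      (h.hasDerivAt_potF h.rad_pos).continuousAt.sub continuousAt_const
    simpa [ContinuousAt] using this.tendsto.mono_left nhdsWithin_le_nhds
  · have : ContinuousAt (fun r => (r - σ) ^ 2) σ := by fun_prop
    simpa [ContinuousAt] using this.tendsto.mono_left nhdsWithin_le_nhds
  · have h1 := (hasDerivAt_iff_tendsto_slope.1 (h.hasDerivAt_mul h.rad_pos)).div_const 2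
    refine h1.congr' ?_
    filter_upwards [self_mem_nhdsWithin] with r hr
    rw [slope_def_field, h.rad_eq]
    have : r - σ ≠ 0 := sub_ne_zero.2 hr
    field_simp

lemma rootV_div_eq {r : ℝ} (hr : r ≠ σ) :
    rootV g σ r / (r - σ) = √((potF g r - potF g σ) / (r - σ) ^ 2) := by
  rw [Real.sqrt_div' _ (sq_nonneg _), Real.sqrt_sq_eq_abs]
  rcases lt_or_gt_of_ne hr with h1 | h1
  · rw [rootV_of_lt h1, abs_of_neg (by linarith), neg_div, div_neg]
  · rw [rootV_of_gt h1, abs_of_pos (by linarith)]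

lemma tendsto_rootV_div (h : Admissible g σ) :
    Tendsto (fun r => rootV g σ r / (r - σ)) (𝓝[≠] σ) (𝓝 (√((g σ + σ * deriv g σ) / 2))) := by
  refine ((Real.continuous_sqrt.tendsto _).comp h.tendsto_potF_sub_div_sq).congr' ?_
  filter_upwards [self_mem_nhdsWithin] with r hr
  exact (rootV_div_eq hr).symm

lemma hasDerivAt_rootV_rad (h : Admissible g σ) :
    HasDerivAt (rootV g σ) (√((g σ + σ * deriv g σ) / 2)) σ := by
  rw [hasDerivAt_iff_tendsto_slope]
  refine h.tendsto_rootV_div.congr fun r => ?_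
  rw [slope_def_field, rootV_rad, sub_zero]

lemma rootV_ne_zero (h : Admissible g σ) {r : ℝ} (hr0 : 0 < r) (hr : r ≠ σ) :
    rootV g σ r ≠ 0 := by
  rcases lt_or_gt_of_ne hr with h1 | h1
  · exact (h.rootV_neg hr0 h1).ne
  · exact (h.rootV_pos h1).ne'

lemma hasDerivAt_rootV_of_ne (h : Admissible g σ) {r : ℝ} (hr0 : 0 < r) (hr : r ≠ σ) :
    HasDerivAt (rootV g σ) ((r * g r - 1) / (2 * rootV g σ r)) r := by
  have hd := ((h.hasDerivAt_potF hr0).sub_const (potF g σ)).sqrt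
    (by linarith [h.potF_rad_lt hr0.le hr] : potF g r - potF g σ ≠ 0)
  rcases lt_or_gt_of_ne hr with h1 | h1
  · rw [rootV_of_lt h1]
    have := hd.fun_neg
    rw [← div_neg, ← mul_neg] at this
    refine this.congr_of_eventuallyEq ?_
    filter_upwards [Iio_mem_nhds h1] with x hx using rootV_of_lt hx
  · rw [rootV_of_gt h1]
    refine hd.congr_of_eventuallyEq ?_
    filter_upwards [Ioi_mem_nhds h1] with x hx using rootV_of_gt hx

lemma hasDerivAt_rootV (h : Admissible g σ) {r : ℝ} (hr : 0 < r) :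
    HasDerivAt (rootV g σ) (deriv (rootV g σ) r) r := by
  rcases eq_or_ne r σ with rfl | hne
  · exact h.hasDerivAt_rootV_rad.differentiableAt.hasDerivAt
  · exact (h.hasDerivAt_rootV_of_ne hr hne).differentiableAt.hasDerivAt

lemma deriv_rootV_pos (h : Admissible g σ) {r : ℝ} (hr : 0 < r) : 0 < deriv (rootV g σ) r := by
  rcases lt_trichotomy r σ with h1 | rfl | h1
  · rw [(h.hasDerivAt_rootV_of_ne hr h1.ne).deriv]
    exact div_pos_of_neg_of_neg (by linarith [(h.mul_lt_one_iff hr).2 h1])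
      (by linarith [h.rootV_neg hr h1])
  · rw [h.hasDerivAt_rootV_rad.deriv]
    exact Real.sqrt_pos.2 (by linarith [h.convex r hr])
  · rw [(h.hasDerivAt_rootV_of_ne hr h1.ne').deriv]
    exact div_pos (by linarith [(h.one_lt_mul_iff hr).2 h1]) (by linarith [h.rootV_pos h1])

lemma two_mul_rootV_mul_deriv (h : Admissible g σ) {r : ℝ} (hr : 0 < r) :
    2 * rootV g σ r * deriv (rootV g σ) r = r * g r - 1 := by
  rcases eq_or_ne r σ with rfl | hne
  · rw [rootV_rad, h.rad_eq]; ring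
  · rw [(h.hasDerivAt_rootV_of_ne hr hne).deriv]
    have := h.rootV_ne_zero hr hne
    field_simp

lemma continuousOn_deriv_rootV (h : Admissible g σ) :
    ContinuousOn (deriv (rootV g σ)) (Ioi 0) := by
  intro r hr
  apply ContinuousAt.continuousWithinAt
  have hr : 0 < r := hr
  rcases eq_or_ne r σ with rfl | hne
  · -- At the minimum, `v' = F' / (2 v)` is a quotient of two slopes.
    rw [← continuousWithinAt_compl_self, ContinuousWithinAt, h.hasDerivAt_rootV_rad.deriv]
    have hF := (hasDerivAt_iff_tendsto_slope.1 (h.hasDerivAt_mul h.rad_pos))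
    have hpos : 0 < (g r + r * deriv g r) / 2 := by linarith [h.convex r hr]
    have h1 := hF.div (h.tendsto_rootV_div.const_mul 2)
      (by have := Real.sqrt_pos.2 hpos; positivity)
    have e : (g r + r * deriv g r) / (2 * √((g r + r * deriv g r) / 2)) =
        √((g r + r * deriv g r) / 2) := by
      have h2 := Real.sqrt_pos.2 hpos
      rw [div_eq_iff (by positivity)]
      nlinarith [Real.sq_sqrt hpos.le]
    rw [e] at h1
    refine h1.congr' ?_
    filter_upwards [self_mem_nhdsWithin, nhdsWithin_le_nhds (Ioi_mem_nhds hr)] with s hs hs0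
    have hs : s ≠ r := hs
    simp only [Pi.div_apply]
    rw [slope_def_field, h.rad_eq, (h.hasDerivAt_rootV_of_ne hs0 hs).deriv]
    have := sub_ne_zero.2 hs
    have := h.rootV_ne_zero hs0 hs
    field_simp
  · have hc : ContinuousAt (fun s => (s * g s - 1) / (2 * rootV g σ s)) r := by
      refine ((h.hasDerivAt_mul hr).continuousAt.sub continuousAt_const).div
        (continuousAt_const.mul (h.hasDerivAt_rootV hr).continuousAt) ?_
      have := h.rootV_ne_zero hr hne
      positivity
    refine hc.congr ?_
    filter_upwards [Ioi_mem_nhds hr, isOpen_ne.mem_nhds hne] with s hs0 hs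
    exact ((h.hasDerivAt_rootV_of_ne hs0 hs).deriv).symm

lemma rootV_strictMonoOn (h : Admissible g σ) : StrictMonoOn (rootV g σ) (Ioi 0) := by
  apply strictMonoOn_of_deriv_pos (convex_Ioi 0)
  · exact fun s hs => (h.hasDerivAt_rootV hs).continuousAt.continuousWithinAt
  · intro s hs
    rw [interior_Ioi] at hs
    exact h.deriv_rootV_pos hs

lemma neg_maxAmp_lt_rootV (h : Admissible g σ) {r : ℝ} (hr : 0 < r) :
    -maxAmp g σ < rootV g σ r := by
  have hm : 0 < maxAmp g σ := Real.sqrt_pos.2 (by linarith [h.potF_rad_neg])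
  rcases lt_trichotomy r σ with h1 | rfl | h1
  · rw [rootV_of_lt h1, neg_lt_neg_iff]
    exact Real.sqrt_lt_sqrt (by linarith [h.potF_rad_le hr.le])
      (by linarith [h.potF_neg_of_le hr h1.le])
  · rw [rootV_rad]; linarith
  · linarith [h.rootV_pos h1]

lemma maxAmp_pos (h : Admissible g σ) : 0 < maxAmp g σ :=
  Real.sqrt_pos.2 (by linarith [h.potF_rad_neg])

lemma maxAmp_sq (h : Admissible g σ) : maxAmp g σ ^ 2 = -potF g σ :=
  Real.sq_sqrt (by linarith [h.potF_rad_neg])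

lemma exists_rootV_eq (h : Admissible g σ) {y : ℝ} (hy : -maxAmp g σ < y) :
    ∃ r ∈ Ioi (0 : ℝ), rootV g σ r = y := by
  rcases le_or_gt 0 y with h0 | h0
  · obtain ⟨S, hS, hS'⟩ := h.exists_potF_gt (potF g σ + y ^ 2)
    have hc : ContinuousOn (potF g) (Icc σ S) :=
      h.continuousOn_potF.mono fun x hx => h.rad_pos.le.trans hx.1
    obtain ⟨r, hr, hr'⟩ := intermediate_value_Icc hS.le hc
      (show potF g σ + y ^ 2 ∈ Icc _ _ from ⟨by nlinarith, hS'.le⟩)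
    refine ⟨r, h.rad_pos.trans_le hr.1, ?_⟩
    rcases hr.1.eq_or_lt with rfl | h1
    · rw [rootV_rad]; nlinarith
    · rw [rootV_of_gt h1, hr', add_sub_cancel_left, Real.sqrt_sq h0]
  · have hc : ContinuousOn (potF g) (Icc 0 σ) := h.continuousOn_potF.mono fun x hx => hx.1
    have hy2 : y ^ 2 < -potF g σ := by
      rw [← h.maxAmp_sq]; nlinarith
    obtain ⟨r, hr, hr'⟩ := intermediate_value_Icc' h.rad_pos.le hc
      (show potF g σ + y ^ 2 ∈ Icc _ _ from ⟨by nlinarith, by rw [potF_zero]; linarith⟩)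
    have hr0 : r ≠ 0 := by
      rintro rfl
      rw [potF_zero] at hr'
      linarith
    have hrσ : r ≠ σ := by
      rintro rfl
      nlinarith
    refine ⟨r, lt_of_le_of_ne hr.1 (Ne.symm hr0), ?_⟩
    rw [rootV_of_lt (lt_of_le_of_ne hr.2 hrσ), hr', add_sub_cancel_left,
      Real.sqrt_sq_eq_abs, abs_of_neg h0, neg_neg]

lemma radR_pos (h : Admissible g σ) {y : ℝ} (hy : -maxAmp g σ < y) : 0 < radR g σ y :=
  Function.invFunOn_mem (h.exists_rootV_eq hy)

lemma rootV_radR (h : Admissible g σ) {y : ℝ} (hy : -maxAmp g σ < y) :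
    rootV g σ (radR g σ y) = y :=
  Function.invFunOn_eq (h.exists_rootV_eq hy)

lemma radR_rootV (h : Admissible g σ) {r : ℝ} (hr : 0 < r) : radR g σ (rootV g σ r) = r :=
  h.rootV_strictMonoOn.injOn (h.radR_pos (h.neg_maxAmp_lt_rootV hr)) hr
    (h.rootV_radR (h.neg_maxAmp_lt_rootV hr))

lemma radR_zero (h : Admissible g σ) : radR g σ 0 = σ := by
  have := h.radR_rootV h.rad_pos
  rwa [rootV_rad] at this

lemma radR_strictMonoOn (h : Admissible g σ) : StrictMonoOn (radR g σ) (Ioi (-maxAmp g σ)) := by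
  intro x hx y hy hxy
  rw [← h.rootV_strictMonoOn.lt_iff_lt (h.radR_pos hx) (h.radR_pos hy), h.rootV_radR hx,
    h.rootV_radR hy]
  exact hxy

lemma potF_radR (h : Admissible g σ) {y : ℝ} (hy : -maxAmp g σ < y) :
    potF g (radR g σ y) = potF g σ + y ^ 2 := by
  have := h.rootV_sq (h.radR_pos hy)
  rw [h.rootV_radR hy] at this
  linarith

lemma continuousAt_radR (h : Admissible g σ) {y : ℝ} (hy : -maxAmp g σ < y) :
    ContinuousAt (radR g σ) y := by
  apply h.radR_strictMonoOn.continuousAt_of_image_mem_nhds (Ioi_mem_nhds hy)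
  refine mem_of_superset (Ioi_mem_nhds (h.radR_pos hy)) fun r hr => ?_
  exact ⟨rootV g σ r, h.neg_maxAmp_lt_rootV hr, h.radR_rootV hr⟩

lemma hasDerivAt_radR' (h : Admissible g σ) {y : ℝ} (hy : -maxAmp g σ < y) :
    HasDerivAt (radR g σ) (deriv (rootV g σ) (radR g σ y))⁻¹ y := by
  apply HasDerivAt.of_local_left_inverse (h.continuousAt_radR hy)
    (h.hasDerivAt_rootV (h.radR_pos hy)) (h.deriv_rootV_pos (h.radR_pos hy)).ne'
  filter_upwards [Ioi_mem_nhds hy] with x hx using h.rootV_radR hx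

lemma deriv_radR (h : Admissible g σ) {y : ℝ} (hy : -maxAmp g σ < y) :
    deriv (radR g σ) y = (deriv (rootV g σ) (radR g σ y))⁻¹ :=
  (h.hasDerivAt_radR' hy).deriv

lemma hasDerivAt_radR (h : Admissible g σ) {y : ℝ} (hy : -maxAmp g σ < y) :
    HasDerivAt (radR g σ) (deriv (radR g σ) y) y :=
  (h.hasDerivAt_radR' hy).differentiableAt.hasDerivAt

lemma deriv_radR_pos (h : Admissible g σ) {y : ℝ} (hy : -maxAmp g σ < y) :
    0 < deriv (radR g σ) y := by
  rw [h.deriv_radR hy]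
  exact inv_pos.2 (h.deriv_rootV_pos (h.radR_pos hy))

lemma deriv_radR_mul (h : Admissible g σ) {y : ℝ} (hy : -maxAmp g σ < y) :
    (radR g σ y * g (radR g σ y) - 1) * deriv (radR g σ) y = 2 * y := by
  rw [h.deriv_radR hy, ← h.two_mul_rootV_mul_deriv (h.radR_pos hy), h.rootV_radR hy,
    mul_inv_cancel_right₀ (h.deriv_rootV_pos (h.radR_pos hy)).ne']

lemma continuousOn_radR (h : Admissible g σ) : ContinuousOn (radR g σ) (Ioi (-maxAmp g σ)) :=
  fun _ hy => (h.continuousAt_radR hy).continuousWithinAt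

lemma continuousOn_deriv_radR (h : Admissible g σ) :
    ContinuousOn (deriv (radR g σ)) (Ioi (-maxAmp g σ)) := by
  have h1 : ContinuousOn (fun y => (deriv (rootV g σ) (radR g σ y))⁻¹) (Ioi (-maxAmp g σ)) :=
    ContinuousOn.inv₀ (h.continuousOn_deriv_rootV.comp h.continuousOn_radR
      fun y hy => h.radR_pos hy) fun y hy => (h.deriv_rootV_pos (h.radR_pos hy)).ne'
  exact h1.congr fun y hy => h.deriv_radR hy

lemma deriv_radR_zero (h : Admissible g σ) :
    deriv (radR g σ) 0 = (√((g σ + σ * deriv g σ) / 2))⁻¹ := by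
  rw [h.deriv_radR (by linarith [h.maxAmp_pos]), h.radR_zero, h.hasDerivAt_rootV_rad.deriv]

end Admissible

end PlanarCurvature

namespace PlanarCurvature

/-! ### Explicit orbits of the auxiliary flow -/

/-- The radius at angle `θ` on the orbit of amplitude `A`: the orbit of energy `F(σ) + A²` is the
circle `θ ↦ -A cos θ` in the coordinate `v`, starting at its point closest to `0`. -/
noncomputable def orbR (g : ℝ → ℝ) (σ A θ : ℝ) : ℝ := radR g σ (-A * Real.cos θ)

/-- The real part at angle `θ` of the orbit of amplitude `A`. -/
noncomputable def orbX (g : ℝ → ℝ) (σ A θ : ℝ) : ℝ := orbR g σ A θ - A ^ 2 * Real.sin θ ^ 2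

/-- The sum of radius and real part at angle `θ` of the orbit of amplitude `A`. -/
noncomputable def orbD (g : ℝ → ℝ) (σ A θ : ℝ) : ℝ := 2 * orbR g σ A θ - A ^ 2 * Real.sin θ ^ 2

/-- The imaginary part at angle `θ` of the orbit of amplitude `A`. -/
noncomputable def orbY (g : ℝ → ℝ) (σ A θ : ℝ) : ℝ := -A * Real.sin θ * √(orbD g σ A θ)

/-- The derivative of time with respect to the angle `θ` along the orbit of amplitude `A`. -/
noncomputable def orbP (g : ℝ → ℝ) (σ A θ : ℝ) : ℝ :=
  orbR g σ A θ * deriv (radR g σ) (-A * Real.cos θ) / √(orbD g σ A θ)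

/-- The time at which the orbit of amplitude `A` reaches the angle `θ`. -/
noncomputable def orbTime (g : ℝ → ℝ) (σ A θ : ℝ) : ℝ := ∫ φ in (0 : ℝ)..θ, orbP g σ A φ

/-- The angle as a function of time on the orbit of amplitude `A`. -/
noncomputable def orbAngle (g : ℝ → ℝ) (σ A : ℝ) : ℝ → ℝ := Function.invFun (orbTime g σ A)

/-- The orbit of amplitude `A`, as a function of time. -/
noncomputable def orbU (g : ℝ → ℝ) (σ A t : ℝ) : ℂ :=
  (orbX g σ A (orbAngle g σ A t) : ℂ) + (orbY g σ A (orbAngle g σ A t) : ℂ) * Complex.I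

namespace Admissible

variable {g : ℝ → ℝ} {σ A : ℝ}

lemma orb_range (hA : |A| < maxAmp g σ) (θ : ℝ) : -maxAmp g σ < -A * Real.cos θ := by
  have h1 : |A * Real.cos θ| ≤ |A| := by
    rw [abs_mul]
    exact mul_le_of_le_one_right (abs_nonneg _) (Real.abs_cos_le_one θ)
  linarith [le_abs_self (A * Real.cos θ)]

lemma orbR_pos (h : Admissible g σ) (hA : |A| < maxAmp g σ) (θ : ℝ) : 0 < orbR g σ A θ :=
  h.radR_pos (orb_range hA θ)

lemma orbX_eq (h : Admissible g σ) (hA : |A| < maxAmp g σ) (θ : ℝ) :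
    orbX g σ A θ = potG g (orbR g σ A θ) - (potF g σ + A ^ 2) := by
  have h1 := h.potF_radR (orb_range hA θ)
  change potF g (orbR g σ A θ) = _ at h1
  have h2 := Real.sin_sq_add_cos_sq θ
  rw [orbX]
  have h3 : potG g (orbR g σ A θ) = potF g (orbR g σ A θ) + orbR g σ A θ := by rw [potF]; ring
  rw [h3, h1]
  linear_combination (-A ^ 2) * h2

lemma amp_sq_lt (h : Admissible g σ) (hA : |A| < maxAmp g σ) : potF g σ + A ^ 2 < 0 := by
  have := sq_lt_sq' (by linarith [abs_nonneg A, h.maxAmp_pos]) hA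
  rw [sq_abs, h.maxAmp_sq] at this
  linarith

lemma orbX_pos (h : Admissible g σ) (hA : |A| < maxAmp g σ) (θ : ℝ) : 0 < orbX g σ A θ := by
  rw [h.orbX_eq hA]
  linarith [h.amp_sq_lt hA, h.potG_pos (h.orbR_pos hA θ)]

lemma orbD_eq (θ : ℝ) : orbD g σ A θ = orbR g σ A θ + orbX g σ A θ := by
  rw [orbD, orbX]; ring

lemma orbD_pos (h : Admissible g σ) (hA : |A| < maxAmp g σ) (θ : ℝ) : 0 < orbD g σ A θ := by
  rw [orbD_eq]
  exact add_pos (h.orbR_pos hA θ) (h.orbX_pos hA θ)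

lemma orbX_sq_add_orbY_sq (h : Admissible g σ) (hA : |A| < maxAmp g σ) (θ : ℝ) :
    orbX g σ A θ ^ 2 + orbY g σ A θ ^ 2 = orbR g σ A θ ^ 2 := by
  rw [orbY, mul_pow, Real.sq_sqrt (h.orbD_pos hA θ).le, orbD, orbX]
  ring

lemma orbP_pos (h : Admissible g σ) (hA : |A| < maxAmp g σ) (θ : ℝ) : 0 < orbP g σ A θ :=
  div_pos (mul_pos (h.orbR_pos hA θ) (h.deriv_radR_pos (orb_range hA θ)))
    (Real.sqrt_pos.2 (h.orbD_pos hA θ))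

/-- The orbits depend continuously on the amplitude and the angle jointly. -/
lemma continuous_orbR (h : Admissible g σ) :
    Continuous fun q : {A : ℝ // |A| < maxAmp g σ} × ℝ => orbR g σ q.1 q.2 := by
  refine h.continuousOn_radR.comp_continuous ?_ fun q => orb_range q.1.2 q.2
  fun_prop

lemma continuous_orbP (h : Admissible g σ) :
    Continuous fun q : {A : ℝ // |A| < maxAmp g σ} × ℝ => orbP g σ q.1 q.2 := by
  have h1 := h.continuous_orbR
  have h2 : Continuous fun q : {A : ℝ // |A| < maxAmp g σ} × ℝ =>
      deriv (radR g σ) (-(q.1 : ℝ) * Real.cos q.2) :=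
    h.continuousOn_deriv_radR.comp_continuous (by fun_prop) fun q => orb_range q.1.2 q.2
  have h3 : Continuous fun q : {A : ℝ // |A| < maxAmp g σ} × ℝ => √(orbD g σ q.1 q.2) := by
    unfold orbD
    fun_prop
  exact (h1.mul h2).div h3 fun q => (Real.sqrt_pos.2 (h.orbD_pos q.1.2 q.2)).ne'

lemma continuous_orbP_right (h : Admissible g σ) (hA : |A| < maxAmp g σ) :
    Continuous (orbP g σ A) :=
  h.continuous_orbP.comp (Continuous.prodMk_right (⟨A, hA⟩ : {A : ℝ // |A| < maxAmp g σ}))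

lemma orbR_periodic : Function.Periodic (orbR g σ A) (2 * Real.pi) := fun θ => by
  simp [orbR]

lemma orbP_periodic : Function.Periodic (orbP g σ A) (2 * Real.pi) := fun θ => by
  simp [orbP, orbD, orbR]

lemma hasDerivAt_orbTime (h : Admissible g σ) (hA : |A| < maxAmp g σ) (θ : ℝ) :
    HasDerivAt (orbTime g σ A) (orbP g σ A θ) θ :=
  (h.continuous_orbP_right hA).integral_hasStrictDerivAt 0 θ |>.hasDerivAt

lemma orbTime_strictMono (h : Admissible g σ) (hA : |A| < maxAmp g σ) :
    StrictMono (orbTime g σ A) := by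
  apply strictMono_of_deriv_pos
  intro θ
  rw [(h.hasDerivAt_orbTime hA θ).deriv]
  exact h.orbP_pos hA θ

lemma orbTime_continuous (h : Admissible g σ) (hA : |A| < maxAmp g σ) :
    Continuous (orbTime g σ A) :=
  continuous_iff_continuousAt.2 fun θ => (h.hasDerivAt_orbTime hA θ).continuousAt

lemma orbTime_surjective (h : Admissible g σ) (hA : |A| < maxAmp g σ) :
    Function.Surjective (orbTime g σ A) := by
  have hi := (h.continuous_orbP_right hA).intervalIntegrable 
    (μ := MeasureTheory.volume) 0 (2 * Real.pi)
  exact (h.orbTime_continuous hA).surjective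
    (orbP_periodic.tendsto_atTop_intervalIntegral_of_pos' hi (h.orbP_pos hA) Real.two_pi_pos)
    (orbP_periodic.tendsto_atBot_intervalIntegral_of_pos' hi (h.orbP_pos hA) Real.two_pi_pos)

lemma orbTime_orbAngle (h : Admissible g σ) (hA : |A| < maxAmp g σ) (t : ℝ) :
    orbTime g σ A (orbAngle g σ A t) = t :=
  Function.rightInverse_invFun (h.orbTime_surjective hA) t

lemma orbAngle_orbTime (h : Admissible g σ) (hA : |A| < maxAmp g σ) (θ : ℝ) :
    orbAngle g σ A (orbTime g σ A θ) = θ :=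
  Function.leftInverse_invFun (h.orbTime_strictMono hA).injective θ

lemma orbAngle_strictMono (h : Admissible g σ) (hA : |A| < maxAmp g σ) :
    StrictMono (orbAngle g σ A) := by
  intro s t hst
  rwa [← (h.orbTime_strictMono hA).lt_iff_lt, h.orbTime_orbAngle hA, h.orbTime_orbAngle hA]

lemma hasDerivAt_orbAngle (h : Admissible g σ) (hA : |A| < maxAmp g σ) (t : ℝ) :
    HasDerivAt (orbAngle g σ A) (orbP g σ A (orbAngle g σ A t))⁻¹ t := by
  apply HasDerivAt.of_local_left_inverse _ (h.hasDerivAt_orbTime hA _) (h.orbP_pos hA _).ne'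
    (Eventually.of_forall (h.orbTime_orbAngle hA))
  exact ((h.orbAngle_strictMono hA).monotone.continuous_of_surjective
    fun θ => ⟨_, h.orbAngle_orbTime hA θ⟩).continuousAt

lemma orbTime_zero : orbTime g σ A 0 = 0 := by simp [orbTime]

lemma orbAngle_zero (h : Admissible g σ) (hA : |A| < maxAmp g σ) : orbAngle g σ A 0 = 0 := by
  have := h.orbAngle_orbTime hA 0
  rwa [orbTime_zero] at this

lemma orbTime_add_two_pi (h : Admissible g σ) (hA : |A| < maxAmp g σ) (θ : ℝ) :
    orbTime g σ A (θ + 2 * Real.pi) = orbTime g σ A θ + orbTime g σ A (2 * Real.pi) := by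
  have hi : ∀ a b, IntervalIntegrable (orbP g σ A) MeasureTheory.volume a b :=
    fun a b => (h.continuous_orbP_right hA).intervalIntegrable a b
  rw [orbTime, orbTime, orbTime,
    ← intervalIntegral.integral_add_adjacent_intervals (hi 0 θ) (hi θ _),
    orbP_periodic.intervalIntegral_add_eq θ 0, zero_add]

lemma orbTime_neg (θ : ℝ) : orbTime g σ A (-θ) = -orbTime g σ A θ := by
  have := intervalIntegral.integral_comp_neg (a := 0) (b := θ) (orbP g σ A)
  have h2 : ∀ x, orbP g σ A (-x) = orbP g σ A x := fun x => by simp [orbP, orbD, orbR]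
  simp only [h2, neg_zero] at this
  rw [orbTime, orbTime, this, intervalIntegral.integral_symm]

lemma orbTime_two_pi (h : Admissible g σ) (hA : |A| < maxAmp g σ) :
    orbTime g σ A (2 * Real.pi) = 2 * orbTime g σ A Real.pi := by
  have h1 := h.orbTime_add_two_pi hA (-Real.pi)
  rw [orbTime_neg, show -Real.pi + 2 * Real.pi = Real.pi by ring] at h1
  linarith

/-- The orbit of amplitude `A` takes the time `2 τ` for a full turn, by its reflection
symmetry. -/
lemma orbAngle_add (h : Admissible g σ) (hA : |A| < maxAmp g σ) (t : ℝ) :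
    orbAngle g σ A (t + 2 * orbTime g σ A Real.pi) = orbAngle g σ A t + 2 * Real.pi := by
  rw [← h.orbTime_two_pi hA]
  apply (h.orbTime_strictMono hA).injective
  rw [h.orbTime_orbAngle hA, h.orbTime_add_two_pi hA, h.orbTime_orbAngle hA]

lemma orbAngle_neg (h : Admissible g σ) (hA : |A| < maxAmp g σ) (t : ℝ) :
    orbAngle g σ A (-t) = -orbAngle g σ A t := by
  apply (h.orbTime_strictMono hA).injective
  rw [h.orbTime_orbAngle hA, orbTime_neg, h.orbTime_orbAngle hA]

lemma hasDerivAt_orbR (h : Admissible g σ) (hA : |A| < maxAmp g σ) (θ : ℝ) :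
    HasDerivAt (orbR g σ A) (deriv (radR g σ) (-A * Real.cos θ) * (A * Real.sin θ)) θ := by
  have h1 : HasDerivAt (fun θ => -A * Real.cos θ) (A * Real.sin θ) θ := by
    simpa using (Real.hasDerivAt_cos θ).const_mul (-A)
  exact (h.hasDerivAt_radR (orb_range hA θ)).comp θ h1

lemma orbR_deriv_rel (h : Admissible g σ) (hA : |A| < maxAmp g σ) (θ : ℝ) :
    (orbR g σ A θ * g (orbR g σ A θ) - 1) * deriv (radR g σ) (-A * Real.cos θ) =
      2 * (-A * Real.cos θ) :=
  h.deriv_radR_mul (orb_range hA θ)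

/-- `dx/dθ = -y f(r) dt/dθ` on the explicit orbit. -/
lemma hasDerivAt_orbX (h : Admissible g σ) (hA : |A| < maxAmp g σ) (θ : ℝ) :
    HasDerivAt (orbX g σ A)
      (-orbY g σ A θ * g (orbR g σ A θ) * orbP g σ A θ) θ := by
  have h1 := (h.hasDerivAt_orbR hA θ).fun_sub
      (((Real.hasDerivAt_sin θ).fun_pow 2).const_mul (A ^ 2))
  refine h1.congr_deriv ?_
  have h2 := h.orbR_deriv_rel hA θ
  have h3 := (Real.sqrt_pos.2 (h.orbD_pos hA θ)).ne'
  rw [orbY, orbP]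
  generalize deriv (radR g σ) (-A * Real.cos θ) = K at *
  field_simp
  push_cast
  linear_combination (-A * Real.sin θ) * h2

/-- `dy/dθ = (x f(r) - 1) dt/dθ` on the explicit orbit. -/
lemma hasDerivAt_orbY (h : Admissible g σ) (hA : |A| < maxAmp g σ) (θ : ℝ) :
    HasDerivAt (orbY g σ A)
      ((orbX g σ A θ * g (orbR g σ A θ) - 1) * orbP g σ A θ) θ := by
  have hD : HasDerivAt (orbD g σ A) (2 * (deriv (radR g σ) (-A * Real.cos θ) * (A * Real.sin θ))
      - A ^ 2 * (2 * Real.sin θ * Real.cos θ)) θ := by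
    have h1 := ((h.hasDerivAt_orbR hA θ).const_mul 2).fun_sub
      (((Real.hasDerivAt_sin θ).fun_pow 2).const_mul (A ^ 2))
    exact h1.congr_deriv (by norm_num)
  have hD0 := h.orbD_pos hA θ
  have h1 := ((Real.hasDerivAt_sin θ).const_mul (-A)).fun_mul (hD.sqrt hD0.ne')
  refine h1.congr_deriv ?_
  have h2 := h.orbR_deriv_rel hA θ
  have h3 := (Real.sqrt_pos.2 hD0).ne'
  have h4 := Real.sq_sqrt hD0.le
  rw [orbP]
  have h5 : orbX g σ A θ = orbD g σ A θ - orbR g σ A θ := by rw [orbD_eq]; ring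
  have h6 : A ^ 2 * Real.sin θ ^ 2 = 2 * orbR g σ A θ - orbD g σ A θ := by rw [orbD]; ring
  rw [h5]
  generalize deriv (radR g σ) (-A * Real.cos θ) = K at *
  field_simp
  rw [h4]
  linear_combination (-(orbD g σ A θ - A ^ 2 * Real.sin θ ^ 2) / 2) * h2 -
    (orbR g σ A θ * g (orbR g σ A θ) + 1) * K / 2 * h6

end Admissible

end PlanarCurvature

namespace PlanarCurvature

/-! ### The auxiliary flow -/

/-- The vector field `i z f(|z|) - i` of the auxiliary flow. -/
noncomputable def flowField (g : ℝ → ℝ) (z : ℂ) : ℂ :=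
  Complex.I * z * ((g ‖z‖ : ℝ) : ℂ) - Complex.I

namespace Admissible

variable {g : ℝ → ℝ} {σ A : ℝ}

lemma contDiffAt_flowField (h : Admissible g σ) {z : ℂ} (hz : z ≠ 0) :
    ContDiffAt ℝ ∞ (flowField g) z := by
  have h1 : ContDiffAt ℝ ∞ (fun z : ℂ => g ‖z‖) z :=
    (h.smooth.contDiffAt (Ioi_mem_nhds (norm_pos_iff.2 hz))).comp z (contDiffAt_norm ℝ hz)
  have h2 : ContDiffAt ℝ ∞ (fun z : ℂ => ((g ‖z‖ : ℝ) : ℂ)) z :=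
    Complex.ofRealCLM.contDiff.contDiffAt.comp z h1
  exact ((contDiffAt_const.mul contDiffAt_id).mul h2).sub contDiffAt_const

lemma flow_eqOn (h : Admissible g σ) {J : Set ℝ} (hJ : IsOpen J) (hJ' : IsPreconnected J)
    {u v : ℝ → ℂ} (hu : ∀ t ∈ J, u t ≠ 0 ∧ HasDerivAt u (flowField g (u t)) t)
    (hv : ∀ t ∈ J, v t ≠ 0 ∧ HasDerivAt v (flowField g (v t)) t)
    {t₀ : ℝ} (ht₀ : t₀ ∈ J) (he : u t₀ = v t₀) : EqOn u v J := by
  have hS : IsOpen {t | t ∈ J ∧ u t = v t} := by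
    rw [isOpen_iff_mem_nhds]
    rintro t ⟨ht, heq⟩
    obtain ⟨K, s, hs, hK⟩ := ((h.contDiffAt_flowField (hu t ht).1).of_le
      (by simp : (1 : WithTop ℕ∞) ≤ ∞)).exists_lipschitzOnWith
    have hJt := hJ.mem_nhds ht
    have e1 : ∀ᶠ t' in 𝓝 t, u t' ∈ s := (hu t ht).2.continuousAt.eventually hs
    have e2 : ∀ᶠ t' in 𝓝 t, v t' ∈ s := (hv t ht).2.continuousAt.eventually (heq ▸ hs)
    have := ODE_solution_unique_of_eventually (v := fun _ => flowField g) (s := fun _ => s)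
      (Eventually.of_forall fun _ => hK)
      (by filter_upwards [hJt, e1] with t' h1 h2 using ⟨(hu t' h1).2, h2⟩)
      (by filter_upwards [hJt, e2] with t' h1 h2 using ⟨(hv t' h1).2, h2⟩) heq
    filter_upwards [hJt, this] with t' h1 h2 using ⟨h1, h2⟩
  have hS' : IsOpen {t | t ∈ J ∧ u t ≠ v t} := by
    rw [isOpen_iff_mem_nhds]
    rintro t ⟨ht, hne⟩
    filter_upwards [hJ.mem_nhds ht, ((hu t ht).2.continuousAt.ne_iff_eventually_ne
      (hv t ht).2.continuousAt).1 hne] with t' h1 h2 using ⟨h1, h2⟩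
  have := hJ'.subset_left_of_subset_union hS hS'
    (disjoint_left.2 fun t h1 h2 => h2.2 h1.2)
    (fun t ht => (em (u t = v t)).imp (fun h => ⟨ht, h⟩) (fun h => ⟨ht, h⟩)) ⟨t₀, ht₀, ht₀, he⟩
  exact fun t ht => (this ht).2

lemma flowLine_eq (h : Admissible g σ) {u : ℝ → ℂ} (hu : IsFlowLine g u) :
    flowLine g (u 0) = u := by
  have hs : flowLine g (u 0) 0 = u 0 ∧ IsFlowLine g (flowLine g (u 0)) :=
    Classical.epsilon_spec (p := fun v : ℝ → ℂ => v 0 = u 0 ∧ IsFlowLine g v) ⟨u, rfl, hu⟩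
  funext t
  exact h.flow_eqOn isOpen_univ isPreconnected_univ (fun t _ => hs.2 t) (fun t _ => hu t)
    (mem_univ 0) hs.1 (mem_univ t)

/-! ### Properties of the explicit orbits -/

lemma norm_orbU (h : Admissible g σ) (hA : |A| < maxAmp g σ) (t : ℝ) :
    ‖orbU g σ A t‖ = orbR g σ A (orbAngle g σ A t) := by
  rw [orbU, Complex.norm_add_mul_I, h.orbX_sq_add_orbY_sq hA, Real.sqrt_sq (h.orbR_pos hA _).le]

lemma orbU_re (t : ℝ) : (orbU g σ A t).re = orbX g σ A (orbAngle g σ A t) := by simp [orbU]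

lemma orbU_im (t : ℝ) : (orbU g σ A t).im = orbY g σ A (orbAngle g σ A t) := by simp [orbU]

lemma isFlowLine_orbU (h : Admissible g σ) (hA : |A| < maxAmp g σ) :
    IsFlowLine g (orbU g σ A) := by
  intro t
  constructor
  · rw [← norm_pos_iff, h.norm_orbU hA]
    exact h.orbR_pos hA _
  · have hP := (h.orbP_pos hA (orbAngle g σ A t)).ne'
    have h1 := ((h.hasDerivAt_orbX hA _).comp t (h.hasDerivAt_orbAngle hA t)).ofReal_comp
    have h2 := ((h.hasDerivAt_orbY hA _).comp t (h.hasDerivAt_orbAngle hA t)).ofReal_comp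
    have h3 := h1.fun_add (h2.mul_const Complex.I)
    refine h3.congr_deriv ?_
    rw [h.norm_orbU hA]
    rw [mul_inv_cancel_right₀ hP, mul_inv_cancel_right₀ hP, orbU]
    push_cast
    linear_combination (-(orbY g σ A (orbAngle g σ A t) : ℂ) *
      (g (orbR g σ A (orbAngle g σ A t)) : ℂ)) * Complex.I_sq

/-- Half of the period of the explicit orbit. -/
noncomputable def _root_.PlanarCurvature.orbHalf (g : ℝ → ℝ) (σ A : ℝ) : ℝ :=
  orbTime g σ A Real.pi

lemma orbHalf_pos (h : Admissible g σ) (hA : |A| < maxAmp g σ) : 0 < orbHalf g σ A := by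
  rw [← orbTime_zero (g := g) (σ := σ) (A := A)]
  exact h.orbTime_strictMono hA Real.pi_pos

lemma orbAngle_orbHalf (h : Admissible g σ) (hA : |A| < maxAmp g σ) :
    orbAngle g σ A (orbHalf g σ A) = Real.pi := h.orbAngle_orbTime hA _

lemma orbU_periodic (h : Admissible g σ) (hA : |A| < maxAmp g σ) :
    Function.Periodic (orbU g σ A) (2 * orbHalf g σ A) := by
  intro t
  simp only [orbU, orbHalf, h.orbAngle_add hA, orbX, orbY, orbD, orbR_periodic _,
    Real.sin_add_two_pi]

lemma orbX_neg (θ : ℝ) : orbX g σ A (-θ) = orbX g σ A θ := by simp [orbX, orbR]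

lemma orbY_neg (θ : ℝ) : orbY g σ A (-θ) = -orbY g σ A θ := by simp [orbY, orbD, orbR]

lemma orbU_neg (h : Admissible g σ) (hA : |A| < maxAmp g σ) (t : ℝ) :
    orbU g σ A (-t) = (starRingEnd ℂ) (orbU g σ A t) := by
  simp [orbU, h.orbAngle_neg hA, orbX_neg, orbY_neg]

lemma orbU_zero (h : Admissible g σ) (hA : |A| < maxAmp g σ) :
    orbU g σ A 0 = (radR g σ (-A) : ℂ) := by
  simp [orbU, h.orbAngle_zero hA, orbX, orbY, orbR]

lemma norm_orbU_strictMonoOn (h : Admissible g σ) (hA : |A| < maxAmp g σ) (hA0 : 0 < A) :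
    StrictMonoOn (fun t => ‖orbU g σ A t‖) (Icc 0 (orbHalf g σ A)) := by
  intro s hs t ht hst
  have hm := h.orbAngle_strictMono hA
  have h1 : ∀ x ∈ Icc 0 (orbHalf g σ A), orbAngle g σ A x ∈ Icc 0 Real.pi := by
    intro x hx
    have h2 := hm.monotone hx.1
    have h3 := hm.monotone hx.2
    rw [h.orbAngle_zero hA] at h2
    rw [h.orbAngle_orbHalf hA] at h3
    exact ⟨h2, h3⟩
  simp only [h.norm_orbU hA]
  apply h.radR_strictMonoOn (orb_range hA _) (orb_range hA _)
  have := Real.strictAntiOn_cos (h1 s hs) (h1 t ht) (hm hst)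
  nlinarith

lemma orbTime_int_mul (h : Admissible g σ) (hA : |A| < maxAmp g σ) (k : ℤ) :
    orbTime g σ A (k * (2 * Real.pi)) = k * (2 * orbHalf g σ A) := by
  have hi : ∀ a b, IntervalIntegrable (orbP g σ A) MeasureTheory.volume a b :=
    fun a b => (h.continuous_orbP_right hA).intervalIntegrable a b
  have := orbP_periodic (g := g) (σ := σ) (A := A).intervalIntegral_add_zsmul_eq k 0 hi
  simp only [zero_add, zsmul_eq_mul] at this
  rw [orbTime, this, orbHalf, ← h.orbTime_two_pi hA, orbTime]

lemma eq_int_mul_of_norm_orbU (h : Admissible g σ) (hA : |A| < maxAmp g σ) (hA0 : 0 < A) {t : ℝ}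
    (ht : ‖orbU g σ A t‖ = radR g σ (-A)) : ∃ k : ℤ, t = k * (2 * orbHalf g σ A) := by
  rw [h.norm_orbU hA, orbR] at ht
  have h0 := orb_range hA 0
  rw [Real.cos_zero, mul_one] at h0
  have h1 := h.radR_strictMonoOn.injOn (orb_range hA _) h0 ht
  have h2 : Real.cos (orbAngle g σ A t) = 1 := by
    have : A * (Real.cos (orbAngle g σ A t) - 1) = 0 := by linarith
    rcases mul_eq_zero.1 this with h3 | h3 <;> linarith
  obtain ⟨k, hk⟩ := (Real.cos_eq_one_iff _).1 h2
  refine ⟨k, ?_⟩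
  rw [← h.orbTime_int_mul hA, hk, h.orbTime_orbAngle hA]

/-- The explicit orbit is the whole level set of the energy. -/
lemma exists_orbU_eq (h : Admissible g σ) (hA : |A| < maxAmp g σ) (hA0 : 0 < A) {w : ℂ}
    (hw : w ≠ 0) (he : potG g ‖w‖ - w.re = potF g σ + A ^ 2) : ∃ t, orbU g σ A t = w := by
  have hr : 0 < ‖w‖ := norm_pos_iff.2 hw
  have hv := h.rootV_sq hr
  have hre := Complex.re_le_norm w
  have hF : potF g ‖w‖ = potG g ‖w‖ - ‖w‖ := rfl
  have hle : rootV g σ ‖w‖ ^ 2 ≤ A ^ 2 := by rw [hv]; linarith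
  have hab := abs_le_of_sq_le_sq' hle hA0.le
  set θ := Real.arccos (-(rootV g σ ‖w‖ / A)) with hθ
  have hcos : -A * Real.cos θ = rootV g σ ‖w‖ := by
    rw [hθ, Real.cos_arccos]
    · field_simp
    · rw [neg_le_neg_iff, div_le_one hA0]; exact hab.2
    · rw [neg_le, le_div_iff₀ hA0]; linarith
  have hR : ∀ φ, Real.cos φ = Real.cos θ → orbR g σ A φ = ‖w‖ := by
    intro φ hφ
    rw [orbR, hφ, hcos, h.radR_rootV hr]
  have hX : ∀ φ, Real.cos φ = Real.cos θ → orbX g σ A φ = w.re := by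
    intro φ hφ
    rw [h.orbX_eq hA, hR φ hφ]; linarith
  have hsq : orbY g σ A θ ^ 2 = w.im ^ 2 := by
    have h1 := h.orbX_sq_add_orbY_sq hA θ
    rw [hX θ rfl, hR θ rfl, ← Complex.normSq_eq_norm_sq, Complex.normSq_apply] at h1
    linarith
  rcases sq_eq_sq_iff_eq_or_eq_neg.1 hsq with h1 | h1
  · refine ⟨orbTime g σ A θ, Complex.ext ?_ ?_⟩
    · rw [orbU_re, h.orbAngle_orbTime hA, hX θ rfl]
    · rw [orbU_im, h.orbAngle_orbTime hA, h1]
  · refine ⟨orbTime g σ A (-θ), Complex.ext ?_ ?_⟩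
    · rw [orbU_re, h.orbAngle_orbTime hA, hX _ (Real.cos_neg θ)]
    · rw [orbU_im, h.orbAngle_orbTime hA, orbY_neg, h1, neg_neg]

end Admissible

end PlanarCurvature

namespace PlanarCurvature

/-! ### Net winding -/

lemma IsFlowLine.continuous {g : ℝ → ℝ} {u : ℝ → ℂ} (hu : IsFlowLine g u) : Continuous u :=
  continuous_iff_continuousAt.2 fun t => (hu t).2.continuousAt

lemma IsFlowLine.norm_pos {g : ℝ → ℝ} {u : ℝ → ℂ} (hu : IsFlowLine g u) (t : ℝ) : 0 < ‖u t‖ :=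
  norm_pos_iff.2 (hu t).1

lemma IsFlowLine.hasDerivAt_re {g : ℝ → ℝ} {u : ℝ → ℂ} (hu : IsFlowLine g u) (t : ℝ) :
    HasDerivAt (fun t => (u t).re) (-(u t).im * g ‖u t‖) t := by
  have := Complex.reCLM.hasFDerivAt.comp_hasDerivAt t (hu t).2
  simpa [Function.comp_def] using this

lemma IsFlowLine.hasDerivAt_im {g : ℝ → ℝ} {u : ℝ → ℂ} (hu : IsFlowLine g u) (t : ℝ) :
    HasDerivAt (fun t => (u t).im) ((u t).re * g ‖u t‖ - 1) t := by
  have := Complex.imCLM.hasFDerivAt.comp_hasDerivAt t (hu t).2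
  simpa [Function.comp_def] using this

/-- The net winding of the explicit orbit of amplitude `A`, as an integral over the angle with
an integrand that is continuous up to the fixed point `A = 0`. -/
noncomputable def windA (g : ℝ → ℝ) (σ A : ℝ) : ℝ :=
  (2 * Real.pi)⁻¹ * ∫ θ in (0 : ℝ)..2 * Real.pi, g (orbR g σ A θ) * orbP g σ A θ

namespace Admissible

variable {g : ℝ → ℝ} {σ A : ℝ}

lemma continuous_comp_norm (h : Admissible g σ) {u : ℝ → ℂ} (hu : IsFlowLine g u) :
    Continuous fun t => g ‖u t‖ :=
  h.smooth.continuousOn.comp_continuous hu.continuous.norm hu.norm_pos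

/-- Closed flow lines run counter-clockwise: by Green's formula the enclosed area is
`∫ y² f(r) dt`. -/
lemma orientationSign_eq_one (h : Admissible g σ) {u : ℝ → ℂ} (hu : IsFlowLine g u) {T : ℝ}
    (hT : 0 < T) (hper : u T = u 0) (hne : ∃ t ∈ Icc 0 T, (u t).im ≠ 0) :
    orientationSign u T = 1 := by
  have hg := h.continuous_comp_norm hu
  have hre : Continuous fun t => (u t).re := Complex.continuous_re.comp hu.continuous
  have him : Continuous fun t => (u t).im := Complex.continuous_im.comp hu.continuous
  have c1 : Continuous fun t =>
      -(u t).im * g ‖u t‖ * (u t).im + (u t).re * ((u t).re * g ‖u t‖ - 1) :=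
    ((him.neg.mul hg).mul him).add (hre.mul ((hre.mul hg).sub continuous_const))
  have c2 : Continuous fun t => 2 * ((u t).im ^ 2 * g ‖u t‖) :=
    continuous_const.mul ((him.pow 2).mul hg)
  have h1 : ∀ t, HasDerivAt (fun t => (u t).re * (u t).im)
      (-(u t).im * g ‖u t‖ * (u t).im + (u t).re * ((u t).re * g ‖u t‖ - 1)) t :=
    fun t => (hu.hasDerivAt_re t).fun_mul (hu.hasDerivAt_im t)
  have h2 : ∫ t in (0 : ℝ)..T,
      (-(u t).im * g ‖u t‖ * (u t).im + (u t).re * ((u t).re * g ‖u t‖ - 1)) = 0 := by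
    rw [intervalIntegral.integral_eq_sub_of_hasDerivAt (fun t _ => h1 t)
      (c1.intervalIntegrable _ _), hper, sub_self]
  have h3 : ∀ t, ((starRingEnd ℂ) (u t) * deriv u t).im =
      (-(u t).im * g ‖u t‖ * (u t).im + (u t).re * ((u t).re * g ‖u t‖ - 1)) +
        2 * ((u t).im ^ 2 * g ‖u t‖) := by
    intro t
    rw [(hu t).2.deriv]
    simp
    ring
  have h4 : 0 < ∫ t in (0 : ℝ)..T, 2 * ((u t).im ^ 2 * g ‖u t‖) := by
    refine intervalIntegral.integral_pos hT c2.continuousOn ?_ ?_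
    · intro t _
      have := h.pos _ (hu.norm_pos t)
      positivity
    · obtain ⟨t, ht, hne⟩ := hne
      have := h.pos _ (hu.norm_pos t)
      exact ⟨t, ht, by positivity⟩
  rw [orientationSign]
  apply Real.sign_of_pos
  simp_rw [h3]
  rw [intervalIntegral.integral_add (c1.intervalIntegrable _ _) (c2.intervalIntegrable _ _), h2,
      zero_add]
  exact h4

lemma integral_comp_norm_orbU (h : Admissible g σ) (hA : |A| < maxAmp g σ) :
    ∫ t in (0 : ℝ)..2 * orbHalf g σ A, g ‖orbU g σ A t‖ =
      ∫ θ in (0 : ℝ)..2 * Real.pi, g (orbR g σ A θ) * orbP g σ A θ := by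
  have hc : Continuous fun t => g ‖orbU g σ A t‖ := h.continuous_comp_norm (h.isFlowLine_orbU hA)
  have := intervalIntegral.integral_comp_mul_deriv (a := 0) (b := 2 * Real.pi)
    (f := orbTime g σ A) (f' := orbP g σ A) (fun θ _ => h.hasDerivAt_orbTime hA θ)
    (h.continuous_orbP_right hA).continuousOn hc
  rw [orbTime_zero, h.orbTime_two_pi hA] at this
  rw [orbHalf, ← this]
  refine intervalIntegral.integral_congr fun θ _ => ?_
  simp [h.norm_orbU hA, h.orbAngle_orbTime hA]

lemma minPer_eq (h : Admissible g σ) (hA : |A| < maxAmp g σ) (hA0 : 0 < A) :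
    minPer g (orbU g σ A 0) = 2 * orbHalf g σ A := by
  have hT := h.orbHalf_pos hA
  rw [minPer, h.flowLine_eq (h.isFlowLine_orbU hA)]
  apply IsLeast.csInf_eq
  refine ⟨⟨by linarith, by simpa using h.orbU_periodic hA 0⟩, ?_⟩
  rintro t ⟨ht0, ht⟩
  have h0 := orb_range hA 0
  rw [Real.cos_zero, mul_one] at h0
  have hn : ‖orbU g σ A t‖ = radR g σ (-A) := by
    rw [ht, h.orbU_zero hA, Complex.norm_real, Real.norm_of_nonneg (h.radR_pos h0).le]
  obtain ⟨k, hk⟩ := h.eq_int_mul_of_norm_orbU hA hA0 hn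
  have hk0 : 0 < k := by
    by_contra hcon
    have : (k : ℝ) ≤ 0 := by exact_mod_cast not_lt.1 hcon
    nlinarith
  have : (1 : ℝ) ≤ k := by exact_mod_cast hk0
  nlinarith

lemma netWinding_orbU (h : Admissible g σ) (hA : |A| < maxAmp g σ) (hA0 : 0 < A) :
    netWinding g (orbU g σ A 0) =
      (2 * Real.pi)⁻¹ * ∫ t in (0 : ℝ)..2 * orbHalf g σ A, g ‖orbU g σ A t‖ := by
  have hT := h.orbHalf_pos hA
  have hu := h.isFlowLine_orbU hA
  have hp : orbU g σ A (2 * orbHalf g σ A) = orbU g σ A 0 := by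
    simpa using h.orbU_periodic hA 0
  have hne : ∃ t ∈ Icc 0 (2 * orbHalf g σ A), (orbU g σ A t).im ≠ 0 := by
    refine ⟨orbTime g σ A (Real.pi / 2), ⟨?_, ?_⟩, ?_⟩
    · rw [← orbTime_zero (g := g) (σ := σ) (A := A)]
      exact (h.orbTime_strictMono hA).monotone (by positivity)
    · rw [orbHalf, ← h.orbTime_two_pi hA]
      exact (h.orbTime_strictMono hA).monotone (by linarith [Real.pi_pos])
    · rw [orbU_im, h.orbAngle_orbTime hA, orbY, Real.sin_pi_div_two]
      have := Real.sqrt_pos.2 (h.orbD_pos hA (Real.pi / 2))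
      have : A * √(orbD g σ A (Real.pi / 2)) > 0 := by positivity
      linarith
  rw [netWinding, h.minPer_eq hA hA0, h.flowLine_eq hu,
    h.orientationSign_eq_one hu (by linarith) hp hne, one_mul]

/-- The amplitude of the orbit through the point `s` closest to `0`. -/
noncomputable def _root_.PlanarCurvature.ampOf (g : ℝ → ℝ) (σ s : ℝ) : ℝ := -rootV g σ s

lemma ampOf_pos (h : Admissible g σ) {s : ℝ} (hs : s ∈ Ioo 0 σ) : 0 < ampOf g σ s :=
  neg_pos.2 (h.rootV_neg hs.1 hs.2)

lemma abs_ampOf_lt (h : Admissible g σ) {s : ℝ} (hs : s ∈ Ioo 0 σ) :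
    |ampOf g σ s| < maxAmp g σ := by
  rw [abs_of_pos (h.ampOf_pos hs), ampOf]
  linarith [h.neg_maxAmp_lt_rootV hs.1]

lemma orbU_ampOf_zero (h : Admissible g σ) {s : ℝ} (hs : s ∈ Ioo 0 σ) :
    orbU g σ (ampOf g σ s) 0 = (s : ℂ) := by
  rw [h.orbU_zero (h.abs_ampOf_lt hs), ampOf, neg_neg, h.radR_rootV hs.1]

lemma netWinding_eq_windA (h : Admissible g σ) {s : ℝ} (hs : s ∈ Ioo 0 σ) :
    netWinding g (s : ℂ) = windA g σ (ampOf g σ s) := by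
  rw [← h.orbU_ampOf_zero hs, h.netWinding_orbU (h.abs_ampOf_lt hs) (h.ampOf_pos hs),
    h.integral_comp_norm_orbU (h.abs_ampOf_lt hs), windA]

lemma continuousOn_windA (h : Admissible g σ) :
    ContinuousOn (windA g σ) {A | |A| < maxAmp g σ} := by
  rw [continuousOn_iff_continuous_domRestrict]
  have h1 : Continuous fun q : {A : ℝ // |A| < maxAmp g σ} × ℝ =>
      g (orbR g σ q.1 q.2) * orbP g σ q.1 q.2 :=
    (h.smooth.continuousOn.comp_continuous h.continuous_orbR
      fun q => h.orbR_pos q.1.2 q.2).mul h.continuous_orbP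
  exact continuous_const.mul (intervalIntegral.continuous_parametric_intervalIntegral_of_continuous'
    (f := fun (A : {A : ℝ // |A| < maxAmp g σ}) θ => g (orbR g σ A θ) * orbP g σ A θ) h1 _ _)

lemma windA_zero (h : Admissible g σ) : windA g σ 0 = (√(σ * (g σ + σ * deriv g σ)))⁻¹ := by
  have hσ := h.rad_pos
  have hF := h.convex σ hσ
  have hgσ : g σ = σ⁻¹ := eq_inv_of_mul_eq_one_right h.rad_eq
  have h1 : ∀ θ, g (orbR g σ 0 θ) * orbP g σ 0 θ = (√(σ * (g σ + σ * deriv g σ)))⁻¹ := by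
    intro θ
    have e : √(σ * (g σ + σ * deriv g σ)) = √((g σ + σ * deriv g σ) / 2) * √(2 * σ) := by
      rw [← Real.sqrt_mul (by positivity)]
      congr 1; ring
    rw [e]
    simp only [orbP, orbD, orbR, neg_zero, zero_mul, h.radR_zero, h.deriv_radR_zero]
    have h2 := Real.sqrt_pos.2 (by positivity : 0 < (g σ + σ * deriv g σ) / 2)
    generalize √((g σ + σ * deriv g σ) / 2) = q at *
    rw [hgσ]
    simp
    field_simp
  rw [windA]
  simp_rw [h1]
  rw [intervalIntegral.integral_const, smul_eq_mul, sub_zero,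
    inv_mul_cancel_left₀ Real.two_pi_pos.ne']

lemma windA_pos (h : Admissible g σ) (hA : |A| < maxAmp g σ) : 0 < windA g σ A := by
  refine mul_pos (inv_pos.2 Real.two_pi_pos) ?_
  have hc : Continuous fun θ => g (orbR g σ A θ) * orbP g σ A θ :=
    (h.smooth.continuousOn.comp_continuous (h.continuous_orbR.comp
      (Continuous.prodMk_right (⟨A, hA⟩ : {A : ℝ // |A| < maxAmp g σ})))
      fun θ => h.orbR_pos hA θ).mul (h.continuous_orbP_right hA)
  exact intervalIntegral.intervalIntegral_pos_of_pos (hc.intervalIntegrable _ _)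
    (fun θ => mul_pos (h.pos _ (h.orbR_pos hA θ)) (h.orbP_pos hA θ)) Real.two_pi_pos

lemma continuousAt_ampOf (h : Admissible g σ) {s : ℝ} (hs : 0 < s) :
    ContinuousAt (ampOf g σ) s := (h.hasDerivAt_rootV hs).continuousAt.neg

lemma continuousOn_netWinding (h : Admissible g σ) :
    ContinuousOn (fun s : ℝ => netWinding g (s : ℂ)) (Ioo 0 σ) := by
  have h1 : ContinuousOn (fun s => windA g σ (ampOf g σ s)) (Ioo 0 σ) :=
    h.continuousOn_windA.comp (fun s hs => (h.continuousAt_ampOf hs.1).continuousWithinAt)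
      fun s hs => h.abs_ampOf_lt hs
  exact h1.congr fun s hs => h.netWinding_eq_windA hs

lemma netWinding_pos (h : Admissible g σ) {s : ℝ} (hs : s ∈ Ioo 0 σ) :
    0 < netWinding g (s : ℂ) := by
  rw [h.netWinding_eq_windA hs]
  exact h.windA_pos (h.abs_ampOf_lt hs)

/-- The net winding tends to that of the linearisation at the fixed point `σ`. -/
lemma tendsto_netWinding_rad (h : Admissible g σ) :
    Tendsto (fun s : ℝ => netWinding g (s : ℂ)) (𝓝[<] σ)
      (𝓝 (√(σ * (g σ + σ * deriv g σ)))⁻¹) := by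
  have h0 : ampOf g σ σ = 0 := by rw [ampOf, rootV_rad, neg_zero]
  have h1 : ContinuousAt (windA g σ) (ampOf g σ σ) := by
    rw [h0]
    refine h.continuousOn_windA.continuousAt
      ((isOpen_lt continuous_abs continuous_const).mem_nhds ?_)
    simpa using h.maxAmp_pos
  have h2 := (ContinuousAt.comp (f := ampOf g σ) h1
      (h.continuousAt_ampOf h.rad_pos)).tendsto.mono_left
    (nhdsWithin_le_nhds (s := Iio σ))
  rw [Function.comp_apply, h0, h.windA_zero] at h2
  refine h2.congr' ?_
  filter_upwards [Ioo_mem_nhdsLT h.rad_pos] with s hs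
  exact (h.netWinding_eq_windA hs).symm

end Admissible

end PlanarCurvature

namespace PlanarCurvature

/-! ### Regular curves with a Jordan trace -/

lemma strictMonoOn_or_strictAntiOn_of_injOn {J : Set ℝ} (hJ : J.OrdConnected) {γ : ℝ → ℝ}
    (hc : ContinuousOn γ J) (hi : InjOn γ J) : StrictMonoOn γ J ∨ StrictAntiOn γ J := by
  by_contra hcon
  rw [not_or] at hcon
  simp only [StrictMonoOn, StrictAntiOn] at hcon
  push Not at hcon
  obtain ⟨⟨a, ha, b, hb, hab, h1⟩, c, hc', d, hd, hcd, h2⟩ := hcon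
  have hp : min a c ∈ J := by rcases min_choice a c with h | h <;> rw [h] <;> assumption
  have hq : max b d ∈ J := by rcases max_choice b d with h | h <;> rw [h] <;> assumption
  have hle : min a c ≤ max b d := (min_le_left a c).trans (hab.le.trans (le_max_left b d))
  have hsub := hJ.out hp hq
  have ma : a ∈ Icc (min a c) (max b d) := ⟨min_le_left _ _, hab.le.trans (le_max_left _ _)⟩
  have mb : b ∈ Icc (min a c) (max b d) := ⟨(min_le_left _ _).trans hab.le, le_max_left _ _⟩
  have mc : c ∈ Icc (min a c) (max b d) := ⟨min_le_right _ _, hcd.le.trans (le_max_right _ _)⟩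
  have md : d ∈ Icc (min a c) (max b d) := ⟨(min_le_right _ _).trans hcd.le, le_max_right _ _⟩
  rcases (hc.mono hsub).strictMonoOn_of_injOn_Icc' hle (hi.mono hsub) with h | h
  · exact absurd (h ma mb hab) (not_lt.2 h1)
  · exact absurd (h mc md hcd) (not_lt.2 h2)

lemma strictMonoOn_or_strictAntiOn_of_locally_injOn {J : Set ℝ} (hJ : J.OrdConnected)
    {γ : ℝ → ℝ} (hc : ContinuousOn γ J)
    (hi : ∀ t ∈ J, ∃ δ > 0, Icc (t - δ) (t + δ) ⊆ J ∧ InjOn γ (Icc (t - δ) (t + δ))) :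
    StrictMonoOn γ J ∨ StrictAntiOn γ J := by
  apply strictMonoOn_or_strictAntiOn_of_injOn hJ hc
  -- Two equal values enclose a local extremum, near which `γ` is not injective.
  have key : ∀ a ∈ J, ∀ b ∈ J, a < b → γ a ≠ γ b := by
    intro a ha b hb hab heq
    obtain ⟨x, hx, hext⟩ := exists_isLocalExtr_Ioo hab (hc.mono (hJ.out ha hb)) heq
    obtain ⟨δ, hδ, hsub, hinj⟩ := hi x (hJ.out ha hb ⟨hx.1.le, hx.2.le⟩)
    have hm := (hc.mono hsub).strictMonoOn_of_injOn_Icc' (by linarith) hinj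
    have hx0 : x ∈ Icc (x - δ) (x + δ) := ⟨by linarith, by linarith⟩
    have hr : ∃ᶠ y in 𝓝 x, y ∈ Ioo x (x + δ) :=
      (Eventually.frequently (Ioo_mem_nhdsGT (by linarith : x < x + δ))).filter_mono
          nhdsWithin_le_nhds
    have hl : ∃ᶠ y in 𝓝 x, y ∈ Ioo (x - δ) x :=
      (Eventually.frequently (Ioo_mem_nhdsLT (by linarith : x - δ < x))).filter_mono
          nhdsWithin_le_nhds
    rcases hext with he | he
    · obtain ⟨y, hy, hy'⟩ := (hr.and_eventually he).exists
      obtain ⟨z, hz, hz'⟩ := (hl.and_eventually he).exists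
      rcases hm with h | h
      · exact absurd (h ⟨hz.1.le, by linarith [hz.2]⟩ hx0 hz.2) (not_lt.2 hz')
      · exact absurd (h hx0 ⟨by linarith [hy.1], hy.2.le⟩ hy.1) (not_lt.2 hy')
    · obtain ⟨y, hy, hy'⟩ := (hr.and_eventually he).exists
      obtain ⟨z, hz, hz'⟩ := (hl.and_eventually he).exists
      rcases hm with h | h
      · exact absurd (h hx0 ⟨by linarith [hy.1], hy.2.le⟩ hy.1) (not_lt.2 hy')
      · exact absurd (h ⟨hz.1.le, by linarith [hz.2]⟩ hx0 hz.2) (not_lt.2 hz')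
  intro a ha b hb heq
  by_contra hne
  rcases lt_or_gt_of_ne hne with h | h
  · exact key a ha b hb h heq
  · exact key b hb a ha h heq.symm

lemma exists_Icc_subset {J : Set ℝ} (hJ : IsOpen J) {t : ℝ} (ht : t ∈ J) :
    ∃ δ > 0, Icc (t - δ) (t + δ) ⊆ J := by
  obtain ⟨δ, hδ, h⟩ := Metric.isOpen_iff.1 hJ t ht
  refine ⟨δ / 2, by positivity, fun x hx => h ?_⟩
  rw [Metric.mem_ball, Real.dist_eq, abs_lt]
  constructor <;> linarith [hx.1, hx.2]

lemma exists_injOn_Icc {J : Set ℝ} (hJ : IsOpen J) {c d : ℝ → ℂ}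
    (hc : ∀ t ∈ J, HasDerivAt c (d t) t) (hd : ContinuousOn d J) (hd1 : ∀ t ∈ J, ‖d t‖ = 1)
    {t : ℝ} (ht : t ∈ J) :
    ∃ δ > 0, Icc (t - δ) (t + δ) ⊆ J ∧ InjOn c (Icc (t - δ) (t + δ)) := by
  -- The component of `c` in the direction `d t` is strictly increasing near `t`.
  have hφ : ∀ s ∈ J, HasDerivAt (fun s => ((starRingEnd ℂ) (d t) * c s).re)
      ((starRingEnd ℂ) (d t) * d s).re s := fun s hs => by
    have := Complex.reCLM.hasFDerivAt.comp_hasDerivAt s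
        ((hc s hs).const_mul ((starRingEnd ℂ) (d t)))
    simpa [Function.comp_def] using this
  have hpos : ∀ᶠ s in 𝓝 t, 0 < ((starRingEnd ℂ) (d t) * d s).re := by
    have hcont : ContinuousAt (fun s => ((starRingEnd ℂ) (d t) * d s).re) t :=
      Complex.continuous_re.continuousAt.comp
        (continuousAt_const.mul (hd.continuousAt (hJ.mem_nhds ht)))
    apply hcont.eventually_const_lt
    change 0 < ((starRingEnd ℂ) (d t) * d t).re
    rw [← Complex.normSq_eq_conj_mul_self, Complex.ofReal_re, Complex.normSq_eq_norm_sq, hd1 t ht]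
    norm_num
  obtain ⟨δ, hδ, hδ'⟩ := exists_Icc_subset
      (isOpen_interior (s := J ∩ {s | 0 < ((starRingEnd ℂ) (d t) * d s).re}))
    (mem_interior_iff_mem_nhds.2 (inter_mem (hJ.mem_nhds ht) hpos))
  have hsub : ∀ s ∈ Icc (t - δ) (t + δ), s ∈ J ∧ 0 < ((starRingEnd ℂ) (d t) * d s).re :=
    fun s hs => (interior_subset (hδ' hs) : s ∈ J ∩ {s | 0 < ((starRingEnd ℂ) (d t) * d s).re})
  refine ⟨δ, hδ, fun s hs => (hsub s hs).1, ?_⟩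
  have hm : StrictMonoOn (fun s => ((starRingEnd ℂ) (d t) * c s).re) (Icc (t - δ) (t + δ)) := by
    apply strictMonoOn_of_deriv_pos (convex_Icc _ _)
    · exact fun s hs => (hφ s (hsub s hs).1).continuousAt.continuousWithinAt
    · intro s hs
      have hs := interior_subset hs
      rw [(hφ s (hsub s hs).1).deriv]
      exact (hsub s hs).2
  intro x hx y hy hxy
  exact hm.injOn hx hy (by simp only [hxy])

/-- A curve with values in a Jordan curve has a continuous angular coordinate. -/
lemma exists_angle_of_homeomorph {J : Set ℝ} (hJ : IsOpen J) (hJ' : J.OrdConnected)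
    (hne : J.Nonempty) {c : ℝ → ℂ} (hc : ContinuousOn c J) (e : (c '' J) ≃ₜ Circle) :
    ∃ γ : ℝ → ℝ, ContinuousOn γ J ∧
      (∀ s ∈ J, ∀ t ∈ J, c s = c t ↔ ∃ k : ℤ, γ s = γ t + k * (2 * Real.pi)) ∧
      (∀ a : ℝ, ∃ t ∈ J, ∃ k : ℤ, γ t = a + k * (2 * Real.pi)) := by
  have hcv : Convex ℝ J := hJ'.convex
  have : ContractibleSpace J := hcv.contractibleSpace hne
  have : LocallyPathConnectedSpace J := hJ.locallyPathConnectedSpace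
  obtain ⟨t₀, ht₀⟩ := hne
  let E : C(J, Circle) := ⟨fun t => e ⟨c t, mem_image_of_mem c t.2⟩,
    e.continuous.comp (hc.domRestrict.subtype_mk _)⟩
  obtain ⟨a₀, ha₀⟩ := Circle.exp_surjective (E ⟨t₀, ht₀⟩)
  obtain ⟨Γ, ⟨-, hΓ⟩, -⟩ := Circle.isCoveringMap_exp.existsUnique_continuousMap_lifts E ⟨t₀, ht₀⟩
    a₀ ha₀
  have hΓ' : ∀ t : J, Circle.exp (Γ t) = e ⟨c t, mem_image_of_mem c t.2⟩ :=
    fun t => congrFun hΓ t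
  classical
  have hγ : ∀ t (ht : t ∈ J), (fun t => if ht : t ∈ J then Γ ⟨t, ht⟩ else 0) t = Γ ⟨t, ht⟩ :=
    fun t ht => dif_pos ht
  refine ⟨fun t => if ht : t ∈ J then Γ ⟨t, ht⟩ else 0, ?_, ?_, ?_⟩
  · rw [continuousOn_iff_continuous_domRestrict]
    refine Γ.continuous.congr fun t => ?_
    exact (hγ t t.2).symm
  · intro s hs t ht
    rw [hγ s hs, hγ t ht, ← Circle.exp_eq_exp, hΓ', hΓ', e.injective.eq_iff, Subtype.mk_eq_mk]
  · intro a
    obtain ⟨⟨z, t, ht, rfl⟩, hz⟩ := e.surjective (Circle.exp a)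
    refine ⟨t, ht, ?_⟩
    rw [hγ t ht, ← Circle.exp_eq_exp, hΓ', hz]

/-- A continuous increasing function on an open interval whose values represent all classes
modulo `2π` takes two values that differ by `2π`. -/
lemma exists_add_two_pi {J : Set ℝ} (hJ : IsOpen J) (hJ' : J.OrdConnected) (hne : J.Nonempty)
    {γ : ℝ → ℝ} (hc : ContinuousOn γ J) (hm : StrictMonoOn γ J)
    (hs : ∀ a : ℝ, ∃ t ∈ J, ∃ k : ℤ, γ t = a + k * (2 * Real.pi)) :
    ∃ t₀ ∈ J, ∃ t₁ ∈ J, t₀ < t₁ ∧ γ t₁ = γ t₀ + 2 * Real.pi := by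
  have hpi := Real.two_pi_pos
  -- It suffices that the values have diameter at least `2π`.
  suffices ∃ s ∈ J, ∃ t ∈ J, γ s + 2 * Real.pi ≤ γ t by
    obtain ⟨s, hs, t, ht, hst⟩ := this
    have hlt : s < t := (hm.lt_iff_lt hs ht).1 (by linarith)
    obtain ⟨t₁, ht₁, h1⟩ := intermediate_value_Icc hlt.le (hc.mono (hJ'.out hs ht))
      (show γ s + 2 * Real.pi ∈ Icc _ _ from ⟨by linarith, hst⟩)
    have ht₁J := hJ'.out hs ht ht₁
    exact ⟨s, hs, t₁, ht₁J, (hm.lt_iff_lt hs ht₁J).1 (by linarith), h1⟩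
  by_contra! hcon
  have hbdd : BddAbove (γ '' J) := by
    obtain ⟨s, hs⟩ := hne
    refine ⟨γ s + 2 * Real.pi, ?_⟩
    rintro _ ⟨t, ht, rfl⟩
    exact (hcon s hs t ht).le
  obtain ⟨t, ht, k, hk⟩ := hs (sSup (γ '' J))
  have hlt : ∀ x ∈ J, γ x < sSup (γ '' J) := by
    intro x hx
    obtain ⟨δ, hδ, hsub⟩ := exists_Icc_subset hJ hx
    have hxδ : x + δ ∈ J := hsub ⟨by linarith, le_rfl⟩
    exact (hm hx hxδ (by linarith)).trans_le (le_csSup hbdd (mem_image_of_mem γ hxδ))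
  have hk1 : (k : ℝ) ≤ -1 := by
    have h1 := hlt t ht
    have h2 : (k : ℝ) < 0 := by
      by_contra h3
      nlinarith [not_lt.1 h3]
    have h3 : k < 0 := by exact_mod_cast h2
    exact_mod_cast (by omega : k ≤ -1)
  obtain ⟨δ, hδ, hsub⟩ := exists_Icc_subset hJ ht
  have htδ : t - δ ∈ J := hsub ⟨le_rfl, by linarith⟩
  have h4 : γ (t - δ) < sSup (γ '' J) - 2 * Real.pi := by
    have := hm htδ ht (by linarith)
    nlinarith
  obtain ⟨_, ⟨x, hx, rfl⟩, h5⟩ := exists_lt_of_lt_csSup (hne.image γ)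
    (by linarith : γ (t - δ) + 2 * Real.pi < sSup (γ '' J))
  exact absurd (hcon _ htδ x hx) (not_lt.2 h5.le)

/-- A unit-speed curve that follows itself after a reparametrization follows itself at a constant
delay. -/
lemma shift_const_of_comp_eq {J N : Set ℝ} (hN : IsOpen N) (hN' : IsPreconnected N) {c d : ℝ → ℂ}
    (hc : ∀ t ∈ J, HasDerivAt c (d t) t) (hd1 : ∀ t ∈ J, ‖d t‖ = 1) (hNJ : N ⊆ J)
    {τ : ℝ → ℝ} (hτJ : MapsTo τ N J) (hτc : ContinuousOn τ N) (hτm : StrictMonoOn τ N)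
    (hτ : ∀ t ∈ N, c (τ t) = c t) {s t : ℝ} (hs : s ∈ N) (ht : t ∈ N) : τ s - s = τ t - t := by
  have hder : ∀ x ∈ N, HasDerivAt τ 1 x := by
    intro x hx
    rw [hasDerivAt_iff_tendsto_slope]
    have h1 := (hasDerivAt_iff_tendsto_slope.1 (hc x (hNJ hx))).norm
    have hτx : Tendsto τ (𝓝[≠] x) (𝓝[≠] (τ x)) := by
      apply tendsto_nhdsWithin_of_tendsto_nhds_of_eventually_within
      · exact (hτc.continuousAt (hN.mem_nhds hx)).tendsto.mono_left nhdsWithin_le_nhds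
      · filter_upwards [self_mem_nhdsWithin, nhdsWithin_le_nhds (hN.mem_nhds hx)] with y hy hyN
        exact fun h => hy (hτm.injOn hyN hx h)
    have h2 := ((hasDerivAt_iff_tendsto_slope.1 (hc (τ x) (hτJ hx))).comp hτx).norm
    have h3 := h1.div h2 (by rw [hd1 _ (hτJ hx)]; exact one_ne_zero)
    rw [hd1 _ (hτJ hx), hd1 _ (hNJ hx), div_one] at h3
    refine h3.congr' ?_
    filter_upwards [self_mem_nhdsWithin, nhdsWithin_le_nhds (hN.mem_nhds hx),
      (hasDerivAt_iff_tendsto_slope.1 (hc x (hNJ hx))).eventually_ne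
        (norm_ne_zero_iff.1 (by rw [hd1 x (hNJ hx)]; exact one_ne_zero))] with y hy hyN hne
    have hy : y ≠ x := hy
    have h4 : c y - c x ≠ 0 := fun h => hne (by rw [slope_def_module, h, smul_zero])
    have hyx : y - x ≠ 0 := sub_ne_zero.2 hy
    have hτyx : τ y - τ x ≠ 0 := sub_ne_zero.2 fun h => hy (hτm.injOn hyN hx h)
    have hpos : 0 < (τ y - τ x) / (y - x) := by
      rcases lt_or_gt_of_ne hy with h | h
      · exact div_pos_of_neg_of_neg (by linarith [hτm hyN hx h]) (by linarith)
      · exact div_pos (by linarith [hτm hx hyN h]) (by linarith)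
    simp only [Pi.div_apply, Function.comp_apply]
    rw [slope_def_module, slope_def_module, slope_def_field, hτ y hyN, hτ x hx, norm_smul,
        norm_smul,
      ← abs_of_pos hpos, abs_div, norm_inv, norm_inv, Real.norm_eq_abs, Real.norm_eq_abs]
    have := norm_ne_zero_iff.2 h4
    have := abs_ne_zero.2 hyx
    have := abs_ne_zero.2 hτyx
    field_simp
  refine hN.is_const_of_deriv_eq_zero (f := fun x => τ x - x) hN' ?_ ?_ hs ht
  · exact fun x hx => ((hder x hx).fun_sub
        (hasDerivAt_id' x)).differentiableAt.differentiableWithinAt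
  · intro x hx
    rw [((hder x hx).fun_sub (hasDerivAt_id' x)).deriv]
    simp

/-- A regular curve whose trace is homeomorphic to the circle runs through its trace periodically:
on some interval `[t₀, t₀ + L[` it is a bijection onto the trace, and it continues past `t₀ + L`
as it started at `t₀`. -/
lemma exists_period_of_homeomorph {J : Set ℝ} (hJ : IsOpen J) (hJ' : J.OrdConnected)
    (hne : J.Nonempty) {c d : ℝ → ℂ} (hc : ∀ t ∈ J, HasDerivAt c (d t) t) (hd : ContinuousOn d J)
    (hd1 : ∀ t ∈ J, ‖d t‖ = 1) (e : (c '' J) ≃ₜ Circle) :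
    ∃ t₀ L δ : ℝ, 0 < L ∧ 0 < δ ∧ Ioo (t₀ - δ) (t₀ + L + δ) ⊆ J ∧
      (∀ t ∈ Ioo (t₀ - δ) (t₀ + δ), c (t + L) = c t) ∧ c '' Ico t₀ (t₀ + L) = c '' J ∧
      InjOn c (Ico t₀ (t₀ + L)) := by
  have hpi := Real.two_pi_pos
  have hcc : ContinuousOn c J := fun t ht => (hc t ht).continuousAt.continuousWithinAt
  obtain ⟨γ, hγ, hiff, hsurj, hm⟩ : ∃ γ : ℝ → ℝ, ContinuousOn γ J ∧
      (∀ s ∈ J, ∀ t ∈ J, c s = c t ↔ ∃ k : ℤ, γ s = γ t + k * (2 * Real.pi)) ∧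
      (∀ a : ℝ, ∃ t ∈ J, ∃ k : ℤ, γ t = a + k * (2 * Real.pi)) ∧ StrictMonoOn γ J := by
    obtain ⟨γ, hγ, hiff, hsurj⟩ := exists_angle_of_homeomorph hJ hJ' hne hcc e
    have hm := strictMonoOn_or_strictAntiOn_of_locally_injOn hJ' hγ fun t ht => by
      obtain ⟨δ, hδ, hsub, hinj⟩ := exists_injOn_Icc hJ hc hd hd1 ht
      refine ⟨δ, hδ, hsub, fun x hx y hy hxy => hinj hx hy ?_⟩
      exact (hiff x (hsub hx) y (hsub hy)).2 ⟨0, by simp [hxy]⟩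
    rcases hm with hm | hm
    · exact ⟨γ, hγ, hiff, hsurj, hm⟩
    · refine ⟨fun t => -γ t, hγ.neg, fun s hs t ht => ?_, fun a => ?_, fun x hx y hy hxy =>
        neg_lt_neg (hm hx hy hxy)⟩
      · rw [hiff s hs t ht]
        constructor
        · rintro ⟨k, hk⟩
          exact ⟨-k, by push_cast; linarith⟩
        · rintro ⟨k, hk⟩
          exact ⟨-k, by push_cast; linarith⟩
      · obtain ⟨t, ht, k, hk⟩ := hsurj (-a)
        exact ⟨t, ht, -k, by push_cast; linarith⟩
  obtain ⟨t₀, ht₀, t₁, ht₁, hlt, h01⟩ := exists_add_two_pi hJ hJ' hne hγ hm hsurj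
  obtain ⟨δ₀, hδ₀, hsub₀⟩ := exists_Icc_subset hJ ht₀
  obtain ⟨δ₁, hδ₁, hsub₁⟩ := exists_Icc_subset hJ ht₁
  have m₁ : t₁ - δ₁ ∈ J := hsub₁ ⟨le_rfl, by linarith⟩
  have m₂ : t₁ + δ₁ ∈ J := hsub₁ ⟨by linarith, le_rfl⟩
  -- Near `t₀` the angle can be raised by a full turn within the curve.
  have hev : ∀ᶠ t in 𝓝 t₀, γ t + 2 * Real.pi ∈ Ioo (γ (t₁ - δ₁)) (γ (t₁ + δ₁)) := by
    have hcont : ContinuousAt (fun t => γ t + 2 * Real.pi) t₀ :=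
      (hγ.continuousAt (hJ.mem_nhds ht₀)).add continuousAt_const
    apply hcont.eventually_mem
    apply Ioo_mem_nhds
    · rw [← h01]; exact hm m₁ ht₁ (by linarith)
    · rw [← h01]; exact hm ht₁ m₂ (by linarith)
  obtain ⟨δ, hδ, hball⟩ := Metric.eventually_nhds_iff_ball.1 hev
  set N := Ioo (t₀ - min δ (min δ₀ δ₁)) (t₀ + min δ (min δ₀ δ₁)) with hN
  have hη : 0 < min δ (min δ₀ δ₁) := lt_min hδ (lt_min hδ₀ hδ₁)
  have hη0 : min δ (min δ₀ δ₁) ≤ δ := min_le_left _ _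
  have hη1 : min δ (min δ₀ δ₁) ≤ δ₀ := (min_le_right _ _).trans (min_le_left _ _)
  have hη2 : min δ (min δ₀ δ₁) ≤ δ₁ := (min_le_right _ _).trans (min_le_right _ _)
  have hNJ : N ⊆ J := fun t ht => hsub₀ ⟨by linarith [ht.1], by linarith [ht.2]⟩
  have hex : ∀ t ∈ N, ∃ x ∈ Icc (t₁ - δ₁) (t₁ + δ₁), γ x = γ t + 2 * Real.pi := by
    intro t ht
    have h1 := hball t (by
      rw [Metric.mem_ball, Real.dist_eq, abs_lt]
      constructor <;> linarith [ht.1, ht.2])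
    exact intermediate_value_Icc (by linarith) (hγ.mono hsub₁) ⟨h1.1.le, h1.2.le⟩
  choose! τ hτ1 hτ2 using hex
  have hτJ : MapsTo τ N J := fun t ht => hsub₁ (hτ1 t ht)
  have hτm : StrictMonoOn τ N := by
    intro x hx y hy hxy
    rw [← hm.lt_iff_lt (hτJ hx) (hτJ hy), hτ2 x hx, hτ2 y hy]
    linarith [hm (hNJ hx) (hNJ hy) hxy]
  have ht₀N : t₀ ∈ N := ⟨by linarith, by linarith⟩
  have hτc : ContinuousOn τ N := by
    intro t ht
    apply ContinuousAt.continuousWithinAt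
    have hγt : Tendsto (fun s => γ s + 2 * Real.pi) (𝓝 t) (𝓝 (γ (τ t))) := by
      rw [hτ2 t ht]
      exact (hγ.continuousAt (hJ.mem_nhds (hNJ ht))).add continuousAt_const
    have hNt : N ∈ 𝓝 t := isOpen_Ioo.mem_nhds ht
    obtain ⟨ε, hε, hεJ⟩ := exists_Icc_subset hJ (hτJ ht)
    rw [ContinuousAt, tendsto_order]
    constructor
    · intro a ha
      have hb : max a (τ t - ε) ∈ J := hεJ ⟨le_max_right _ _, max_le (by linarith) (by linarith)⟩
      have hb' : max a (τ t - ε) < τ t := max_lt ha (by linarith)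
      filter_upwards [hγt.eventually_const_lt (hm hb (hτJ ht) hb'), hNt] with s hs hsN
      rw [← hτ2 s hsN, hm.lt_iff_lt hb (hτJ hsN)] at hs
      exact (le_max_left _ _).trans_lt hs
    · intro a ha
      have hb : min a (τ t + ε) ∈ J := hεJ ⟨le_min (by linarith) (by linarith), min_le_right _ _⟩
      have hb' : τ t < min a (τ t + ε) := lt_min ha (by linarith)
      filter_upwards [hγt.eventually_lt_const (hm (hτJ ht) hb hb'), hNt] with s hs hsN
      rw [← hτ2 s hsN, hm.lt_iff_lt (hτJ hsN) hb] at hs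
      exact hs.trans_le (min_le_left _ _)
  have hcτ : ∀ t ∈ N, c (τ t) = c t := fun t ht =>
    (hiff _ (hτJ ht) t (hNJ ht)).2 ⟨1, by rw [hτ2 t ht]; simp⟩
  have hτ0 : τ t₀ = t₁ := hm.injOn (hτJ ht₀N) ht₁ (by rw [hτ2 t₀ ht₀N, h01])
  refine ⟨t₀, t₁ - t₀, min δ (min δ₀ δ₁), by linarith, hη, ?_, ?_, ?_, ?_⟩
  · intro t ht
    have h1 : t₀ - δ₀ ∈ J := hsub₀ ⟨le_rfl, by linarith⟩
    exact hJ'.out h1 m₂ ⟨by linarith [ht.1], by linarith [ht.2]⟩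
  · intro t ht
    have h1 := shift_const_of_comp_eq isOpen_Ioo isPreconnected_Ioo hc hd1 hNJ hτJ hτc hτm hcτ
      ht ht₀N
    rw [hτ0] at h1
    rw [← h1, ← hcτ t ht]
    congr 1; ring
  · rw [add_sub_cancel]
    refine (image_mono fun t ht => hJ'.out ht₀ ht₁ ⟨ht.1, ht.2.le⟩).antisymm ?_
    rintro _ ⟨t, ht, rfl⟩
    have h1 := toIcoMod_mem_Ico hpi (γ t₀) (γ t)
    rw [← h01] at h1
    obtain ⟨x, hx, hx'⟩ := intermediate_value_Ico hlt.le (hγ.mono (hJ'.out ht₀ ht₁)) h1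
    refine ⟨x, hx, ?_⟩
    rw [hiff x (hJ'.out ht₀ ht₁ ⟨hx.1, hx.2.le⟩) t ht]
    refine ⟨-toIcoDiv hpi (γ t₀) (γ t), ?_⟩
    have h2 := toIcoMod_add_toIcoDiv_zsmul hpi (γ t₀) (γ t)
    rw [zsmul_eq_mul] at h2
    rw [hx']
    push_cast
    linarith
  · rw [add_sub_cancel]
    intro x hx y hy hxy
    have hxJ := hJ'.out ht₀ ht₁ ⟨hx.1, hx.2.le⟩
    have hyJ := hJ'.out ht₀ ht₁ ⟨hy.1, hy.2.le⟩
    obtain ⟨k, hk⟩ := (hiff x hxJ y hyJ).1 hxy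
    have x1 := hm.monotoneOn ht₀ hxJ hx.1
    have x2 := hm hxJ ht₁ hx.2
    have y1 := hm.monotoneOn ht₀ hyJ hy.1
    have y2 := hm hyJ ht₁ hy.2
    have hk1 : (k : ℝ) < 1 := by
      by_contra h
      nlinarith [not_lt.1 h]
    have hk2 : (-1 : ℝ) < k := by
      by_contra h
      nlinarith [not_lt.1 h]
    have hk0 : k = 0 := by
      have a1 : k < 1 := by exact_mod_cast hk1
      have a2 : -1 < k := by exact_mod_cast hk2
      omega
    rw [hk0, Int.cast_zero, zero_mul, add_zero] at hk
    exact hm.injOn hxJ hyJ hk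

end PlanarCurvature

namespace PlanarCurvature

/-! ### Solutions in the moving frame -/

/-- The part of the notion of solution that the classification uses: `c` has unit tangent vector
`e^{iϑ}`, and `ϑ' = g(|c|)` away from `0`. -/
structure IsArc (g : ℝ → ℝ) (J : Set ℝ) (c : ℝ → ℂ) (ϑ : ℝ → ℝ) : Prop where
  hasDerivAt : ∀ t ∈ J, HasDerivAt c (Complex.exp (ϑ t * Complex.I)) t
  continuousOn : ContinuousOn ϑ J
  hasDerivAt_angle : ∀ t ∈ J, c t ≠ 0 → HasDerivAt ϑ (g ‖c t‖) t

/-- The position vector in the moving frame, turned and reflected so as to be a solution of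
`ż = i z f(|z|) - i`. -/
noncomputable def comoving (c : ℝ → ℂ) (ϑ : ℝ → ℝ) (t : ℝ) : ℂ :=
  -Complex.I * (starRingEnd ℂ) (c t) * Complex.exp (ϑ t * Complex.I)

/-- The first integral `G(|c|) - Re u` of the solutions. -/
noncomputable def energy (g : ℝ → ℝ) (c : ℝ → ℂ) (ϑ : ℝ → ℝ) (t : ℝ) : ℝ :=
  potG g ‖c t‖ - (comoving c ϑ t).re

variable {g : ℝ → ℝ} {σ : ℝ} {J : Set ℝ} {c : ℝ → ℂ} {ϑ : ℝ → ℝ}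

lemma conj_exp_mul_I (x : ℝ) :
    (starRingEnd ℂ) (Complex.exp (x * Complex.I)) = Complex.exp (-(x * Complex.I)) := by
  rw [← Complex.exp_conj, map_mul, Complex.conj_ofReal, Complex.conj_I, mul_neg]

lemma exp_mul_exp_neg (z : ℂ) : Complex.exp z * Complex.exp (-z) = 1 := by
  rw [← Complex.exp_add, add_neg_cancel, Complex.exp_zero]

lemma norm_comoving (t : ℝ) : ‖comoving c ϑ t‖ = ‖c t‖ := by
  simp [comoving, Complex.norm_exp_ofReal_mul_I]

lemma comoving_ne_zero {t : ℝ} (h : c t ≠ 0) : comoving c ϑ t ≠ 0 := by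
  rwa [← norm_ne_zero_iff, norm_comoving, norm_ne_zero_iff]

lemma eq_of_comoving (t : ℝ) :
    c t = -Complex.I * (starRingEnd ℂ) (comoving c ϑ t) * Complex.exp (ϑ t * Complex.I) := by
  simp only [comoving, map_mul, map_neg, Complex.conj_I, Complex.conj_conj, conj_exp_mul_I]
  linear_combination (c t) * Complex.I ^ 2 * exp_mul_exp_neg (ϑ t * Complex.I) +
    (c t) * Complex.I_sq

lemma hasDerivAt_exp_mul_I {κ t : ℝ} (h : HasDerivAt ϑ κ t) :
    HasDerivAt (fun t => Complex.exp (ϑ t * Complex.I))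
      (Complex.exp (ϑ t * Complex.I) * (κ * Complex.I)) t :=
  (h.ofReal_comp.mul_const Complex.I).cexp

lemma IsArc.mono {J' : Set ℝ} (h : IsArc g J c ϑ) (hJ : J' ⊆ J) : IsArc g J' c ϑ :=
  ⟨fun t ht => h.hasDerivAt t (hJ ht), h.continuousOn.mono hJ,
    fun t ht => h.hasDerivAt_angle t (hJ ht)⟩

lemma IsArc.continuousOn_curve (h : IsArc g J c ϑ) : ContinuousOn c J :=
  fun t ht => (h.hasDerivAt t ht).continuousAt.continuousWithinAt

lemma IsArc.hasDerivAt_comoving (h : IsArc g J c ϑ) {t : ℝ} (ht : t ∈ J) (h0 : c t ≠ 0) :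
    HasDerivAt (comoving c ϑ) (flowField g (comoving c ϑ t)) t := by
  have h1 := (h.hasDerivAt t ht).star
  have h2 := (h1.const_mul (-Complex.I)).fun_mul (hasDerivAt_exp_mul_I (h.hasDerivAt_angle t ht h0))
  refine h2.congr_deriv ?_
  rw [flowField, norm_comoving, comoving]
  simp only [RCLike.star_def, conj_exp_mul_I]
  linear_combination (-Complex.I) * exp_mul_exp_neg (ϑ t * Complex.I)

lemma IsArc.flow (h : IsArc g J c ϑ) (h0 : ∀ t ∈ J, c t ≠ 0) (t : ℝ) (ht : t ∈ J) :
    comoving c ϑ t ≠ 0 ∧ HasDerivAt (comoving c ϑ) (flowField g (comoving c ϑ t)) t :=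
  ⟨comoving_ne_zero (h0 t ht), h.hasDerivAt_comoving ht (h0 t ht)⟩

lemma IsArc.continuousOn_comoving (h : IsArc g J c ϑ) : ContinuousOn (comoving c ϑ) J := by
  have h1 := h.continuousOn_curve
  have h2 := h.continuousOn
  have h3 : ContinuousOn (fun t => (ϑ t : ℂ)) J := Complex.continuous_ofReal.comp_continuousOn h2
  exact (continuousOn_const.mul (Complex.continuous_conj.comp_continuousOn h1)).mul
    (h3.mul continuousOn_const).cexp

lemma countable_of_eventually_notMem {X : Type*} [TopologicalSpace X] [SecondCountableTopology X]
    {S : Set X} (h : ∀ x ∈ S, ∀ᶠ y in 𝓝[≠] x, y ∉ S) : S.Countable := by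
  have : DiscreteTopology S := by
    rw [discreteTopology_subtype_iff]
    intro x hx
    rw [inf_principal_eq_bot]
    exact h x hx
  rw [← countable_coe_iff]
  exact TopologicalSpace.separableSpace_iff_countable.1 inferInstance

lemma IsArc.countable_zeros (h : IsArc g J c ϑ) : {t | t ∈ J ∧ c t = 0}.Countable := by
  apply countable_of_eventually_notMem
  rintro t ⟨ht, -⟩
  filter_upwards [(h.hasDerivAt t ht).eventually_ne (c := 0) (Complex.exp_ne_zero _)] with s hs hs'
  exact hs hs'.2

namespace Admissible

/-- Conservation of energy, for flow lines. -/
lemma hasDerivAt_flow_energy (h : Admissible g σ) {u : ℝ → ℂ} {t : ℝ} (h0 : u t ≠ 0)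
    (hu : HasDerivAt u (flowField g (u t)) t) :
    HasDerivAt (fun t => potG g ‖u t‖ - (u t).re) 0 t := by
  have hn : 0 < ‖u t‖ := norm_pos_iff.2 h0
  have h1 := hu.norm_sq.sqrt (by positivity)
  simp only [Real.sqrt_sq (norm_nonneg _)] at h1
  have h2 := (h.hasDerivAt_potG hn).comp t h1
  have h3 : HasDerivAt (fun t => (u t).re) (flowField g (u t)).re t := by
    have := Complex.reCLM.hasFDerivAt.comp_hasDerivAt t hu
    simpa [Function.comp_def] using this
  refine (h2.fun_sub h3).congr_deriv ?_
  rw [flowField]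
  simp [Complex.inner]
  field_simp
  ring

lemma energy_eq (h : Admissible g σ) (hJ' : J.OrdConnected) (ha : IsArc g J c ϑ) {s t : ℝ}
    (hs : s ∈ J) (ht : t ∈ J) : energy g c ϑ s = energy g c ϑ t := by
  have hc : ContinuousOn (energy g c ϑ) J := by
    refine ContinuousOn.sub (h.continuousOn_potG.comp ha.continuousOn_curve.norm
      fun t _ => norm_nonneg _) ?_
    exact Complex.continuous_re.comp_continuousOn ha.continuousOn_comoving
  have hder : ∀ x ∈ J, c x ≠ 0 → HasDerivAt (energy g c ϑ) 0 x := by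
    intro x hx h0
    have := h.hasDerivAt_flow_energy (comoving_ne_zero h0) (ha.hasDerivAt_comoving hx h0)
    simp only [norm_comoving] at this
    exact this
  have hsub : uIcc s t ⊆ J := hJ'.uIcc_subset hs ht
  have := MeasureTheory.integral_eq_of_hasDerivAt_off_countable (energy g c ϑ) (fun _ => 0)
    (a := s) (b := t) ha.countable_zeros (hc.mono hsub) (fun x hx => ?_)
    intervalIntegrable_const
  · rw [intervalIntegral.integral_zero] at this
    linarith
  · have hxJ := hsub ⟨hx.1.1.le, hx.1.2.le⟩
    exact hder x hxJ fun h0 => hx.2 ⟨hxJ, h0⟩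

lemma _root_.PlanarCurvature.potF_le_energy (t : ℝ) : potF g ‖c t‖ ≤ energy g c ϑ t := by
  have := Complex.re_le_norm (comoving c ϑ t)
  rw [norm_comoving] at this
  rw [energy, potF]
  linarith

lemma rad_energy_le (h : Admissible g σ) (t : ℝ) : potF g σ ≤ energy g c ϑ t :=
  (h.potF_rad_le (norm_nonneg _)).trans (potF_le_energy t)

/-- Two solutions with the same motion in the moving frame differ by a rotation about `0`. -/
lemma eq_rotation (hJ : IsOpen J) (hJ' : J.OrdConnected) {c' : ℝ → ℂ} {ϑ' : ℝ → ℝ}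
    (ha : IsArc g J c ϑ) (ha' : IsArc g J c' ϑ') (h0 : ∀ t ∈ J, c t ≠ 0)
    (he : ∀ t ∈ J, comoving c ϑ t = comoving c' ϑ' t) {t₀ : ℝ} (ht₀ : t₀ ∈ J) {t : ℝ}
    (ht : t ∈ J) : ϑ t - ϑ' t = ϑ t₀ - ϑ' t₀ ∧
      c t = Complex.exp (((ϑ t₀ - ϑ' t₀ : ℝ) : ℂ) * Complex.I) * c' t := by
  have hn : ∀ t ∈ J, ‖c t‖ = ‖c' t‖ := fun t ht => by
    rw [← norm_comoving (ϑ := ϑ), he t ht, norm_comoving]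
  have hd : ∀ t ∈ J, HasDerivAt (fun t => ϑ t - ϑ' t) 0 t := by
    intro t ht
    have h1 := ha.hasDerivAt_angle t ht (h0 t ht)
    have h2 := ha'.hasDerivAt_angle t ht
      (norm_ne_zero_iff.1 (by rw [← hn t ht]; exact norm_ne_zero_iff.2 (h0 t ht)))
    rw [← hn t ht] at h2
    simpa using h1.fun_sub h2
  have h1 : ϑ t - ϑ' t = ϑ t₀ - ϑ' t₀ :=
    hJ.is_const_of_deriv_eq_zero (f := fun t => ϑ t - ϑ' t) hJ'.isPreconnected
      (fun x hx => (hd x hx).differentiableAt.differentiableWithinAt)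
      (fun x hx => (hd x hx).deriv) ht ht₀
  refine ⟨h1, ?_⟩
  rw [← h1, eq_of_comoving (c := c) (ϑ := ϑ) t, eq_of_comoving (c := c') (ϑ := ϑ') t, he t ht]
  have h2 : Complex.exp (ϑ t * Complex.I) =
      Complex.exp (((ϑ t - ϑ' t : ℝ) : ℂ) * Complex.I) * Complex.exp (ϑ' t * Complex.I) := by
    rw [← Complex.exp_add]
    congr 1
    push_cast
    ring
  rw [h2]
  ring

lemma isArc_reflect {t₀ : ℝ} (hsymm : ∀ t ∈ J, 2 * t₀ - t ∈ J) (ha : IsArc g J c ϑ) :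
    IsArc g J (fun t => -(starRingEnd ℂ) (c (2 * t₀ - t))) (fun t => -ϑ (2 * t₀ - t)) := by
  have hr : ∀ t, HasDerivAt (fun t => 2 * t₀ - t) (-1) t := fun t => by
    simpa using (hasDerivAt_id' t).const_sub (2 * t₀)
  refine ⟨fun t ht => ?_, ?_, fun t ht h0 => ?_⟩
  · have h1 := ((ha.hasDerivAt _ (hsymm t ht)).scomp t (hr t)).star.fun_neg
    refine h1.congr_deriv ?_
    simp only [RCLike.star_def, neg_smul, one_smul, map_neg, neg_neg, conj_exp_mul_I,
      Complex.ofReal_neg, neg_mul]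
  · exact (ha.continuousOn.comp (by fun_prop) hsymm).neg
  · have h0' : c (2 * t₀ - t) ≠ 0 := fun h => h0 (by simp [h])
    have h1 := ((ha.hasDerivAt_angle _ (hsymm t ht) h0').comp t (hr t)).fun_neg
    refine h1.congr_deriv ?_
    simp

/-- A solution is symmetric about the line through `0` and each of its points at which the
distance to `0` is stationary. -/
lemma reflection (h : Admissible g σ) (hJ : IsOpen J) (hJ' : J.OrdConnected) {t₀ : ℝ}
    (ht₀ : t₀ ∈ J) (hsymm : ∀ t ∈ J, 2 * t₀ - t ∈ J) (ha : IsArc g J c ϑ)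
    (h0 : ∀ t ∈ J, c t ≠ 0) (him : (comoving c ϑ t₀).im = 0) {t : ℝ} (ht : t ∈ J) :
    ϑ (2 * t₀ - t) = 2 * ϑ t₀ - ϑ t ∧
      c (2 * t₀ - t) = -Complex.exp ((ϑ t₀ : ℂ) * Complex.I) ^ 2 * (starRingEnd ℂ) (c t) := by
  have ha' := isArc_reflect hsymm ha
  have h0' : ∀ t ∈ J, (fun t => -(starRingEnd ℂ) (c (2 * t₀ - t))) t ≠ 0 := fun t ht hc =>
    h0 _ (hsymm t ht) (by simpa using hc)
  have e : 2 * t₀ - t₀ = t₀ := by ring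
  have hu : comoving (fun t => -(starRingEnd ℂ) (c (2 * t₀ - t))) (fun t => -ϑ (2 * t₀ - t)) t₀ =
      comoving c ϑ t₀ := by
    rw [← Complex.conj_eq_iff_im.2 him]
    simp only [comoving, e, map_neg, map_mul, Complex.conj_conj, Complex.conj_I, conj_exp_mul_I,
      Complex.ofReal_neg, neg_mul, neg_neg, mul_neg]
  have he := h.flow_eqOn hJ hJ'.isPreconnected (ha'.flow h0') (ha.flow h0) ht₀ hu
  obtain ⟨h1, h2⟩ := eq_rotation hJ hJ' ha' ha h0' he ht₀ ht
  simp only [e] at h1 h2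
  refine ⟨by linarith, ?_⟩
  have h3 := congrArg (starRingEnd ℂ) h2
  simp only [map_neg, Complex.conj_conj, map_mul, conj_exp_mul_I] at h3
  have h4 : Complex.exp (-(((-ϑ t₀ - ϑ t₀ : ℝ) : ℂ) * Complex.I)) =
      Complex.exp ((ϑ t₀ : ℂ) * Complex.I) ^ 2 := by
    rw [← Complex.exp_nat_mul]
    congr 1
    push_cast
    ring
  rw [h4] at h3
  linear_combination -h3

/-- The component of the position in the direction `e^{iα}`. For `α = ϑ(t₀)`, where the distance
to `0` is stationary at `t₀`, its zeros are the times at which the solution meets its symmetry line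
through `c(t₀)`. -/
noncomputable def _root_.PlanarCurvature.tangComp (c : ℝ → ℂ) (α t : ℝ) : ℝ :=
  (c t * Complex.exp (-((α : ℂ) * Complex.I))).re

lemma hasDerivAt_tangComp (ha : IsArc g J c ϑ) (α : ℝ) {t : ℝ} (ht : t ∈ J) :
    HasDerivAt (tangComp c α) (Real.cos (ϑ t - α)) t := by
  have h1 := (ha.hasDerivAt t ht).mul_const (Complex.exp (-((α : ℂ) * Complex.I)))
  have h2 := Complex.reCLM.hasFDerivAt.comp_hasDerivAt t h1
  refine h2.congr_deriv ?_
  rw [← Complex.exp_add, Complex.reCLM_apply,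
    show (ϑ t : ℂ) * Complex.I + -((α : ℂ) * Complex.I) = ((ϑ t - α : ℝ) : ℂ) * Complex.I by
      push_cast; ring, Complex.exp_ofReal_mul_I_re]

/-- A solution meets itself where it crosses one of its symmetry lines. -/
lemma crossing (h : Admissible g σ) (hJ : IsOpen J) (hJ' : J.OrdConnected) {t₀ : ℝ}
    (ht₀ : t₀ ∈ J) (hsymm : ∀ t ∈ J, 2 * t₀ - t ∈ J) (ha : IsArc g J c ϑ)
    (h0 : ∀ t ∈ J, c t ≠ 0) (him : (comoving c ϑ t₀).im = 0) {t : ℝ} (ht : t ∈ J)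
    (hz : tangComp c (ϑ t₀) t = 0) : c (2 * t₀ - t) = c t := by
  rw [(h.reflection hJ hJ' ht₀ hsymm ha h0 him ht).2]
  set w := c t * Complex.exp (-((ϑ t₀ : ℂ) * Complex.I)) with hw
  have hw' : (starRingEnd ℂ) w = -w := by
    apply Complex.ext
    · simp only [Complex.conj_re, Complex.neg_re]
      have : w.re = 0 := hz
      linarith
    · simp
  have hE := exp_mul_exp_neg ((ϑ t₀ : ℂ) * Complex.I)
  have h1 : c t = w * Complex.exp ((ϑ t₀ : ℂ) * Complex.I) := by
    rw [hw]; linear_combination (-(c t)) * hE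
  rw [h1, map_mul, hw', conj_exp_mul_I]
  linear_combination (w * Complex.exp ((ϑ t₀ : ℂ) * Complex.I)) * hE

end Admissible

end PlanarCurvature

namespace PlanarCurvature

variable {g : ℝ → ℝ} {σ : ℝ} {J : Set ℝ} {c : ℝ → ℂ} {ϑ : ℝ → ℝ}

/-! ### Closed solutions -/

/-- A solution on the whole line that is a simple closed curve of length `L`. -/
structure IsClosedSolution (g : ℝ → ℝ) (c : ℝ → ℂ) (ϑ : ℝ → ℝ) (L : ℝ) : Prop where
  isArc : IsArc g univ c ϑ
  pos : 0 < L
  periodic : Function.Periodic c L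
  eq_iff : ∀ s t, c s = c t → ∃ k : ℤ, s = t + k * L

/-- A function that repeats itself up to a constant on a neighbourhood of `t₀` extends to the
whole line, locally as a translate of itself. -/
lemma exists_periodic_extension {E : Type*} [AddCommGroup E] (φ : ℝ → E) (v : E) {t₀ L δ : ℝ}
    (hL : 0 < L) (hδ : 0 < δ) (hper : ∀ t ∈ Ioo (t₀ - δ) (t₀ + δ), φ (t + L) = φ t + v) :
    ∃ ψ : ℝ → E, (∀ t, ψ t = φ (toIcoMod hL t₀ t) + toIcoDiv hL t₀ t • v) ∧
      ∀ t, ψ =ᶠ[𝓝 t] fun s => φ (s - toIcoDiv hL t₀ t * L) + toIcoDiv hL t₀ t • v := by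
  refine ⟨fun t => φ (toIcoMod hL t₀ t) + toIcoDiv hL t₀ t • v, fun t => rfl, fun t => ?_⟩
  set k := toIcoDiv hL t₀ t with hk
  have hmem : t - k * L ∈ Ico t₀ (t₀ + L) := by
    have := sub_toIcoDiv_zsmul_mem_Ico hL t₀ t
    rwa [zsmul_eq_mul] at this
  have hnear : ∀ᶠ s in 𝓝 t, s - k * L ∈ Ioo (t₀ - min δ L) (t₀ + L) := by
    have hcont : ContinuousAt (fun s => s - k * L) t := by fun_prop
    exact hcont.eventually_mem (Ioo_mem_nhds (by linarith [hmem.1, lt_min hδ hL]) hmem.2)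
  filter_upwards [hnear] with s hs
  have hmod : ∀ j : ℤ, toIcoDiv hL t₀ s = j → toIcoMod hL t₀ s = s - j * L := fun j hj => by
    rw [← self_sub_toIcoDiv_mul, hj]
  rcases le_or_gt t₀ (s - k * L) with h1 | h1
  · have h2 : toIcoDiv hL t₀ s = k :=
      toIcoDiv_eq_of_sub_zsmul_mem_Ico hL (by rw [zsmul_eq_mul]; exact ⟨h1, hs.2⟩)
    rw [hmod k h2, h2]
  · have h2 : toIcoDiv hL t₀ s = k - 1 := by
      apply toIcoDiv_eq_of_sub_zsmul_mem_Ico hL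
      rw [zsmul_eq_mul]
      push_cast
      constructor <;> linarith [hs.1, min_le_right δ L]
    rw [hmod _ h2, h2, show s - ((k - 1 : ℤ) : ℝ) * L = s - k * L + L by push_cast; ring,
      hper _ ⟨by linarith [hs.1, min_le_left δ L], by linarith⟩, sub_smul, one_smul]
    abel

lemma exists_closedSolution (hJ : IsOpen J) (hJ' : J.OrdConnected) (hne : J.Nonempty)
    (ha : IsArc g J c ϑ) (e : (c '' J) ≃ₜ Circle) :
    ∃ (c' : ℝ → ℂ) (ϑ' : ℝ → ℝ) (L : ℝ), IsClosedSolution g c' ϑ' L ∧ range c' = c '' J := by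
  have hd : ContinuousOn (fun t => Complex.exp (ϑ t * Complex.I)) J :=
    ((Complex.continuous_ofReal.comp_continuousOn ha.continuousOn).mul continuousOn_const).cexp
  obtain ⟨t₀, L, δ, hL, hδ, hsub, hper, himg, hinj⟩ := exists_period_of_homeomorph hJ hJ' hne
    ha.hasDerivAt hd (fun t _ => Complex.norm_exp_ofReal_mul_I _) e
  -- The tangents at corresponding points agree, so the angle increases by a constant.
  have hexp : ∀ t ∈ Ioo (t₀ - δ) (t₀ + δ), ∃ k : ℤ, ϑ (t + L) = ϑ t + k * (2 * Real.pi) := by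
    intro t ht
    have h1 := ha.hasDerivAt t (hsub ⟨ht.1, by linarith [ht.2]⟩)
    have h2 := (ha.hasDerivAt (t + L) (hsub
        ⟨by linarith [ht.1], by linarith [ht.2]⟩)).comp_add_const
    have h3 : (fun s => c (s + L)) =ᶠ[𝓝 t] c := by
      filter_upwards [Ioo_mem_nhds ht.1 ht.2] with s hs using hper s hs
    have h4 := (h2.congr_of_eventuallyEq h3.symm).unique h1
    obtain ⟨k, hk⟩ := Complex.exp_eq_exp_iff_exists_int.1 h4
    refine ⟨k, ?_⟩
    have h5 : ((ϑ (t + L) : ℂ) - (ϑ t + k * (2 * Real.pi))) * Complex.I = 0 := by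
      linear_combination hk
    have h6 := (mul_eq_zero.1 h5).resolve_right Complex.I_ne_zero
    have h7 : ((ϑ (t + L) - (ϑ t + k * (2 * Real.pi)) : ℝ) : ℂ) = 0 := by
      push_cast; exact h6
    have := Complex.ofReal_eq_zero.1 h7
    linarith
  have ht₀ : t₀ ∈ Ioo (t₀ - δ) (t₀ + δ) := ⟨by linarith, by linarith⟩
  set v := ϑ (t₀ + L) - ϑ t₀ with hv
  obtain ⟨k₀, hk₀⟩ := hexp t₀ ht₀
  obtain ⟨δ', hδ', hδ'δ, hϑper⟩ : ∃ δ' > 0, δ' ≤ δ ∧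
      ∀ t ∈ Ioo (t₀ - δ') (t₀ + δ'), ϑ (t + L) = ϑ t + v := by
    have hcont : ContinuousAt (fun t => ϑ (t + L) - ϑ t) t₀ := by
      refine ContinuousAt.sub (ContinuousAt.comp (f := fun t => t + L) ?_ (by fun_prop)) ?_
      · exact ha.continuousOn.continuousAt (hJ.mem_nhds (hsub ⟨by linarith, by linarith⟩))
      · exact ha.continuousOn.continuousAt (hJ.mem_nhds (hsub ⟨by linarith, by linarith⟩))
    have hball := Metric.continuousAt_iff.1 hcont (2 * Real.pi) Real.two_pi_pos
    obtain ⟨ε, hε, hball⟩ := hball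
    refine ⟨min ε δ, lt_min hε hδ, min_le_right _ _, fun t ht => ?_⟩
    have h1 := hball (x := t) (by
      rw [Real.dist_eq, abs_lt]
      constructor <;> linarith [ht.1, ht.2, min_le_left ε δ])
    obtain ⟨k, hk⟩ := hexp t ⟨by linarith [ht.1, min_le_right ε δ],
      by linarith [ht.2, min_le_right ε δ]⟩
    rw [Real.dist_eq, hk, hk₀, add_sub_cancel_left, add_sub_cancel_left, ← sub_mul, abs_mul,
      abs_of_pos Real.two_pi_pos] at h1
    have h2 : |(k : ℝ) - k₀| < 1 := by
      by_contra h
      nlinarith [not_lt.1 h, Real.two_pi_pos]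
    have h3 : k = k₀ := by
      have h4 : |k - k₀| < 1 := by exact_mod_cast h2
      have := Int.abs_lt_one_iff.1 h4
      omega
    rw [hk, hv, hk₀, h3]
    ring
  obtain ⟨c', hc', hc'loc⟩ := exists_periodic_extension c 0 hL hδ'
    (t₀ := t₀) fun t ht => by
      rw [add_zero]; exact hper t ⟨by linarith [ht.1], by linarith [ht.2]⟩
  obtain ⟨ϑ', hϑ', hϑ'loc⟩ := exists_periodic_extension ϑ v hL hδ' hϑper
  have hmem : ∀ t, t - toIcoDiv hL t₀ t * L ∈ Ico t₀ (t₀ + L) := fun t => by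
    have := sub_toIcoDiv_zsmul_mem_Ico hL t₀ t
    rwa [zsmul_eq_mul] at this
  have hmemJ : ∀ t, t - toIcoDiv hL t₀ t * L ∈ J := fun t =>
    hsub ⟨by linarith [(hmem t).1], by linarith [(hmem t).2]⟩
  have hv2 : v = k₀ * (2 * Real.pi) := by rw [hv, hk₀]; ring
  have hc'eq : ∀ t, c' t = c (t - toIcoDiv hL t₀ t * L) := fun t => by
    rw [(hc'loc t).eq_of_nhds, smul_zero, add_zero]
  have hc't : ∀ t, c' t = c (toIcoMod hL t₀ t) := fun t => by
    rw [hc', smul_zero, add_zero]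
  refine ⟨c', ϑ', L, ⟨⟨fun t _ => ?_, ?_, fun t _ h0 => ?_⟩, hL, fun t => ?_, fun s t hst => ?_⟩,
      ?_⟩
  · have h1 := (ha.hasDerivAt _ (hmemJ t)).comp_sub_const t (toIcoDiv hL t₀ t * L)
    refine (h1.congr_of_eventuallyEq ?_).congr_deriv ?_
    · filter_upwards [hc'loc t] with s hs
      rw [hs, smul_zero, add_zero]
    · rw [(hϑ'loc t).eq_of_nhds, hv2, Complex.exp_eq_exp_iff_exists_int]
      refine ⟨-(toIcoDiv hL t₀ t * k₀), ?_⟩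
      simp
      ring
  · intro t _
    have h1 : ContinuousAt (fun s => ϑ (s - toIcoDiv hL t₀ t * L) + toIcoDiv hL t₀ t • v) t := by
      refine ContinuousAt.add (ContinuousAt.comp (f := fun s => s - toIcoDiv hL t₀ t * L) ?_
        (by fun_prop)) continuousAt_const
      exact ha.continuousOn.continuousAt (hJ.mem_nhds (hmemJ t))
    exact (h1.congr (hϑ'loc t).symm).continuousWithinAt
  · rw [hc'eq t] at h0 ⊢
    have h1 := (ha.hasDerivAt_angle _ (hmemJ t) h0).comp_sub_const t (toIcoDiv hL t₀ t * L)
    exact (h1.add_const (toIcoDiv hL t₀ t • v)).congr_of_eventuallyEq (hϑ'loc t)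
  · rw [hc't, hc't, toIcoMod_add_right]
  · rw [hc't, hc't] at hst
    have h1 := hinj (toIcoMod_mem_Ico hL t₀ s) (toIcoMod_mem_Ico hL t₀ t) hst
    have h2 := toIcoMod_add_toIcoDiv_zsmul hL t₀ s
    have h3 := toIcoMod_add_toIcoDiv_zsmul hL t₀ t
    rw [zsmul_eq_mul] at h2 h3
    refine ⟨toIcoDiv hL t₀ s - toIcoDiv hL t₀ t, ?_⟩
    push_cast
    linarith
  · rw [← himg]
    apply Subset.antisymm
    · rintro _ ⟨t, rfl⟩
      exact ⟨_, toIcoMod_mem_Ico hL t₀ t, (hc't t).symm⟩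
    · rintro _ ⟨t, ht, rfl⟩
      refine ⟨t, ?_⟩
      rw [hc't, (toIcoMod_eq_self hL).2 ht]

/-! ### Monotone curvature forces self-intersections -/

/-- If the curvature decreases along an arc that turns by at least `π`, then the arc comes back
to the level of its starting point, measured along its initial tangent. The point: while the
direction turns from `0` to `π`, the forward part is run through with larger curvature, hence in
less time, than the backward part. -/
lemma exists_return_of_curvature_anti {a b : ℝ} (hab : a < b) {ϑ κ m : ℝ → ℝ}
    (hϑc : ContinuousOn ϑ (Icc a b)) (hϑ : ∀ t ∈ Ioo a b, HasDerivAt ϑ (κ t) t)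
    (hκ0 : ∀ t ∈ Ioo a b, 0 < κ t) (hκ : StrictAntiOn κ (Ioo a b)) (hturn : Real.pi ≤ ϑ b - ϑ a)
    (hmc : ContinuousOn m (Icc a b)) (hm : ∀ t ∈ Ioo a b, HasDerivAt m (Real.cos (ϑ t - ϑ a)) t)
    (hma : m a = 0) : ∃ t ∈ Ioo a b, m t = 0 := by
  have hpi := Real.pi_pos
  have hϑm : StrictMonoOn ϑ (Icc a b) := by
    apply strictMonoOn_of_deriv_pos (convex_Icc a b) hϑc
    intro t ht
    rw [interior_Icc] at ht
    rw [(hϑ t ht).deriv]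
    exact hκ0 t ht
  have ma : a ∈ Icc a b := ⟨le_rfl, hab.le⟩
  obtain ⟨b', hb', hb'π⟩ := intermediate_value_Icc hab.le hϑc
    (show ϑ a + Real.pi ∈ Icc _ _ from ⟨by linarith, by linarith⟩)
  have hab' : a < b' := (hϑm.lt_iff_lt ma hb').1 (by linarith)
  have hsub : Icc a b' ⊆ Icc a b := Icc_subset_Icc_right hb'.2
  obtain ⟨p, hp, hpπ⟩ := intermediate_value_Icc hab'.le (hϑc.mono hsub)
    (show ϑ a + Real.pi / 2 ∈ Icc _ _ from ⟨by linarith, by linarith⟩)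
  have hap : a < p := (hϑm.lt_iff_lt ma (hsub hp)).1 (by linarith)
  have hpb : p < b' := (hϑm.lt_iff_lt (hsub hp) hb').1 (by linarith)
  have hpm : p ∈ Ioo a b := ⟨hap, hpb.trans_le hb'.2⟩
  have cpos : ∀ t ∈ Ioo a p, 0 < Real.cos (ϑ t - ϑ a) := by
    intro t ht
    have m1 : t ∈ Icc a b := ⟨ht.1.le, (ht.2.trans hpm.2).le⟩
    have h1 := hϑm ma m1 ht.1
    have h2 := hϑm m1 (hsub hp) ht.2
    exact Real.cos_pos_of_mem_Ioo ⟨by linarith, by linarith⟩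
  have cneg : ∀ t ∈ Ioo p b', Real.cos (ϑ t - ϑ a) < 0 := by
    intro t ht
    have m1 : t ∈ Icc a b := ⟨(hap.trans ht.1).le, (ht.2.trans_le hb'.2).le⟩
    have h1 := hϑm (hsub hp) m1 ht.1
    have h2 := hϑm m1 hb' ht.2
    exact Real.cos_neg_of_pi_div_two_lt_of_lt (by linarith) (by linarith)
  set N : ℝ → ℝ := fun t => κ p * m t - Real.sin (ϑ t - ϑ a) with hN
  have hNc : ContinuousOn N (Icc a b) :=
    (continuousOn_const.mul hmc).sub
      (Real.continuous_sin.comp_continuousOn (hϑc.sub continuousOn_const))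
  have hNd : ∀ t ∈ Ioo a b, HasDerivAt N (Real.cos (ϑ t - ϑ a) * (κ p - κ t)) t := by
    intro t ht
    have h1 := ((hm t ht).const_mul (κ p)).fun_sub ((hϑ t ht).sub_const (ϑ a)).sin
    exact h1.congr_deriv (by ring)
  have h1 : N p < N a := by
    have : StrictAntiOn N (Icc a p) := by
      apply strictAntiOn_of_deriv_neg (convex_Icc a p)
        (hNc.mono (Icc_subset_Icc_right hpm.2.le))
      intro t ht
      rw [interior_Icc] at ht
      have m1 : t ∈ Ioo a b := ⟨ht.1, ht.2.trans hpm.2⟩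
      rw [(hNd t m1).deriv]
      exact mul_neg_of_pos_of_neg (cpos t ht) (by linarith [hκ m1 hpm ht.2])
    exact this ⟨le_rfl, hap.le⟩ ⟨hap.le, le_rfl⟩ hap
  have h2 : N b' < N p := by
    have : StrictAntiOn N (Icc p b') := by
      apply strictAntiOn_of_deriv_neg (convex_Icc p b')
        (hNc.mono (Icc_subset_Icc hap.le hb'.2))
      intro t ht
      rw [interior_Icc] at ht
      have m1 : t ∈ Ioo a b := ⟨hap.trans ht.1, ht.2.trans_le hb'.2⟩
      rw [(hNd t m1).deriv]
      exact mul_neg_of_neg_of_pos (cneg t ht) (by linarith [hκ hpm m1 ht.1])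
    exact this ⟨le_rfl, hpb.le⟩ ⟨hpb.le, le_rfl⟩ hpb
  have h3 : N a = 0 := by simp [hN, hma]
  have h4 : N b' = κ p * m b' := by
    simp [hN, hb'π]
  have h5 : m b' < 0 := by
    have := hκ0 p hpm
    by_contra h
    nlinarith [not_lt.1 h]
  have h6 : 0 < m p := by
    have : StrictMonoOn m (Icc a p) := by
      apply strictMonoOn_of_deriv_pos (convex_Icc a p)
        (hmc.mono (Icc_subset_Icc_right hpm.2.le))
      intro t ht
      rw [interior_Icc] at ht
      rw [(hm t ⟨ht.1, ht.2.trans hpm.2⟩).deriv]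
      exact cpos t ht
    rw [← hma]
    exact this ⟨le_rfl, hap.le⟩ ⟨hap.le, le_rfl⟩ hap
  obtain ⟨t, ht, ht0⟩ := intermediate_value_Ioo' hpb.le
    (hmc.mono (Icc_subset_Icc hap.le hb'.2)) (show (0 : ℝ) ∈ Ioo _ _ from ⟨h5, h6⟩)
  exact ⟨t, ⟨hap.trans ht.1, ht.2.trans_le hb'.2⟩, ht0⟩

lemma exists_return_of_curvature_mono {a b : ℝ} (hab : a < b) {ϑ κ m : ℝ → ℝ}
    (hϑc : ContinuousOn ϑ (Icc a b)) (hϑ : ∀ t ∈ Ioo a b, HasDerivAt ϑ (κ t) t)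
    (hκ0 : ∀ t ∈ Ioo a b, 0 < κ t) (hκ : StrictMonoOn κ (Ioo a b)) (hturn : Real.pi ≤ ϑ b - ϑ a)
    (hmc : ContinuousOn m (Icc a b)) (hm : ∀ t ∈ Ioo a b, HasDerivAt m (Real.cos (ϑ t - ϑ b)) t)
    (hmb : m b = 0) : ∃ t ∈ Ioo a b, m t = 0 := by
  have r1 : ∀ t ∈ Icc (-b) (-a), -t ∈ Icc a b := fun t ht =>
      ⟨by linarith [ht.2], by linarith [ht.1]⟩
  have r2 : ∀ t ∈ Ioo (-b) (-a), -t ∈ Ioo a b := fun t ht =>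
      ⟨by linarith [ht.2], by linarith [ht.1]⟩
  obtain ⟨t, ht, ht0⟩ := exists_return_of_curvature_anti (a := -b) (b := -a) (by linarith)
    (ϑ := fun t => -ϑ (-t)) (κ := fun t => κ (-t)) (m := fun t => -m (-t))
    ((hϑc.comp continuous_neg.continuousOn r1).neg)
    (fun t ht => by
      have := ((hϑ _ (r2 t ht)).comp t (hasDerivAt_neg t)).fun_neg
      exact this.congr_deriv (by ring))
    (fun t ht => hκ0 _ (r2 t ht))
    (fun x hx y hy hxy => hκ (r2 y hy) (r2 x hx) (by linarith))
    (by simp only [neg_neg]; linarith)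
    ((hmc.comp continuous_neg.continuousOn r1).neg)
    (fun t ht => by
      have := ((hm _ (r2 t ht)).comp t (hasDerivAt_neg t)).fun_neg
      refine this.congr_deriv ?_
      rw [neg_neg, mul_neg_one, neg_neg, ← Real.cos_neg]
      congr 1; ring)
    (by simp [hmb])
  exact ⟨-t, r2 t ht, by simpa using ht0⟩

end PlanarCurvature

namespace PlanarCurvature

variable {g : ℝ → ℝ} {σ : ℝ} {J : Set ℝ} {c : ℝ → ℂ} {ϑ : ℝ → ℝ} {L : ℝ}

/-! ### Symmetries of closed solutions -/

lemma tangComp_self (t : ℝ) : tangComp c (ϑ t) t = -(comoving c ϑ t).im := by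
  have h : c t * Complex.exp (-((ϑ t : ℂ) * Complex.I)) =
      (starRingEnd ℂ) (Complex.I * comoving c ϑ t) := by
    simp only [comoving, map_mul, map_neg, Complex.conj_I, Complex.conj_conj, conj_exp_mul_I]
    linear_combination (c t * Complex.exp (-((ϑ t : ℂ) * Complex.I))) * Complex.I_sq
  rw [tangComp, h, Complex.conj_re]
  simp

lemma IsArc.hasDerivAt_norm_sq (ha : IsArc g J c ϑ) {t : ℝ} (ht : t ∈ J) :
    HasDerivAt (fun t => ‖c t‖ ^ 2) (-2 * (comoving c ϑ t).im) t := by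
  refine (ha.hasDerivAt t ht).norm_sq.congr_deriv ?_
  rw [comoving, Complex.inner]
  simp
  ring

lemma IsClosedSolution.continuous (hC : IsClosedSolution g c ϑ L) : Continuous c :=
  continuousOn_univ.1 hC.isArc.continuousOn_curve

lemma IsClosedSolution.continuous_angle (hC : IsClosedSolution g c ϑ L) : Continuous ϑ :=
  continuousOn_univ.1 hC.isArc.continuousOn

lemma IsClosedSolution.shift (hC : IsClosedSolution g c ϑ L) (x : ℝ) :
    IsClosedSolution g (fun t => c (t + x)) (fun t => ϑ (t + x)) L := by
  refine ⟨⟨fun t _ => ?_, ?_, fun t _ h0 => ?_⟩, hC.pos, fun t => ?_, fun s t hst => ?_⟩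
  · exact (hC.isArc.hasDerivAt _ (mem_univ _)).comp_add_const
  · have := hC.continuous_angle
    exact (this.comp (by fun_prop : Continuous fun t => t + x)).continuousOn
  · exact (hC.isArc.hasDerivAt_angle _ (mem_univ _) h0).comp_add_const
  · rw [add_right_comm]
    exact hC.periodic _
  · obtain ⟨k, hk⟩ := hC.eq_iff _ _ hst
    exact ⟨k, by linarith⟩

lemma IsClosedSolution.add_int_mul (hC : IsClosedSolution g c ϑ L) (t : ℝ) (k : ℤ) :
    c (t + k * L) = c t := by
  have := hC.periodic.int_mul k t
  exact this

lemma exists_zero_of_deriv_pos {a b m' : ℝ} (hab : a < b) {m : ℝ → ℝ}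
    (hc : ContinuousOn m (Icc a b)) (hm : HasDerivAt m m' a) (hm' : 0 < m') (ha : m a = 0)
    (hb : m b < 0) : ∃ t ∈ Ioo a b, m t = 0 := by
  have h1 : ∀ᶠ t in 𝓝[>] a, 0 < m t := by
    have h2 := ((hasDerivAt_iff_tendsto_slope.1 hm).eventually_const_lt hm').filter_mono
      (nhdsWithin_mono a (fun x hx => ne_of_gt hx) : 𝓝[>] a ≤ 𝓝[≠] a)
    filter_upwards [h2, self_mem_nhdsWithin] with t ht hta
    rw [slope_def_field, ha, sub_zero] at ht
    exact (div_pos_iff_of_pos_right (sub_pos.2 hta)).1 ht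
  obtain ⟨p, hp, hpab⟩ := (h1.and (Ioo_mem_nhdsGT hab)).exists
  obtain ⟨t, ht, ht0⟩ := intermediate_value_Ioo' hpab.2.le
    (hc.mono (Icc_subset_Icc_left hpab.1.le)) (show (0 : ℝ) ∈ Ioo _ _ from ⟨hb, hp⟩)
  exact ⟨t, ⟨hpab.1.trans ht.1, ht.2⟩, ht0⟩

namespace Admissible

lemma angle_strictMonoOn (h : Admissible g σ) (hC : IsClosedSolution g c ϑ L) {a b : ℝ}
    (h0 : ∀ t ∈ Ioo a b, c t ≠ 0) : StrictMonoOn ϑ (Icc a b) := by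
  apply strictMonoOn_of_deriv_pos (convex_Icc a b) hC.continuous_angle.continuousOn
  intro t ht
  rw [interior_Icc] at ht
  rw [(hC.isArc.hasDerivAt_angle t (mem_univ t) (h0 t ht)).deriv]
  exact h.pos _ (norm_pos_iff.2 (h0 t ht))

/-- The self-intersection forced by monotone curvature: an arc along which the distance to `0`
is strictly monotone and which turns by at least `π` crosses the symmetry line at one of its
ends. -/
lemma exists_tangComp_zero (h : Admissible g σ) (hC : IsClosedSolution g c ϑ L) {a b : ℝ}
    (hab : a < b) (h0 : ∀ t ∈ Ioo a b, c t ≠ 0) (hturn : Real.pi ≤ ϑ b - ϑ a)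
    (ha : tangComp c (ϑ a) a = 0) (hb : tangComp c (ϑ b) b = 0)
    (hm : StrictMonoOn (fun t => ‖c t‖) (Icc a b) ∨ StrictAntiOn (fun t => ‖c t‖) (Icc a b)) :
    ∃ t ∈ Ioo a b, tangComp c (ϑ a) t = 0 ∨ tangComp c (ϑ b) t = 0 := by
  have hϑc := hC.continuous_angle.continuousOn (s := Icc a b)
  have hϑ : ∀ t ∈ Ioo a b, HasDerivAt ϑ (g ‖c t‖) t :=
    fun t ht => hC.isArc.hasDerivAt_angle t (mem_univ t) (h0 t ht)
  have hκ0 : ∀ t ∈ Ioo a b, 0 < g ‖c t‖ := fun t ht => h.pos _ (norm_pos_iff.2 (h0 t ht))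
  have hmd : ∀ α t, HasDerivAt (tangComp c α) (Real.cos (ϑ t - α)) t :=
    fun α t => hasDerivAt_tangComp hC.isArc α (mem_univ t)
  have hmc : ∀ α, ContinuousOn (tangComp c α) (Icc a b) :=
    fun α t _ => (hmd α t).continuousAt.continuousWithinAt
  have hpos : MapsTo (fun t => ‖c t‖) (Ioo a b) (Ioi 0) := fun t ht => norm_pos_iff.2 (h0 t ht)
  have key : StrictMonoOn (fun t => g ‖c t‖) (Ioo a b) ∨ StrictAntiOn (fun t => g ‖c t‖)
      (Ioo a b) := by
    rcases h.strictMonoOn_or_strictAntiOn with hg | hg <;> rcases hm with hm | hm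
    · exact Or.inl (hg.comp (hm.mono Ioo_subset_Icc_self) hpos)
    · exact Or.inr (hg.comp_strictAntiOn (hm.mono Ioo_subset_Icc_self) hpos)
    · exact Or.inr (hg.comp_strictMonoOn (hm.mono Ioo_subset_Icc_self) hpos)
    · exact Or.inl (hg.comp (hm.mono Ioo_subset_Icc_self) hpos)
  rcases key with hk | hk
  · obtain ⟨t, ht, ht0⟩ := exists_return_of_curvature_mono hab hϑc hϑ hκ0 hk hturn (hmc _)
      (fun t _ => hmd (ϑ b) t) hb
    exact ⟨t, ht, Or.inr ht0⟩
  · obtain ⟨t, ht, ht0⟩ := exists_return_of_curvature_anti hab hϑc hϑ hκ0 hk hturn (hmc _)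
      (fun t _ => hmd (ϑ a) t) ha
    exact ⟨t, ht, Or.inl ht0⟩

lemma reflection_univ (h : Admissible g σ) (hC : IsClosedSolution g c ϑ L) (h0 : ∀ t, c t ≠ 0)
    {t₀ : ℝ} (him : (comoving c ϑ t₀).im = 0) (t : ℝ) :
    ϑ (2 * t₀ - t) = 2 * ϑ t₀ - ϑ t ∧ ‖c (2 * t₀ - t)‖ = ‖c t‖ := by
  have := h.reflection isOpen_univ ordConnected_univ (mem_univ t₀) (fun _ _ => mem_univ _) hC.isArc
    (fun t _ => h0 t) him (mem_univ t)
  refine ⟨this.1, ?_⟩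
  rw [this.2]
  simp [Complex.norm_exp_ofReal_mul_I]

lemma norm_period_of_crossing (h : Admissible g σ) (hC : IsClosedSolution g c ϑ L)
    (h0 : ∀ t, c t ≠ 0)
    {t₀ t : ℝ} (him : (comoving c ϑ t₀).im = 0)
    (hz : tangComp c (ϑ t₀) t = 0) (x : ℝ) : ‖c (x + 2 * (t - t₀))‖ = ‖c x‖ := by
  have h1 := h.crossing isOpen_univ ordConnected_univ (mem_univ t₀) (fun _ _ => mem_univ _)
    hC.isArc (fun t _ => h0 t) him (mem_univ t) hz
  obtain ⟨k, hk⟩ := hC.eq_iff _ _ h1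
  have h2 : x + 2 * (t - t₀) = x + ((-k : ℤ) : ℝ) * L := by push_cast; linarith
  rw [h2, hC.add_int_mul]

/-- A simple closed solution does not cross its symmetry lines at the two ends of an arc between
consecutive extrema of the distance to `0`. -/
lemma tangComp_ne_zero (h : Admissible g σ) (hC : IsClosedSolution g c ϑ L) (h0 : ∀ t, c t ≠ 0)
    {a b : ℝ} (ha : (comoving c ϑ a).im = 0) (hb : (comoving c ϑ b).im = 0)
    (hm : InjOn (fun t => ‖c t‖) (Icc a b)) {t : ℝ} (ht : t ∈ Ioo a b) :
    tangComp c (ϑ a) t ≠ 0 ∧ tangComp c (ϑ b) t ≠ 0 := by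
  have hab : a < b := ht.1.trans ht.2
  have ma : a ∈ Icc a b := ⟨le_rfl, hab.le⟩
  have mb : b ∈ Icc a b := ⟨hab.le, le_rfl⟩
  constructor
  · intro hz
    have h1 := h.norm_period_of_crossing hC h0 ha hz a
    rcases le_or_gt (2 * t - a) b with h2 | h2
    · have := hm (x₁ := a + 2 * (t - a)) ⟨by linarith [ht.1], by linarith⟩ ma h1
      linarith [ht.1]
    · have h3 := (h.reflection_univ hC h0 hb (a + 2 * (t - a))).2
      have := hm (x₁ := 2 * b - (a + 2 * (t - a))) ⟨by linarith [ht.2], by linarith⟩ ma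
          (h3.trans h1)
      linarith [ht.2]
  · intro hz
    have h4 := h.norm_period_of_crossing hC h0 hb hz b
    rcases le_or_gt a (2 * t - b) with h2 | h2
    · have := hm (x₁ := b + 2 * (t - b)) ⟨by linarith, by linarith [ht.2]⟩ mb h4
      linarith [ht.2]
    · have h3 := (h.reflection_univ hC h0 ha (b + 2 * (t - b))).2
      have := hm (x₁ := 2 * a - (b + 2 * (t - b))) ⟨by linarith, by linarith [ht.1]⟩ mb
          (h3.trans h4)
      linarith [ht.1]

/-- Between consecutive extrema of the distance to `0`, a simple closed solution turns by less
than `π`. -/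
lemma turning_lt_pi (h : Admissible g σ) (hC : IsClosedSolution g c ϑ L) (h0 : ∀ t, c t ≠ 0)
    {a b : ℝ} (hab : a < b) (ha : (comoving c ϑ a).im = 0)
    (hb : (comoving c ϑ b).im = 0)
    (hm : StrictMonoOn (fun t => ‖c t‖) (Icc a b) ∨ StrictAntiOn (fun t => ‖c t‖) (Icc a b)) :
    ϑ b - ϑ a < Real.pi := by
  by_contra hcon
  obtain ⟨t, ht, ht0⟩ := h.exists_tangComp_zero hC hab (fun t _ => h0 t) (not_lt.1 hcon)
    (by rw [tangComp_self, ha, neg_zero]) (by rw [tangComp_self, hb, neg_zero]) hm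
  have := h.tangComp_ne_zero hC h0 ha hb (hm.elim StrictMonoOn.injOn StrictAntiOn.injOn) ht
  exact ht0.elim this.1 this.2

end Admissible

end PlanarCurvature

namespace PlanarCurvature

variable {g : ℝ → ℝ} {σ : ℝ} {c : ℝ → ℂ} {ϑ : ℝ → ℝ} {L : ℝ}

/-! ### Exclusion of nonnegative energies -/

lemma re_sq_eq_of_im_eq_zero {t : ℝ} (him : (comoving c ϑ t).im = 0) :
    (comoving c ϑ t).re = ‖c t‖ ∨ (comoving c ϑ t).re = -‖c t‖ := by
  apply sq_eq_sq_iff_eq_or_eq_neg.1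
  rw [← norm_comoving (ϑ := ϑ), ← Complex.normSq_eq_norm_sq, Complex.normSq_apply, him]
  ring

lemma exp_eq_of_comoving_im {t : ℝ} (him : (comoving c ϑ t).im = 0) :
    c t = -Complex.I * ((comoving c ϑ t).re : ℂ) * Complex.exp (ϑ t * Complex.I) := by
  have h1 : comoving c ϑ t = ((comoving c ϑ t).re : ℂ) := Complex.ext (by simp) (by simp [him])
  conv_lhs => rw [eq_of_comoving (c := c) (ϑ := ϑ) t, h1, Complex.conj_ofReal]

/-- The position along the tangent at another time, at a time where the distance to `0` is
stationary. -/
lemma tangComp_of_im_eq_zero {t : ℝ} (him : (comoving c ϑ t).im = 0) (α : ℝ) :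
    tangComp c α t = (comoving c ϑ t).re * Real.sin (ϑ t - α) := by
  rw [tangComp, exp_eq_of_comoving_im him, mul_assoc, ← Complex.exp_add,
    show (ϑ t : ℂ) * Complex.I + -((α : ℂ) * Complex.I) = ((ϑ t - α : ℝ) : ℂ) * Complex.I by
      push_cast; ring]
  rw [mul_assoc, neg_mul, Complex.neg_re, Complex.I_mul_re, Complex.im_ofReal_mul,
    Complex.exp_ofReal_mul_I_im, neg_neg]

lemma IsClosedSolution.im_eq_zero_of_isExtr (hC : IsClosedSolution g c ϑ L) {t : ℝ}
    (he : IsLocalExtr (fun t => ‖c t‖ ^ 2) t) : (comoving c ϑ t).im = 0 := by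
  have := he.hasDerivAt_eq_zero (hC.isArc.hasDerivAt_norm_sq (mem_univ t))
  linarith

lemma IsClosedSolution.exists_max (hC : IsClosedSolution g c ϑ L) :
    ∃ t, ∀ s, ‖c s‖ ≤ ‖c t‖ := by
  have hK : IsCompact (range c) := hC.periodic.compact_of_continuous hC.pos.ne' hC.continuous
  obtain ⟨_, ⟨t, rfl⟩, ht⟩ := hK.exists_isMaxOn (range_nonempty c) continuous_norm.continuousOn
  exact ⟨t, fun s => ht (mem_range_self s)⟩

lemma IsClosedSolution.exists_min (hC : IsClosedSolution g c ϑ L) :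
    ∃ t, ∀ s, ‖c t‖ ≤ ‖c s‖ := by
  have hK : IsCompact (range c) := hC.periodic.compact_of_continuous hC.pos.ne' hC.continuous
  obtain ⟨_, ⟨t, rfl⟩, ht⟩ := hK.exists_isMinOn (range_nonempty c) continuous_norm.continuousOn
  exact ⟨t, fun s => ht (mem_range_self s)⟩

/-- An arc on which the distance to `0` is nowhere stationary and ends below its start. -/
lemma IsClosedSolution.strictAntiOn_norm (hC : IsClosedSolution g c ϑ L) {a b : ℝ} (hab : a < b)
    (hne : ∀ t ∈ Ioo a b, (comoving c ϑ t).im ≠ 0) (hle : ‖c b‖ ≤ ‖c a‖) :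
    StrictAntiOn (fun t => ‖c t‖) (Icc a b) := by
  have key : ∀ x ∈ Icc a b, ∀ y ∈ Icc a b, x < y → ‖c x‖ ≠ ‖c y‖ := by
    intro x hx y hy hxy heq
    obtain ⟨t, ht, hext⟩ := exists_isLocalExtr_Ioo (f := fun t => ‖c t‖ ^ 2) hxy
      ((hC.continuous.norm.pow 2).continuousOn) (by simp only [heq])
    exact hne t ⟨hx.1.trans_lt ht.1, ht.2.trans_le hy.2⟩ (hC.im_eq_zero_of_isExtr hext)
  apply hC.continuous.norm.continuousOn.strictAntiOn_of_injOn_Icc hab.le hle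
  intro x hx y hy hxy
  by_contra hne
  rcases lt_or_gt_of_ne hne with h1 | h1
  · exact key x hx y hy h1 hxy
  · exact key y hy x hx h1 hxy.symm

namespace Admissible

lemma norm_eq_rad_of_const (h : Admissible g σ) {J : Set ℝ} (ha : IsArc g J c ϑ) (hJ : IsOpen J)
    {t₀ r : ℝ} (ht₀ : t₀ ∈ J) (hr : 0 < r) (hn : ∀ t ∈ J, ‖c t‖ = r) :
    r = σ ∧ (comoving c ϑ t₀).re = r := by
  have hc0 : ∀ t ∈ J, c t ≠ 0 := fun t ht => norm_pos_iff.1 (by rw [hn t ht]; exact hr)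
  have him : ∀ t ∈ J, (comoving c ϑ t).im = 0 := by
    intro t ht
    have h1 := ha.hasDerivAt_norm_sq ht
    have h2 : HasDerivAt (fun t => ‖c t‖ ^ 2) 0 t := by
      refine (hasDerivAt_const t (r ^ 2)).congr_of_eventuallyEq ?_
      filter_upwards [hJ.mem_nhds ht] with s hs
      rw [hn s hs]
    linarith [h1.unique h2]
  have h1 : HasDerivAt (fun t => (comoving c ϑ t).im)
      (flowField g (comoving c ϑ t₀)).im t₀ := by
    have := Complex.imCLM.hasFDerivAt.comp_hasDerivAt t₀ (ha.hasDerivAt_comoving ht₀ (hc0 t₀ ht₀))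
    simpa [Function.comp_def] using this
  have h2 : HasDerivAt (fun t => (comoving c ϑ t).im) 0 t₀ := by
    refine (hasDerivAt_const t₀ (0 : ℝ)).congr_of_eventuallyEq ?_
    filter_upwards [hJ.mem_nhds ht₀] with s hs using him s hs
  have h3 := h1.unique h2
  rw [flowField, norm_comoving, hn t₀ ht₀] at h3
  simp at h3
  have hg := h.pos r hr
  have hre : (comoving c ϑ t₀).re = r := by
    rcases re_sq_eq_of_im_eq_zero (him t₀ ht₀) with h4 | h4
    · rw [h4, hn t₀ ht₀]
    · rw [h4, hn t₀ ht₀] at h3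
      nlinarith
  refine ⟨h.mul_strictMonoOn.injOn hr h.rad_pos ?_, hre⟩
  simp only [h.rad_eq]
  rw [hre] at h3
  linarith

lemma potF_eq_of_nonneg (h : Admissible g σ) {r s : ℝ} (hr : 0 < r) (hs : 0 < s)
    (h0 : 0 ≤ potF g r) (he : potF g r = potF g s) : r = s := by
  have h1 : σ ≤ r := by
    by_contra hlt
    linarith [h.potF_neg_of_le hr (not_le.1 hlt).le]
  have h2 : σ ≤ s := by
    by_contra hlt
    linarith [h.potF_neg_of_le hs (not_le.1 hlt).le]
  exact h.potF_strictMonoOn.injOn h1 h2 he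

/-- A closed solution that avoids `0` has negative energy. Otherwise `u` is positive at a maximum
of the distance to `0` and negative at the next minimum. Turning by less than `π` in between, the
curve then crosses its symmetry line at the maximum. -/
lemma energy_neg_of_ne_zero (h : Admissible g σ) (hC : IsClosedSolution g c ϑ L)
    (h0 : ∀ t, c t ≠ 0) : energy g c ϑ 0 < 0 := by
  by_contra hE
  rw [not_lt] at hE
  set E := energy g c ϑ 0 with hEdef
  have hen : ∀ t, energy g c ϑ t = E := fun t =>
    h.energy_eq ordConnected_univ hC.isArc (mem_univ t) (mem_univ 0)
  have hpos : ∀ t, 0 < ‖c t‖ := fun t => norm_pos_iff.2 (h0 t)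
  have hFle : ∀ t, potF g ‖c t‖ ≤ E := fun t => (hen t) ▸ potF_le_energy t
  have hcrit : ∀ t, (comoving c ϑ t).im = 0 →
      ((comoving c ϑ t).re = ‖c t‖ ∧ potF g ‖c t‖ = E) ∨
      ((comoving c ϑ t).re = -‖c t‖ ∧ potG g ‖c t‖ + ‖c t‖ = E) := by
    intro t him
    have h1 := hen t
    rw [energy] at h1
    rcases re_sq_eq_of_im_eq_zero him with h2 | h2
    · exact Or.inl ⟨h2, by rw [potF, ← h1, h2]⟩
    · exact Or.inr ⟨h2, by rw [← h1, h2]; ring⟩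
  have hGmono : ∀ r s, 0 < r → 0 < s → potG g r + r = potG g s + s → r = s := by
    intro r s hr hs he
    rcases lt_trichotomy r s with hlt | heq | hlt
    · linarith [h.potG_strictMonoOn hr.le hs.le hlt]
    · exact heq
    · linarith [h.potG_strictMonoOn hs.le hr.le hlt]
  have hnotconst : ¬ ∀ t, ‖c t‖ = ‖c 0‖ := by
    intro hconst
    obtain ⟨h1, -⟩ := h.norm_eq_rad_of_const hC.isArc isOpen_univ (mem_univ 0) (hpos 0)
      (fun t _ => hconst t)
    have h2 := h.norm_eq_rad_of_const hC.isArc isOpen_univ (mem_univ 0) (hpos 0)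
      (fun t _ => hconst t)
    have h3 := hen 0
    rw [energy, h2.2, h1] at h3
    have := h.potF_rad_neg
    rw [potF] at this
    linarith
  obtain ⟨tM, hM⟩ := hC.exists_max
  obtain ⟨tm, hm⟩ := hC.exists_min
  have imM : (comoving c ϑ tM).im = 0 := hC.im_eq_zero_of_isExtr (Or.inr
    (Eventually.of_forall fun s => pow_le_pow_left₀ (norm_nonneg _) (hM s) 2))
  have imm : (comoving c ϑ tm).im = 0 := hC.im_eq_zero_of_isExtr (Or.inl
    (Eventually.of_forall fun s => pow_le_pow_left₀ (norm_nonneg _) (hm s) 2))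
  have hlt : ‖c tm‖ < ‖c tM‖ := by
    by_contra hle
    apply hnotconst
    intro t
    have h1 := hM t
    have h2 := hm t
    have h3 := hM 0
    have h4 := hm 0
    rw [not_lt] at hle
    linarith
  have hminval : potG g ‖c tm‖ + ‖c tm‖ = E := by
    rcases hcrit tm imm with ⟨-, h1⟩ | ⟨-, h1⟩
    · have hσ : σ ≤ ‖c tm‖ := by
        by_contra hlt
        linarith [h.potF_neg_of_le (hpos tm) (not_le.1 hlt).le]
      have h2 := h.potF_strictMonoOn hσ (hσ.trans hlt.le) hlt
      linarith [hFle tM]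
    · exact h1
  have hmaxval : potF g ‖c tM‖ = E := by
    rcases hcrit tM imM with ⟨-, h1⟩ | ⟨-, h1⟩
    · exact h1
    · linarith [hGmono _ _ (hpos tm) (hpos tM) (hminval.trans h1.symm)]
  -- A minimum after the maximum, then consecutive extrema `a < b`.
  obtain ⟨n, hn⟩ := exists_nat_gt ((tM - tm) / L)
  have hn' : tM < tm + ((n : ℤ) : ℝ) * L := by
    rw [div_lt_iff₀ hC.pos] at hn
    push_cast
    linarith
  have hcn : c (tm + ((n : ℤ) : ℝ) * L) = c tm := hC.add_int_mul tm n
  set tm' := tm + ((n : ℤ) : ℝ) * L with htm'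
  have hcn' := hC.continuous.norm
  obtain ⟨b, ⟨hbI, hbmin⟩, hbleast⟩ :=
    (isCompact_Icc.inter_right (isClosed_eq hcn' continuous_const) :
      IsCompact (Icc tM tm' ∩ {t | ‖c t‖ = ‖c tm‖})).exists_isLeast
      ⟨tm', ⟨hn'.le, le_rfl⟩, by rw [mem_ofPred_eq, hcn]⟩
  obtain ⟨a, ⟨haI, hamax⟩, hagreat⟩ :=
    (isCompact_Icc.inter_right (isClosed_eq hcn' continuous_const) :
      IsCompact (Icc tM b ∩ {t | ‖c t‖ = ‖c tM‖})).exists_isGreatest ⟨tM, ⟨le_rfl, hbI.1⟩, rfl⟩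
  have hbmin : ‖c b‖ = ‖c tm‖ := hbmin
  have hamax : ‖c a‖ = ‖c tM‖ := hamax
  have hab : a < b := by
    rcases haI.2.eq_or_lt with heq | h1
    · rw [heq, hbmin] at hamax
      linarith
    · exact h1
  have ima : (comoving c ϑ a).im = 0 := hC.im_eq_zero_of_isExtr (Or.inr
    (Eventually.of_forall fun s => pow_le_pow_left₀ (norm_nonneg _) (hamax ▸ hM s) 2))
  have imb : (comoving c ϑ b).im = 0 := hC.im_eq_zero_of_isExtr (Or.inl
    (Eventually.of_forall fun s => pow_le_pow_left₀ (norm_nonneg _) (hbmin ▸ hm s) 2))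
  have hne : ∀ t ∈ Ioo a b, (comoving c ϑ t).im ≠ 0 := by
    intro t ht him
    rcases hcrit t him with ⟨-, h1⟩ | ⟨-, h1⟩
    · have h2 := h.potF_eq_of_nonneg (hpos t) (hpos tM) (by linarith) (h1.trans hmaxval.symm)
      exact absurd (hagreat ⟨⟨haI.1.trans ht.1.le, ht.2.le⟩, h2⟩) (not_le.2 ht.1)
    · have h2 := hGmono _ _ (hpos t) (hpos tm) (h1.trans hminval.symm)
      exact absurd (hbleast ⟨⟨haI.1.trans ht.1.le, ht.2.le.trans hbI.2⟩, h2⟩) (not_le.2 ht.2)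
  have hanti := hC.strictAntiOn_norm hab hne (by rw [hbmin, hamax]; exact hlt.le)
  have hturn := h.turning_lt_pi hC h0 hab ima imb (Or.inr hanti)
  have hturn0 : 0 < ϑ b - ϑ a := sub_pos.2
    (h.angle_strictMonoOn hC (fun t _ => h0 t) ⟨le_rfl, hab.le⟩ ⟨hab.le, le_rfl⟩ hab)
  have hre : (comoving c ϑ b).re = -‖c b‖ := by
    rcases hcrit b imb with ⟨-, h1⟩ | ⟨h1, -⟩
    · have := h.potF_eq_of_nonneg (hpos b) (hpos tM) (by linarith) (h1.trans hmaxval.symm)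
      linarith
    · exact h1
  have hd : HasDerivAt (tangComp c (ϑ a)) 1 a := by
    have := hasDerivAt_tangComp hC.isArc (ϑ a) (mem_univ a)
    rwa [sub_self, Real.cos_zero] at this
  obtain ⟨t, ht, ht0⟩ := exists_zero_of_deriv_pos hab
    (fun t _ => (hasDerivAt_tangComp hC.isArc (ϑ a) (mem_univ t)).continuousAt.continuousWithinAt)
    hd one_pos (by rw [tangComp_self, ima, neg_zero]) (by
      rw [tangComp_of_im_eq_zero imb, hre]
      have h1 := Real.sin_pos_of_pos_of_lt_pi hturn0 hturn
      have h2 := hpos b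
      nlinarith [mul_pos h1 h2])
  exact (h.tangComp_ne_zero hC h0 ima imb hanti.injOn ht).1 ht0

end Admissible

end PlanarCurvature

namespace PlanarCurvature

variable {g : ℝ → ℝ} {σ : ℝ} {c : ℝ → ℂ} {ϑ : ℝ → ℝ} {L : ℝ}

lemma tangComp_add {α x : ℝ} (hx : Real.sin x = 0) (t : ℝ) :
    tangComp c (α + x) t = Real.cos x * tangComp c α t := by
  have h1 : Complex.exp (-(((α + x : ℝ) : ℂ) * Complex.I)) =
      ((Real.cos x : ℝ) : ℂ) * Complex.exp (-((α : ℂ) * Complex.I)) := by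
    rw [show -(((α + x : ℝ) : ℂ) * Complex.I) = ((-x : ℝ) : ℂ) * Complex.I + -((α : ℂ) * Complex.I)
        by
      push_cast; ring, Complex.exp_add, Complex.exp_mul_I, ← Complex.ofReal_cos,
      ← Complex.ofReal_sin, Real.cos_neg, Real.sin_neg, hx]
    simp
  rw [tangComp, h1, tangComp, mul_left_comm, Complex.re_ofReal_mul]

lemma IsClosedSolution.exists_angle_period (hC : IsClosedSolution g c ϑ L) (t : ℝ) :
    ∃ k : ℤ, ϑ (t + L) - ϑ t = k * (2 * Real.pi) := by
  have h1 := (hC.isArc.hasDerivAt (t + L) (mem_univ _)).comp_add_const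
  rw [show (fun s => c (s + L)) = c from funext hC.periodic] at h1
  obtain ⟨k, hk⟩ := Complex.exp_eq_exp_iff_exists_int.1
      (h1.unique (hC.isArc.hasDerivAt t (mem_univ _)))
  refine ⟨k, ?_⟩
  have h2 : ((ϑ (t + L) - ϑ t - k * (2 * Real.pi) : ℝ) : ℂ) * Complex.I = 0 := by
    push_cast
    linear_combination hk
  have := Complex.ofReal_eq_zero.1 ((mul_eq_zero.1 h2).resolve_right Complex.I_ne_zero)
  linarith

namespace Admissible

/-- A closed solution does not pass through `0`. Otherwise it consists of a single symmetric loop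
based at `0`; each half of the loop turns by a multiple of `π` and hence crosses the symmetry
line. -/
lemma ne_zero_at_zero (h : Admissible g σ) (hC : IsClosedSolution g c ϑ L) : c 0 ≠ 0 := by
  intro hc0
  have hL := hC.pos
  have hcL : c L = 0 := by
    have := hC.periodic 0
    rwa [zero_add, hc0] at this
  have hen : ∀ t, energy g c ϑ t = 0 := fun t => by
    rw [h.energy_eq ordConnected_univ hC.isArc (mem_univ t) (mem_univ 0), energy, comoving, hc0]
    simp [potG_zero]
  have hne : ∀ t ∈ Ioo 0 L, c t ≠ 0 := by
    intro t ht h0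
    obtain ⟨k, hk⟩ := hC.eq_iff t 0 (by rw [h0, hc0])
    rw [zero_add] at hk
    have h1 : (0 : ℝ) < k := by
      by_contra hle
      nlinarith [ht.1, not_lt.1 hle]
    have h2 : (k : ℝ) < 1 := by
      by_contra hle
      nlinarith [ht.2, not_lt.1 hle]
    have h3 : 0 < k := by exact_mod_cast h1
    have h4 : k < 1 := by exact_mod_cast h2
    omega
  have hcrit : ∀ t, c t ≠ 0 → (comoving c ϑ t).im = 0 → potF g ‖c t‖ = 0 := by
    intro t h0 him
    have h1 := hen t
    have hr : 0 < ‖c t‖ := norm_pos_iff.2 h0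
    rw [energy] at h1
    rcases re_sq_eq_of_im_eq_zero him with h2 | h2
    · rw [potF, ← h1, h2]
    · have := h.potG_pos hr
      rw [h2] at h1
      linarith
  -- The last maximum `τ` of the distance to `0` in one period.
  obtain ⟨tM, hM⟩ := hC.exists_max
  obtain ⟨x, hx, hxM⟩ := hC.periodic.exists_mem_Ico₀ hL tM
  have hcn := hC.continuous.norm
  obtain ⟨τ, ⟨hτI, hτmax⟩, hτgreat⟩ :=
    (isCompact_Icc.inter_right (isClosed_eq hcn continuous_const) :
      IsCompact (Icc 0 L ∩ {t | ‖c t‖ = ‖c tM‖})).exists_isGreatest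
      ⟨x, ⟨hx.1, hx.2.le⟩, by rw [mem_ofPred_eq, hxM]⟩
  have hτmax : ‖c τ‖ = ‖c tM‖ := hτmax
  have hMpos : 0 < ‖c tM‖ := by
    refine lt_of_lt_of_le ?_ (hM (L / 2))
    exact norm_pos_iff.2 (hne _ ⟨by linarith, by linarith⟩)
  have hτ0 : c τ ≠ 0 := norm_pos_iff.1 (hτmax ▸ hMpos)
  have hτ : τ ∈ Ioo 0 L := by
    refine ⟨lt_of_le_of_ne hτI.1 ?_, lt_of_le_of_ne hτI.2 ?_⟩
    · rintro rfl
      exact hτ0 hc0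
    · rintro rfl
      exact hτ0 hcL
  have him : (comoving c ϑ τ).im = 0 := hC.im_eq_zero_of_isExtr (Or.inr
    (Eventually.of_forall fun s => pow_le_pow_left₀ (norm_nonneg _) (hτmax ▸ hM s) 2))
  have hanti : StrictAntiOn (fun t => ‖c t‖) (Icc τ L) := by
    refine hC.strictAntiOn_norm hτ.2 (fun t ht ht0 => ?_)
        (by rw [hcL, norm_zero]; exact norm_nonneg _)
    have h0 := hne t ⟨hτ.1.trans ht.1, ht.2⟩
    have h1 := hcrit t h0 ht0
    have h2 := h.potF_eq_of_nonneg (norm_pos_iff.2 h0) (norm_pos_iff.2 hτ0) h1.ge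
      (h1.trans (hcrit τ hτ0 him).symm)
    exact absurd (hτgreat ⟨⟨(hτ.1.trans ht.1).le, ht.2.le⟩, h2.trans hτmax⟩) (not_le.2 ht.1)
  have hrefl : ∀ a b, a ∈ Ico 0 τ → b = 2 * τ - a → b ≤ L → ∀ t ∈ Icc a b,
      ϑ (2 * τ - t) = 2 * ϑ τ - ϑ t ∧ ‖c (2 * τ - t)‖ = ‖c t‖ := by
    intro a b ha hb hbL
    have hsub : Ioo a b ⊆ Ioo 0 L := Ioo_subset_Ioo ha.1 hbL
    have h1 : ∀ t ∈ Ioo a b, ϑ (2 * τ - t) = 2 * ϑ τ - ϑ t ∧ ‖c (2 * τ - t)‖ = ‖c t‖ := by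
      intro t ht
      have := h.reflection isOpen_Ioo ordConnected_Ioo (t₀ := τ) (J := Ioo a b)
        ⟨ha.2, by linarith [ha.2]⟩ (fun t ht => ⟨by linarith [ht.2], by linarith [ht.1]⟩)
        (hC.isArc.mono (subset_univ _)) (fun t ht => hne t (hsub ht)) him ht
      refine ⟨this.1, ?_⟩
      rw [this.2]
      simp [Complex.norm_exp_ofReal_mul_I]
    have hcl : IsClosed {t | ϑ (2 * τ - t) = 2 * ϑ τ - ϑ t ∧ ‖c (2 * τ - t)‖ = ‖c t‖} := by
      have hϑ := hC.continuous_angle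
      exact (isClosed_eq (by fun_prop) (by fun_prop)).inter
        (isClosed_eq (hcn.comp (by fun_prop : Continuous fun t => 2 * τ - t)) hcn)
    have h2 := closure_minimal (fun t ht => h1 t ht : Ioo a b ⊆ _) hcl
    rw [closure_Ioo (by linarith [ha.2])] at h2
    exact fun t ht => h2 ht
  have hL2 : L = 2 * τ := by
    rcases lt_trichotomy L (2 * τ) with hlt | heq | hlt
    · have h1 := (hrefl (2 * τ - L) L ⟨by linarith, by linarith [hτ.2]⟩ (by ring) le_rfl L
        ⟨by linarith [hτ.2], le_rfl⟩).2
      rw [hcL, norm_zero, norm_eq_zero] at h1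
      exact absurd h1 (hne _ ⟨by linarith, by linarith [hτ.2]⟩)
    · exact heq
    · have h1 := (hrefl 0 (2 * τ) ⟨le_rfl, hτ.1⟩ (by ring) hlt.le 0
        ⟨le_rfl, by linarith [hτ.1]⟩).2
      rw [hc0, norm_zero, norm_eq_zero, sub_zero] at h1
      exact absurd h1 (hne _ ⟨by linarith [hτ.1], hlt⟩)
  have hϑL : ϑ L = 2 * ϑ τ - ϑ 0 := by
    have h1 := (hrefl 0 (2 * τ) ⟨le_rfl, hτ.1⟩ (by ring) hL2.ge 0 ⟨le_rfl, by linarith [hτ.1]⟩).1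
    rwa [sub_zero, ← hL2] at h1
  obtain ⟨k, hk⟩ := hC.exists_angle_period 0
  rw [zero_add] at hk
  have hneτ : ∀ t ∈ Ioo τ L, c t ≠ 0 := fun t ht => hne t ⟨hτ.1.trans ht.1, ht.2⟩
  have hkπ : ϑ L = ϑ τ + k * Real.pi := by linarith
  have hmono := h.angle_strictMonoOn hC hneτ ⟨le_rfl, hτ.2.le⟩ ⟨hτ.2.le, le_rfl⟩ hτ.2
  have hpi := Real.pi_pos
  have hk1 : (1 : ℝ) ≤ k := by
    have h1 : (0 : ℝ) < k := by
      by_contra hle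
      nlinarith [not_lt.1 hle]
    have h2 : 0 < k := by exact_mod_cast h1
    exact_mod_cast Int.add_one_le_iff.2 h2
  obtain ⟨t, ht, ht0⟩ := h.exists_tangComp_zero hC hτ.2 hneτ (by nlinarith)
    (by rw [tangComp_self, him, neg_zero]) (by simp [tangComp, hcL]) (Or.inr hanti)
  have hz : tangComp c (ϑ τ) t = 0 := by
    rcases ht0 with h1 | h1
    · exact h1
    · rw [hkπ, tangComp_add (Real.sin_int_mul_pi k)] at h1
      refine (mul_eq_zero.1 h1).resolve_left fun h2 => ?_
      have h3 := Real.sin_sq_add_cos_sq (k * Real.pi)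
      rw [h2, Real.sin_int_mul_pi] at h3
      norm_num at h3
  have hcross := h.crossing isOpen_Ioo ordConnected_Ioo (t₀ := τ) (J := Ioo 0 L) hτ
    (fun t ht => ⟨by linarith [ht.2], by linarith [ht.1]⟩)
    (hC.isArc.mono (subset_univ _)) hne him ⟨hτ.1.trans ht.1, ht.2⟩ hz
  obtain ⟨j, hj⟩ := hC.eq_iff _ _ hcross
  have h1 : (j : ℝ) < 0 := by
    by_contra hle
    nlinarith [ht.1, not_lt.1 hle]
  have h2 : (-1 : ℝ) < j := by
    by_contra hle
    nlinarith [ht.2, not_lt.1 hle]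
  have h3 : j < 0 := by exact_mod_cast h1
  have h4 : -1 < j := by exact_mod_cast h2
  omega

lemma closed_ne_zero (h : Admissible g σ) (hC : IsClosedSolution g c ϑ L) (t : ℝ) : c t ≠ 0 := by
  have := h.ne_zero_at_zero (hC.shift t)
  rwa [zero_add] at this

lemma closed_energy_neg (h : Admissible g σ) (hC : IsClosedSolution g c ϑ L) :
    energy g c ϑ 0 < 0 :=
  h.energy_neg_of_ne_zero hC (h.closed_ne_zero hC)

end Admissible

end PlanarCurvature

namespace PlanarCurvature

/-! ### Solutions of negative energy -/

/-- The total turning along the orbit of amplitude `A`, up to time `t`. -/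
noncomputable def orbTurn (g : ℝ → ℝ) (σ A t : ℝ) : ℝ := ∫ s in (0 : ℝ)..t, g ‖orbU g σ A s‖

/-- The solution with tangent angle `orbTurn` whose motion in the moving frame is `orbU`. -/
noncomputable def orbCurve (g : ℝ → ℝ) (σ A t : ℝ) : ℂ :=
  -Complex.I * (starRingEnd ℂ) (orbU g σ A t) * Complex.exp (orbTurn g σ A t * Complex.I)

variable {g : ℝ → ℝ} {σ A : ℝ} {c : ℝ → ℂ} {ϑ : ℝ → ℝ} {L : ℝ}

lemma norm_orbCurve (t : ℝ) : ‖orbCurve g σ A t‖ = ‖orbU g σ A t‖ := by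
  simp [orbCurve, Complex.norm_exp_ofReal_mul_I]

lemma comoving_orbCurve (t : ℝ) : comoving (orbCurve g σ A) (orbTurn g σ A) t = orbU g σ A t := by
  simp only [comoving, orbCurve, map_mul, map_neg, Complex.conj_I, Complex.conj_conj,
    conj_exp_mul_I]
  linear_combination (-(orbU g σ A t)) * Complex.I ^ 2 * exp_mul_exp_neg
      (orbTurn g σ A t * Complex.I) -
    (orbU g σ A t) * Complex.I_sq

lemma orbTurn_zero : orbTurn g σ A 0 = 0 := by simp [orbTurn]

lemma mem_rotationClass_self (Γ : Set ℂ) : Γ ∈ rotationClass Γ := ⟨0, by simp⟩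

lemma rotationClass_image (Γ : Set ℂ) (α : ℝ) :
    rotationClass ((fun z : ℂ => Complex.exp ((α : ℂ) * Complex.I) * z) '' Γ) = rotationClass Γ :=
        by
  have hadd : ∀ a b : ℝ, (fun z : ℂ => Complex.exp ((a : ℂ) * Complex.I) * z) ''
      ((fun z : ℂ => Complex.exp ((b : ℂ) * Complex.I) * z) '' Γ) =
      (fun z : ℂ => Complex.exp (((a + b : ℝ) : ℂ) * Complex.I) * z) '' Γ := by
    intro a b
    rw [image_image]
    congr 1
    funext z
    rw [← mul_assoc, ← Complex.exp_add]
    push_cast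
    ring_nf
  apply Subset.antisymm
  · rintro _ ⟨β, rfl⟩
    exact ⟨β + α, hadd β α⟩
  · rintro _ ⟨β, rfl⟩
    exact ⟨β - α, by rw [hadd, sub_add_cancel]⟩

namespace Admissible

lemma hasDerivAt_orbTurn (h : Admissible g σ) (hA : |A| < maxAmp g σ) (t : ℝ) :
    HasDerivAt (orbTurn g σ A) (g ‖orbU g σ A t‖) t :=
  intervalIntegral.integral_hasDerivAt_right
    ((h.continuous_comp_norm (h.isFlowLine_orbU hA)).intervalIntegrable _ _)
    ((h.continuous_comp_norm (h.isFlowLine_orbU hA)).stronglyMeasurableAtFilter _ _)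
    (h.continuous_comp_norm (h.isFlowLine_orbU hA)).continuousAt

lemma orbCurve_ne_zero (h : Admissible g σ) (hA : |A| < maxAmp g σ) (t : ℝ) :
    orbCurve g σ A t ≠ 0 := by
  rw [← norm_ne_zero_iff, norm_orbCurve]
  exact ((h.isFlowLine_orbU hA).norm_pos t).ne'

lemma isArc_orbCurve (h : Admissible g σ) (hA : |A| < maxAmp g σ) :
    IsArc g univ (orbCurve g σ A) (orbTurn g σ A) := by
  refine ⟨fun t _ => ?_, fun t _ => (h.hasDerivAt_orbTurn hA t).continuousAt.continuousWithinAt,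
    fun t _ _ => ?_⟩
  · have h1 := ((h.isFlowLine_orbU hA) t).2.star
    have h2 := (h1.const_mul (-Complex.I)).fun_mul
        (hasDerivAt_exp_mul_I (h.hasDerivAt_orbTurn hA t))
    refine h2.congr_deriv ?_
    simp only [RCLike.star_def, map_sub, map_mul, Complex.conj_I, Complex.conj_ofReal]
    linear_combination (-Complex.exp (orbTurn g σ A t * Complex.I)) * Complex.I_sq
  · rw [norm_orbCurve]
    exact h.hasDerivAt_orbTurn hA t

lemma orbTurn_neg (h : Admissible g σ) (hA : |A| < maxAmp g σ) (t : ℝ) :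
    orbTurn g σ A (-t) = -orbTurn g σ A t := by
  have h1 := intervalIntegral.integral_comp_neg (fun s => g ‖orbU g σ A s‖) (a := 0) (b := t)
  simp only [h.orbU_neg hA, RCLike.norm_conj, neg_zero] at h1
  rw [orbTurn, orbTurn, h1, intervalIntegral.integral_symm]

lemma orbTurn_add_period (h : Admissible g σ) (hA : |A| < maxAmp g σ) (t : ℝ) :
    orbTurn g σ A (t + 2 * orbHalf g σ A) = orbTurn g σ A t + 2 * orbTurn g σ A (orbHalf g σ A) :=
        by
  have hp : Function.Periodic (fun s => g ‖orbU g σ A s‖) (2 * orbHalf g σ A) := fun s => by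
    simp only [h.orbU_periodic hA s]
  have hi := (h.continuous_comp_norm (h.isFlowLine_orbU hA)).intervalIntegrable
    (μ := MeasureTheory.volume)
  have h1 : ∀ t, orbTurn g σ A (t + 2 * orbHalf g σ A) =
      orbTurn g σ A t + orbTurn g σ A (2 * orbHalf g σ A) := by
    intro t
    rw [orbTurn, orbTurn, orbTurn, ← intervalIntegral.integral_add_adjacent_intervals (hi 0 t)
        (hi t _),
      hp.intervalIntegral_add_eq t 0, zero_add]
  have h2 := h1 (-orbHalf g σ A)
  rw [h.orbTurn_neg hA, show -orbHalf g σ A + 2 * orbHalf g σ A = orbHalf g σ A by ring] at h2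
  rw [h1]
  linarith

lemma orbTurn_nat_mul (h : Admissible g σ) (hA : |A| < maxAmp g σ) (k : ℕ) :
    orbTurn g σ A (k * orbHalf g σ A) = k * orbTurn g σ A (orbHalf g σ A) := by
  induction k using Nat.twoStepInduction with
  | zero => simp [orbTurn_zero]
  | one => simp
  | more k ih _ =>
    rw [show ((k + 2 : ℕ) : ℝ) * orbHalf g σ A = k * orbHalf g σ A + 2 * orbHalf g σ A by
      push_cast; ring, h.orbTurn_add_period hA, ih]
    push_cast
    ring

lemma orbU_nat_mul_im (h : Admissible g σ) (hA : |A| < maxAmp g σ) (k : ℕ) :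
    (orbU g σ A (k * orbHalf g σ A)).im = 0 := by
  rw [← Complex.conj_eq_iff_im, ← h.orbU_neg hA]
  have := (h.orbU_periodic hA).nat_mul k (-(k * orbHalf g σ A))
  rw [← this]
  congr 1
  ring

lemma orbU_re_pos (h : Admissible g σ) (hA : |A| < maxAmp g σ) (t : ℝ) : 0 < (orbU g σ A t).re := by
  rw [orbU_re]
  exact h.orbX_pos hA _

lemma norm_orbU_zero (h : Admissible g σ) (hA : |A| < maxAmp g σ) :
    ‖orbU g σ A 0‖ = radR g σ (-A) := by
  have h0 := orb_range hA 0
  rw [Real.cos_zero, mul_one] at h0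
  rw [h.orbU_zero hA, Complex.norm_real, Real.norm_of_nonneg (h.radR_pos h0).le]

/-- Closing up as a simple curve forces the turning per half period to be `π / n` with `n ≥ 2`.
Take the first multiple `nΔ` of the turning `Δ` that reaches `π`. If it exceeds `π`, then the
curve meets the symmetry line of its starting point strictly between two extrema. -/
lemma exists_turn_eq (h : Admissible g σ) (hA : |A| < maxAmp g σ) (hA0 : 0 < A)
    (hC : IsClosedSolution g (orbCurve g σ A) (orbTurn g σ A) L) :
    ∃ n : ℕ, 2 ≤ n ∧ n * orbTurn g σ A (orbHalf g σ A) = Real.pi := by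
  set τ := orbHalf g σ A with hτdef
  set Δ := orbTurn g σ A τ with hΔdef
  have hτ : 0 < τ := h.orbHalf_pos hA
  have h0 := h.orbCurve_ne_zero hA
  have him : ∀ k : ℕ, (comoving (orbCurve g σ A) (orbTurn g σ A) (k * τ)).im = 0 := fun k => by
    rw [comoving_orbCurve]; exact h.orbU_nat_mul_im hA k
  have him0 : (comoving (orbCurve g σ A) (orbTurn g σ A) 0).im = 0 := by simpa using him 0
  have him1 : (comoving (orbCurve g σ A) (orbTurn g σ A) τ).im = 0 := by simpa using him 1
  have hΔ0 : 0 < Δ := by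
    have := h.angle_strictMonoOn hC (a := 0) (b := τ) (fun t _ => h0 t) ⟨le_rfl, hτ.le⟩
      ⟨hτ.le, le_rfl⟩ hτ
    rwa [orbTurn_zero] at this
  have hΔπ : Δ < Real.pi := by
    have := h.turning_lt_pi hC h0 hτ him0 him1 (Or.inl (by
      simp only [norm_orbCurve]
      exact h.norm_orbU_strictMonoOn hA hA0))
    rwa [orbTurn_zero, sub_zero] at this
  have htan : ∀ k : ℕ, tangComp (orbCurve g σ A) (orbTurn g σ A 0) (k * τ) =
      (orbU g σ A (k * τ)).re * Real.sin (k * Δ) := by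
    intro k
    rw [tangComp_of_im_eq_zero (him k), comoving_orbCurve, orbTurn_zero, sub_zero,
      h.orbTurn_nat_mul hA]
  obtain ⟨m, hm1, hm2⟩ : ∃ m : ℕ, m * Δ < Real.pi ∧ Real.pi ≤ (m + 1 : ℕ) * Δ := by
    have hex : ∃ n : ℕ, Real.pi ≤ n * Δ := by
      obtain ⟨n, hn⟩ := exists_nat_gt (Real.pi / Δ)
      exact ⟨n, ((div_lt_iff₀ hΔ0).1 hn).le⟩
    classical
    have hpos : Nat.find hex ≠ 0 := fun he => by
      have := Nat.find_spec hex
      rw [he] at this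
      simp at this
      linarith [Real.pi_pos]
    refine ⟨Nat.find hex - 1, not_le.1 (Nat.find_min hex (Nat.sub_one_lt hpos)), ?_⟩
    rw [Nat.sub_add_cancel (Nat.pos_of_ne_zero hpos)]
    exact Nat.find_spec hex
  have hm0 : 1 ≤ m := by
    by_contra hlt
    have : m = 0 := by omega
    subst this
    simp at hm2
    linarith
  have hm0' : (1 : ℝ) ≤ m := by exact_mod_cast hm0
  refine ⟨m + 1, by omega, ?_⟩
  rcases hm2.eq_or_lt with heq | hlt
  · exact heq.symm
  exfalso
  have e1 : 0 < tangComp (orbCurve g σ A) (orbTurn g σ A 0) (m * τ) := by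
    rw [htan]
    exact mul_pos (h.orbU_re_pos hA _) (Real.sin_pos_of_pos_of_lt_pi (by positivity) hm1)
  have e2 : tangComp (orbCurve g σ A) (orbTurn g σ A 0) ((m + 1 : ℕ) * τ) < 0 := by
    rw [htan]
    refine mul_neg_of_pos_of_neg (h.orbU_re_pos hA _) ?_
    rw [← neg_pos, ← Real.sin_sub_pi]
    apply Real.sin_pos_of_pos_of_lt_pi (by linarith)
    push_cast
    linarith
  have hle : m * τ ≤ (m + 1 : ℕ) * τ := by push_cast; linarith
  obtain ⟨t, ht, ht0⟩ := intermediate_value_Ioo' hle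
    (fun t _ => (hasDerivAt_tangComp hC.isArc (orbTurn g σ A 0)
      (mem_univ t)).continuousAt.continuousWithinAt) (show (0 : ℝ) ∈ Ioo _ _ from ⟨e2, e1⟩)
  have h3 := h.norm_period_of_crossing hC h0 him0 ht0 0
  rw [norm_orbCurve, norm_orbCurve, h.norm_orbU_zero hA, zero_add, sub_zero] at h3
  obtain ⟨k, hk⟩ := h.eq_int_mul_of_norm_orbU hA hA0 h3
  have hk' : t = k * τ := by linarith
  have h4 : (m : ℝ) < k := by
    by_contra hcon
    nlinarith [ht.1, not_lt.1 hcon]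
  have h5 : (k : ℝ) < (m + 1 : ℕ) := by
    by_contra hcon
    nlinarith [ht.2, not_lt.1 hcon]
  have h6 : (m : ℤ) < k := by exact_mod_cast h4
  have h7 : k < (m + 1 : ℕ) := by exact_mod_cast h5
  push_cast at h7
  omega

lemma netWinding_eq_turn (h : Admissible g σ) {s : ℝ} (hs : s ∈ Ioo 0 σ) :
    netWinding g (s : ℂ) =
      Real.pi⁻¹ * orbTurn g σ (ampOf g σ s) (orbHalf g σ (ampOf g σ s)) := by
  have hA := h.abs_ampOf_lt hs
  have h1 := h.orbTurn_add_period hA 0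
  rw [zero_add, orbTurn_zero, zero_add] at h1
  rw [← h.orbU_ampOf_zero hs, h.netWinding_orbU hA (h.ampOf_pos hs), ← orbTurn, h1]
  field_simp

lemma isCircle_range (h : Admissible g σ) (hC : IsClosedSolution g c ϑ L)
    (hn : ∀ t, ‖c t‖ = σ) : IsCircle (range c) := by
  have hσ := h.rad_pos
  refine ⟨0, σ, hσ, ?_⟩
  have h0 : ∀ t, c t ≠ 0 := h.closed_ne_zero hC
  have him : ∀ t, (comoving c ϑ t).im = 0 := fun t => hC.im_eq_zero_of_isExtr
    (Or.inl (Eventually.of_forall fun s => by simp only [hn]; exact le_rfl))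
  have hϑ : ∀ t, ϑ t = ϑ 0 + t * g σ := by
    intro t
    have hd : ∀ x, HasDerivAt (fun t => ϑ t - t * g σ) 0 x := fun x => by
      have h1 := hC.isArc.hasDerivAt_angle x (mem_univ x) (h0 x)
      rw [hn] at h1
      have h2 : HasDerivAt (fun t : ℝ => t * g σ) (g σ) x := by
        simpa using (hasDerivAt_id' x).mul_const (g σ)
      simpa using h1.fun_sub h2
    have := is_const_of_deriv_eq_zero (fun x => (hd x).differentiableAt) (fun x => (hd x).deriv) t 0
    simp only [zero_mul, sub_zero] at this
    linarith
  have hre : ∀ t, (comoving c ϑ t).re = σ := fun t =>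
    (h.norm_eq_rad_of_const hC.isArc isOpen_univ (mem_univ t) hσ (fun t _ => hn t)).2
  apply Subset.antisymm
  · rintro _ ⟨t, rfl⟩
    simp [hn t]
  · intro z hz
    rw [mem_sphere_zero_iff_norm] at hz
    have hg := h.pos σ hσ
    refine ⟨(Complex.arg (Complex.I * z) - ϑ 0) / g σ, ?_⟩
    rw [exp_eq_of_comoving_im (him _), hre, hϑ, div_mul_cancel₀ _ hg.ne', add_sub_cancel]
    have h1 := Complex.norm_mul_exp_arg_mul_I (Complex.I * z)
    rw [norm_mul, Complex.norm_I, one_mul, hz] at h1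
    rw [mul_assoc, h1]
    linear_combination (-z) * Complex.I_sq

lemma energy_orbCurve (h : Admissible g σ) (hA : |A| < maxAmp g σ) (t : ℝ) :
    energy g (orbCurve g σ A) (orbTurn g σ A) t = potF g σ + A ^ 2 := by
  rw [energy, norm_orbCurve, comoving_orbCurve, h.norm_orbU hA, orbU_re, h.orbX_eq hA]
  ring

/-- The energy determines a solution that avoids `0`, up to a rotation and a shift of time. -/
lemma exists_rotation_orbCurve (h : Admissible g σ) (hA : |A| < maxAmp g σ) (hA0 : 0 < A)
    {J : Set ℝ} (hJ : IsOpen J) (hJ' : J.OrdConnected) {t₀ : ℝ} (ht₀ : t₀ ∈ J)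
    (ha : IsArc g J c ϑ) (h0 : ∀ t ∈ J, c t ≠ 0) (hE : energy g c ϑ t₀ = potF g σ + A ^ 2) :
    ∃ x α : ℝ, ∀ t ∈ J, c t = Complex.exp ((α : ℂ) * Complex.I) * orbCurve g σ A (t + x) := by
  obtain ⟨y, hy⟩ := h.exists_orbU_eq hA hA0 (w := comoving c ϑ t₀) (comoving_ne_zero (h0 t₀ ht₀))
    (by rw [norm_comoving, ← hE, energy])
  set x := y - t₀ with hx
  have ha' : IsArc g J (fun t => orbCurve g σ A (t + x)) (fun t => orbTurn g σ A (t + x)) := by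
    have hao := h.isArc_orbCurve hA
    refine ⟨fun t _ => (hao.hasDerivAt _ (mem_univ _)).comp_add_const, ?_,
      fun t _ h0 => (hao.hasDerivAt_angle _ (mem_univ _) h0).comp_add_const⟩
    exact ((continuousOn_univ.1 hao.continuousOn).comp
      (by fun_prop : Continuous fun t => t + x)).continuousOn
  have hcom : ∀ t, comoving (fun t => orbCurve g σ A (t + x)) (fun t => orbTurn g σ A (t + x)) t =
      orbU g σ A (t + x) := fun t => by
    rw [← comoving_orbCurve, comoving, comoving]
  have he := h.flow_eqOn hJ hJ'.isPreconnected (ha.flow h0)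
    (ha'.flow fun t _ => h.orbCurve_ne_zero hA _) ht₀ (by
      rw [hcom, ← hy, hx, add_sub_cancel])
  exact ⟨x, _, fun t ht => (eq_rotation hJ hJ' ha ha' h0 he ht₀ ht).2⟩

/-- Every simple closed solution is the circle of radius `σ`, or a rotated copy of one of the
explicit solutions, of net winding `1 / n` with `n ≥ 2`. -/
theorem classification_closed (h : Admissible g σ) (hC : IsClosedSolution g c ϑ L) :
    IsCircle (range c) ∨ ∃ n : ℕ, 2 ≤ n ∧ ∃ s ∈ Ioo 0 σ, netWinding g (s : ℂ) = (n : ℝ)⁻¹ ∧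
      rotationClass (range c) = rotationClass (range (orbCurve g σ (ampOf g σ s))) := by
  have h0 : ∀ t, c t ≠ 0 := h.closed_ne_zero hC
  have hE := h.closed_energy_neg hC
  have hen : ∀ t, energy g c ϑ t = energy g c ϑ 0 := fun t =>
    h.energy_eq ordConnected_univ hC.isArc (mem_univ t) (mem_univ 0)
  set E := energy g c ϑ 0 with hEdef
  have hle : potF g σ ≤ E := h.rad_energy_le 0
  rcases hle.eq_or_lt with heq | hlt
  · left
    apply h.isCircle_range hC
    intro t
    by_contra hne
    have h1 := h.potF_rad_lt (norm_nonneg (c t)) hne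
    have h2 := potF_le_energy (g := g) (c := c) (ϑ := ϑ) t
    rw [hen] at h2
    linarith
  · right
    obtain ⟨A, hA0, hA2⟩ : ∃ A : ℝ, 0 < A ∧ A ^ 2 = E - potF g σ :=
      ⟨√(E - potF g σ), Real.sqrt_pos.2 (by linarith), Real.sq_sqrt (by linarith)⟩
    have hA : |A| < maxAmp g σ := by
      apply abs_lt_of_sq_lt_sq _ h.maxAmp_pos.le
      rw [h.maxAmp_sq]
      linarith
    have hA' : A < maxAmp g σ := (le_abs_self A).trans_lt hA
    have hAm : -A ∈ Ioi (-maxAmp g σ) := mem_Ioi.2 (by linarith)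
    have hs : radR g σ (-A) ∈ Ioo 0 σ := by
      refine ⟨h.radR_pos hAm, ?_⟩
      have := h.radR_strictMonoOn hAm (mem_Ioi.2 (by linarith [h.maxAmp_pos]) : (0 : ℝ) ∈ _)
        (by linarith)
      rwa [h.radR_zero] at this
    have hamp : ampOf g σ (radR g σ (-A)) = A := by rw [ampOf, h.rootV_radR hAm, neg_neg]
    obtain ⟨x, α, hx⟩ := h.exists_rotation_orbCurve hA hA0 isOpen_univ ordConnected_univ
      (mem_univ 0) hC.isArc (fun t _ => h0 t) (by rw [hA2]; linarith)
    have hC₁ := hC.shift (-x)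
    have hrot : ∀ t, c (t + -x) = Complex.exp ((α : ℂ) * Complex.I) * orbCurve g σ A t := fun t =>
        by
      rw [hx _ (mem_univ _), neg_add_cancel_right]
    have hCo : IsClosedSolution g (orbCurve g σ A) (orbTurn g σ A) L := by
      refine ⟨h.isArc_orbCurve hA, hC.pos, fun t => ?_, fun s t hst => ?_⟩
      · have h1 := hC₁.periodic t
        rw [hrot, hrot] at h1
        exact mul_left_cancel₀ (Complex.exp_ne_zero _) h1
      · exact hC₁.eq_iff s t (by rw [hrot, hrot, hst])
    obtain ⟨n, hn, hnΔ⟩ := h.exists_turn_eq hA hA0 hCo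
    refine ⟨n, hn, radR g σ (-A), hs, ?_, ?_⟩
    · rw [h.netWinding_eq_turn hs, hamp]
      have hn0 : (n : ℝ) ≠ 0 := by positivity
      have hpi := Real.pi_ne_zero
      field_simp
      linarith
    · have hrange : range c = (fun z : ℂ => Complex.exp ((α : ℂ) * Complex.I) * z) ''
          range (orbCurve g σ A) := by
        rw [← range_comp]
        apply Subset.antisymm
        · rintro _ ⟨t, rfl⟩
          refine ⟨t + x, ?_⟩
          rw [Function.comp_apply, ← hrot, add_neg_cancel_right]
        · rintro _ ⟨t, rfl⟩
          exact ⟨t + -x, hrot t⟩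
      rw [hamp, hrange, rotationClass_image]

end Admissible

end PlanarCurvature

namespace PlanarCurvature

/-! ### The explicit solutions are smooth and simple closed -/

/-- The polar angle of the explicit solution, up to the constant `-π/2`. -/
noncomputable def polarAngle (g : ℝ → ℝ) (σ A t : ℝ) : ℝ :=
  orbTurn g σ A t - (Complex.log (orbU g σ A t)).im

variable {g : ℝ → ℝ} {σ A : ℝ} {J J' : Set ℝ} {c c' : ℝ → ℂ} {ϑ ϑ' : ℝ → ℝ}

lemma orbCurve_eq_polar (t : ℝ) : orbCurve g σ A t =
    (‖orbU g σ A t‖ : ℂ) * (-Complex.I * Complex.exp (polarAngle g σ A t * Complex.I)) := by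
  have h1 := congrArg (starRingEnd ℂ) (Complex.norm_mul_exp_arg_mul_I (orbU g σ A t))
  rw [map_mul, Complex.conj_ofReal, conj_exp_mul_I] at h1
  have h2 : Complex.exp (polarAngle g σ A t * Complex.I) =
      Complex.exp (-((orbU g σ A t).arg * Complex.I)) * Complex.exp (orbTurn g σ A t * Complex.I) :=
          by
    rw [← Complex.exp_add, polarAngle, Complex.log_im]
    congr 1
    push_cast
    ring
  rw [orbCurve, ← h1, h2]
  ring

lemma exists_polarAngle_eq {s t : ℝ} {z : ℂ} (hs : ∃ r : ℝ, 0 < r ∧ z =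
    (r : ℂ) * (-Complex.I * Complex.exp (s * Complex.I))) (ht : ∃ r : ℝ, 0 < r ∧ z =
    (r : ℂ) * (-Complex.I * Complex.exp (t * Complex.I))) : ∃ k : ℤ, s = t + k * (2 * Real.pi) := by
  obtain ⟨r, hr, h1⟩ := hs
  obtain ⟨r', hr', h2⟩ := ht
  have n1 : ‖z‖ = r := by simp [h1, Complex.norm_exp_ofReal_mul_I, abs_of_pos hr]
  have n2 : ‖z‖ = r' := by simp [h2, Complex.norm_exp_ofReal_mul_I, abs_of_pos hr']
  have hrr : r = r' := n1.symm.trans n2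
  have hr0 : (r : ℂ) ≠ 0 := by exact_mod_cast hr.ne'
  rw [← hrr, h1] at h2
  have h3 := mul_left_cancel₀ (neg_ne_zero.2 Complex.I_ne_zero) (mul_left_cancel₀ hr0 h2)
  obtain ⟨k, hk⟩ := Complex.exp_eq_exp_iff_exists_int.1 h3
  refine ⟨k, ?_⟩
  have h5 : ((s - (t + k * (2 * Real.pi)) : ℝ) : ℂ) * Complex.I = 0 := by
    push_cast
    linear_combination hk
  have := Complex.ofReal_eq_zero.1 ((mul_eq_zero.1 h5).resolve_right Complex.I_ne_zero)
  linarith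

lemma IsSolution.exists_isArc (hs : IsSolution g J c) : ∃ ϑ, IsArc g J c ϑ := by
  obtain ⟨ϑ, h1, h2, h3⟩ := hs.curvature
  refine ⟨ϑ, fun t ht => ?_, h1.continuousOn, fun t ht h0 => ?_⟩
  · rw [← h2 t ht]
    exact ((hs.smooth.contDiffAt (hs.isOpen.mem_nhds ht)).differentiableAt (by simp)).hasDerivAt
  · rw [← h3 t ht h0]
    exact ((h1.contDiffAt (hs.isOpen.mem_nhds ht)).differentiableAt (by simp)).hasDerivAt

/-- Solutions of different energy meet at countably many pairs of times only, apart from the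
points of one exceptional distance to `0`: elsewhere they are transversal. -/
lemma countable_crossings (ha : IsArc g J c ϑ) (ha' : IsArc g J' c' ϑ') {E E' : ℝ} (hne : E ≠ E')
    (hE : ∀ t ∈ J, energy g c ϑ t = E) (hE' : ∀ t ∈ J', energy g c' ϑ' t = E') :
    {p : ℝ × ℝ | p.1 ∈ J ∧ p.2 ∈ J' ∧ c p.1 = c' p.2 ∧
      2 * potG g ‖c p.1‖ ≠ E + E'}.Countable := by
  apply countable_of_eventually_notMem
  rintro ⟨t, t'⟩ ⟨ht, ht', heq, hr⟩
  simp only at ht ht' heq hr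
  have h1 : HasFDerivAt (fun p : ℝ × ℝ => c p.1) _ (t, t') :=
    (ha.hasDerivAt t ht).hasFDerivAt.comp (t, t') hasFDerivAt_fst
  have h2 : HasFDerivAt (fun p : ℝ × ℝ => c' p.2) _ (t, t') :=
    (ha'.hasDerivAt t' ht').hasFDerivAt.comp (t, t') hasFDerivAt_snd
  have h3 := h1.fun_sub h2
  have hE1 := hE t ht
  have hE2 := hE' t' ht'
  simp only [energy, comoving, ← heq] at hE1 hE2
  set e₁ := Complex.exp (ϑ t * Complex.I) with he₁
  set e₂ := Complex.exp (ϑ' t' * Complex.I) with he₂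
  have n1 : ‖e₁‖ = 1 := Complex.norm_exp_ofReal_mul_I _
  have n2 : ‖e₂‖ = 1 := Complex.norm_exp_ofReal_mul_I _
  have hneq : e₁ ≠ e₂ := fun h => hne (by rw [← hE1, ← hE2, h])
  have hneq' : e₁ ≠ -e₂ := fun h => hr (by
    rw [h] at hE1
    rw [mul_neg, Complex.neg_re] at hE1
    linarith)
  have hker : ((ContinuousLinearMap.toSpanSingleton ℝ e₁).comp (ContinuousLinearMap.fst ℝ ℝ ℝ) -
      (ContinuousLinearMap.toSpanSingleton ℝ e₂).comp
        (ContinuousLinearMap.snd ℝ ℝ ℝ)).toLinearMap.ker = ⊥ := by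
    refine LinearMap.ker_eq_bot'.2 ?_
    rintro ⟨a, b⟩ hab
    have hab' : (a : ℂ) * e₁ - (b : ℂ) * e₂ = 0 := by simpa using hab
    have hab2 : (a : ℂ) * e₁ = (b : ℂ) * e₂ := sub_eq_zero.1 hab'
    have hn : |a| = |b| := by simpa [n1, n2] using congrArg norm hab2
    have ha0 : a = 0 := by
      by_contra ha0
      have hac : (a : ℂ) ≠ 0 := by exact_mod_cast ha0
      rcases abs_eq_abs.1 hn with h4 | h4
      · rw [← h4] at hab2
        exact hneq (mul_left_cancel₀ hac hab2)
      · have hb : b = -a := by linarith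
        rw [hb] at hab2
        apply hneq'
        apply mul_left_cancel₀ hac
        rw [hab2]
        push_cast
        ring
    have hb0 : b = 0 := by rwa [ha0, abs_zero, eq_comm, abs_eq_zero] at hn
    rw [ha0, hb0]
    rfl
  obtain ⟨K, -, hK⟩ := LinearMap.exists_antilipschitzWith _ hker
  filter_upwards [h3.eventually_ne (c := 0) ⟨K, hK⟩] with p hp hpS
  exact hp (sub_eq_zero.2 hpS.2.2.1)

/-- A solution on a circle has constant curvature. -/
lemma IsArc.curvature_eq_of_sphere (ha : IsArc g univ c ϑ) (h0 : ∀ t, c t ≠ 0)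
    (hpos : ∀ t, 0 < g ‖c t‖) {a : ℂ} {ρ : ℝ} (hρ : 0 < ρ) (hs : ∀ t, c t ∈ Metric.sphere a ρ)
    (t : ℝ) : g ‖c t‖ = ρ⁻¹ := by
  have hn : ∀ t, ‖c t - a‖ = ρ := fun t => by
    have := hs t
    rwa [mem_sphere_iff_norm] at this
  set w : ℝ → ℂ := fun t => (starRingEnd ℂ) (c t - a) * Complex.exp (ϑ t * Complex.I) with hw
  have hd : ∀ t, HasDerivAt (fun t => c t - a) (Complex.exp (ϑ t * Complex.I)) t :=
    fun t => (ha.hasDerivAt t (mem_univ t)).sub_const a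
  have hre : ∀ t, (w t).re = 0 := by
    intro t
    have h1 := (hd t).norm_sq
    simp only [hn] at h1
    have h2 := h1.unique (hasDerivAt_const t (ρ ^ 2))
    rw [Complex.inner] at h2
    simp only [hw]
    rw [mul_comm]
    linarith
  have h3 : HasDerivAt w (1 + w t * (g ‖c t‖ * Complex.I)) t := by
    have h4 := (hd t).star.fun_mul (hasDerivAt_exp_mul_I
        (ha.hasDerivAt_angle t (mem_univ t) (h0 t)))
    refine h4.congr_deriv ?_
    simp only [RCLike.star_def, conj_exp_mul_I, hw]
    linear_combination exp_mul_exp_neg (ϑ t * Complex.I)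
  have h5 := (Complex.reCLM.hasFDerivAt.comp_hasDerivAt t h3).unique
    ((hasDerivAt_const t (0 : ℝ)).congr_of_eventuallyEq (Eventually.of_forall hre))
  have h6 : 1 - (w t).im * g ‖c t‖ = 0 := by
    simp at h5
    linarith
  have h7 : (w t).im ^ 2 = ρ ^ 2 := by
    have h8 : ‖w t‖ = ρ := by
      simp only [hw, norm_mul, RCLike.norm_conj, hn, Complex.norm_exp_ofReal_mul_I, mul_one]
    rw [← h8, ← Complex.normSq_eq_norm_sq, Complex.normSq_apply, hre]
    ring
  have hg := hpos t
  have h9 : (w t).im = ρ := by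
    rcases sq_eq_sq_iff_eq_or_eq_neg.1 h7 with h | h
    · exact h
    · rw [h] at h6
      nlinarith
  rw [h9] at h6
  exact eq_inv_of_mul_eq_one_right (by linarith)

namespace Admissible

lemma contDiff_orbU (h : Admissible g σ) (hA : |A| < maxAmp g σ) : ContDiff ℝ ∞ (orbU g σ A) := by
  have hu := h.isFlowLine_orbU hA
  have hd : deriv (orbU g σ A) = fun t => flowField g (orbU g σ A t) := funext fun t =>
      (hu t).2.deriv
  refine contDiff_infty.2 fun n => ?_
  induction n with
  | zero => exact contDiff_zero.2 hu.continuous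
  | succ n ih =>
    have h1 : ((n + 1 : ℕ) : WithTop ℕ∞) = (n : WithTop ℕ∞) + 1 := by push_cast; rfl
    rw [h1, contDiff_succ_iff_deriv]
    refine ⟨fun t => (hu t).2.differentiableAt, fun h2 => by simp at h2, ?_⟩
    rw [hd]
    refine contDiff_iff_contDiffAt.2 fun t => ?_
    exact ContDiffAt.comp t ((h.contDiffAt_flowField (hu t).1).of_le (by exact_mod_cast le_top))
      ih.contDiffAt

lemma contDiff_orbTurn (h : Admissible g σ) (hA : |A| < maxAmp g σ) :
    ContDiff ℝ ∞ (orbTurn g σ A) := by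
  rw [contDiff_infty_iff_deriv]
  refine ⟨fun t => (h.hasDerivAt_orbTurn hA t).differentiableAt, ?_⟩
  rw [show deriv (orbTurn g σ A) = fun t => g ‖orbU g σ A t‖ from
    funext fun t => (h.hasDerivAt_orbTurn hA t).deriv]
  refine contDiff_iff_contDiffAt.2 fun t => ?_
  have hu := h.isFlowLine_orbU hA
  exact (h.smooth.contDiffAt (Ioi_mem_nhds (hu.norm_pos t))).comp t
    ((h.contDiff_orbU hA).contDiffAt.norm ℝ (hu t).1)

lemma isSolution_orbCurve (h : Admissible g σ) (hA : |A| < maxAmp g σ) :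
    IsSolution g univ (orbCurve g σ A) := by
  have ha := h.isArc_orbCurve hA
  refine ⟨isOpen_univ, ordConnected_univ, mem_univ 0, ?_, orbTurn g σ A,
    (h.contDiff_orbTurn hA).contDiffOn, fun t ht => (ha.hasDerivAt t ht).deriv,
    fun t ht h0 => (ha.hasDerivAt_angle t ht h0).deriv⟩
  have h1 : ContDiff ℝ ∞ fun t => (starRingEnd ℂ) (orbU g σ A t) :=
    Complex.conjCLE.contDiff.comp (h.contDiff_orbU hA)
  have h2 : ContDiff ℝ ∞ fun t => Complex.exp (orbTurn g σ A t * Complex.I) :=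
    ((Complex.ofRealCLM.contDiff.comp (h.contDiff_orbTurn hA)).mul contDiff_const).cexp
  exact ((contDiff_const.mul h1).mul h2).contDiffOn

lemma hasDerivAt_polarAngle (h : Admissible g σ) (hA : |A| < maxAmp g σ) (t : ℝ) :
    HasDerivAt (polarAngle g σ A) ((orbU g σ A t).re / ‖orbU g σ A t‖ ^ 2) t := by
  have hu := h.isFlowLine_orbU hA
  have h1 := Complex.imCLM.hasFDerivAt.comp_hasDerivAt t
    ((hu t).2.clog_real (Or.inl (h.orbU_re_pos hA t)))
  refine ((h.hasDerivAt_orbTurn hA t).fun_sub h1).congr_deriv ?_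
  rw [sub_div, mul_div_right_comm, mul_div_cancel_right₀ _ (hu t).1, Complex.imCLM_apply,
    ← Complex.normSq_eq_norm_sq, div_eq_mul_inv Complex.I]
  simp [Complex.inv_re]

lemma polarAngle_strictMono (h : Admissible g σ) (hA : |A| < maxAmp g σ) :
    StrictMono (polarAngle g σ A) := by
  apply strictMono_of_deriv_pos
  intro t
  rw [(h.hasDerivAt_polarAngle hA t).deriv]
  have := (h.isFlowLine_orbU hA).norm_pos t
  have := h.orbU_re_pos hA t
  positivity

lemma polarAngle_add (h : Admissible g σ) (hA : |A| < maxAmp g σ) (t : ℝ) (k : ℤ) :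
    polarAngle g σ A (t + k * (2 * orbHalf g σ A)) =
      polarAngle g σ A t + k * (2 * orbTurn g σ A (orbHalf g σ A)) := by
  have hτ := (h.orbHalf_pos hA).ne'
  have hp : Function.Periodic (fun t => polarAngle g σ A t -
      t * (orbTurn g σ A (orbHalf g σ A) / orbHalf g σ A)) (2 * orbHalf g σ A) := by
    intro t
    simp only [polarAngle, h.orbTurn_add_period hA, h.orbU_periodic hA t]
    field_simp
    ring
  have h1 := hp.int_mul k t
  have h2 : (t + k * (2 * orbHalf g σ A)) * (orbTurn g σ A (orbHalf g σ A) / orbHalf g σ A) =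
      t * (orbTurn g σ A (orbHalf g σ A) / orbHalf g σ A) +
        k * (2 * orbTurn g σ A (orbHalf g σ A)) := by
    field_simp
  linarith

/-- The relation between the turning per half period and `n` that closes the solution. -/
lemma polarAngle_add_length (h : Admissible g σ) (hA : |A| < maxAmp g σ) {n : ℕ}
    (hn : n * orbTurn g σ A (orbHalf g σ A) = Real.pi) (t : ℝ) (k : ℤ) :
    polarAngle g σ A (t + k * (n * (2 * orbHalf g σ A))) =
      polarAngle g σ A t + k * (2 * Real.pi) := by
  have := h.polarAngle_add hA t (k * n)
  push_cast at this
  rw [mul_assoc] at this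
  rw [this, ← hn]
  ring

lemma isClosedSolution_orbCurve (h : Admissible g σ) (hA : |A| < maxAmp g σ) {n : ℕ} (hn0 : n ≠ 0)
    (hn : n * orbTurn g σ A (orbHalf g σ A) = Real.pi) :
    IsClosedSolution g (orbCurve g σ A) (orbTurn g σ A) (n * (2 * orbHalf g σ A)) := by
  have hu := h.isFlowLine_orbU hA
  refine ⟨h.isArc_orbCurve hA, ?_, fun t => ?_, fun s t hst => ?_⟩
  · have := h.orbHalf_pos hA
    positivity
  · have h1 := h.polarAngle_add_length hA hn t 1
    have h2 := (h.orbU_periodic hA).nat_mul n t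
    rw [Int.cast_one, one_mul, one_mul] at h1
    rw [orbCurve_eq_polar, orbCurve_eq_polar, h2, h1]
    have h3 : Complex.exp (((polarAngle g σ A t + 2 * Real.pi : ℝ) : ℂ) * Complex.I) =
        Complex.exp (polarAngle g σ A t * Complex.I) := by
      push_cast
      rw [add_mul, Complex.exp_add, Complex.exp_two_pi_mul_I, mul_one]
    rw [h3]
  · obtain ⟨k, hk⟩ := exists_polarAngle_eq
      ⟨_, hu.norm_pos s, orbCurve_eq_polar s⟩ ⟨_, hu.norm_pos t, hst.trans (orbCurve_eq_polar t)⟩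
    rw [← h.polarAngle_add_length hA hn] at hk
    exact ⟨k, (h.polarAngle_strictMono hA).injective hk⟩

/-- The explicit simple closed solutions are graphs in polar coordinates. -/
lemma polarAngle_surjective (h : Admissible g σ) (hA : |A| < maxAmp g σ) {n : ℕ}
    (hn : n * orbTurn g σ A (orbHalf g σ A) = Real.pi) : Function.Surjective (polarAngle g σ A) :=
        by
  intro y
  have hc : Continuous (polarAngle g σ A) :=
    continuous_iff_continuousAt.2 fun t => (h.hasDerivAt_polarAngle hA t).continuousAt
  have hpi := Real.two_pi_pos
  obtain ⟨k, hk⟩ := exists_int_gt ((y - polarAngle g σ A 0) / (2 * Real.pi))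
  obtain ⟨k', hk'⟩ := exists_int_lt ((y - polarAngle g σ A 0) / (2 * Real.pi))
  rw [div_lt_iff₀ hpi] at hk
  rw [lt_div_iff₀ hpi] at hk'
  apply mem_range_of_exists_le_of_exists_ge hc
  · exact ⟨0 + k' * (n * (2 * orbHalf g σ A)), by rw [h.polarAngle_add_length hA hn]; linarith⟩
  · exact ⟨0 + k * (n * (2 * orbHalf g σ A)), by rw [h.polarAngle_add_length hA hn]; linarith⟩

lemma not_isCircle_orbCurve (h : Admissible g σ) (hA : |A| < maxAmp g σ) (hA0 : 0 < A) :
    ¬ IsCircle (range (orbCurve g σ A)) := by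
  rintro ⟨a, ρ, hρ, hs⟩
  have h0 := h.orbCurve_ne_zero hA
  have h1 := (h.isArc_orbCurve hA).curvature_eq_of_sphere h0
    (fun t => h.pos _ (norm_pos_iff.2 (h0 t))) hρ (fun t => hs ▸ mem_range_self t)
  have hτ := h.orbHalf_pos hA
  have h2 := h.injOn (norm_pos_iff.2 (h0 0)) (norm_pos_iff.2 (h0 (orbHalf g σ A)))
    ((h1 0).trans (h1 _).symm)
  rw [norm_orbCurve, norm_orbCurve] at h2
  exact (h.norm_orbU_strictMonoOn hA hA0 ⟨le_rfl, hτ.le⟩ ⟨hτ.le, le_rfl⟩ hτ).ne h2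

end Admissible

/-- A simple closed curve is homeomorphic to the circle. -/
lemma IsClosedSolution.nonempty_homeomorph {L : ℝ} (hC : IsClosedSolution g c ϑ L) :
    Nonempty (range c ≃ₜ Circle) := by
  have hL : Fact (0 < L) := ⟨hC.pos⟩
  have hinj : Function.Injective (hC.periodic.lift : AddCircle L → ℂ) := by
    intro x y hxy
    obtain ⟨s, rfl⟩ := QuotientAddGroup.mk_surjective x
    obtain ⟨t, rfl⟩ := QuotientAddGroup.mk_surjective y
    obtain ⟨k, hk⟩ := hC.eq_iff s t hxy
    refine QuotientAddGroup.eq_iff_sub_mem.2 (AddSubgroup.mem_zmultiples_iff.2 ⟨k, ?_⟩)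
    rw [zsmul_eq_mul]
    linarith
  have hcont : Continuous (hC.periodic.lift : AddCircle L → ℂ) :=
    continuous_coinduced_dom.2 hC.continuous
  have hemb := (hcont.isClosedEmbedding hinj).isEmbedding
  have hrange : range (hC.periodic.lift : AddCircle L → ℂ) = range c := by
    apply Subset.antisymm
    · rintro _ ⟨x, rfl⟩
      obtain ⟨s, rfl⟩ := QuotientAddGroup.mk_surjective x
      exact ⟨s, rfl⟩
    · rintro _ ⟨s, rfl⟩
      exact ⟨(s : AddCircle L), rfl⟩
  exact ⟨(Homeomorph.setCongr hrange.symm).trans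
    (hemb.toHomeomorph.symm.trans (AddCircle.homeomorphCircle hC.pos.ne'))⟩

end PlanarCurvature

namespace PlanarCurvature

variable {g : ℝ → ℝ} {σ A : ℝ} {J : Set ℝ} {c : ℝ → ℂ} {ϑ : ℝ → ℝ}

/-! ### Maximality of the explicit solutions -/

namespace Admissible

/-- A solution of another energy does not contain the trace of an explicit solution. -/
lemma energy_eq_of_range_subset (h : Admissible g σ) (hA : |A| < maxAmp g σ) (hA0 : 0 < A)
    (ha : IsArc g J c ϑ) {E' : ℝ} (hE' : ∀ t ∈ J, energy g c ϑ t = E')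
    (hsub : range (orbCurve g σ A) ⊆ c '' J) : E' = potF g σ + A ^ 2 := by
  by_contra hne
  set E := potF g σ + A ^ 2 with hE
  have hτ := h.orbHalf_pos hA
  have hcount := countable_crossings (h.isArc_orbCurve hA) ha (Ne.symm hne)
    (fun t _ => h.energy_orbCurve hA t) hE'
  have hex : {t | t ∈ Ioo 0 (orbHalf g σ A) ∧ 2 * potG g ‖orbCurve g σ A t‖ = E +
      E'}.Subsingleton := by
    rintro s ⟨hs, hs'⟩ t ⟨ht, ht'⟩
    have hu := h.isFlowLine_orbU hA
    rw [norm_orbCurve] at hs' ht'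
    have h1 := h.potG_strictMonoOn.injOn (hu.norm_pos s).le (hu.norm_pos t).le (by linarith)
    exact (h.norm_orbU_strictMonoOn hA hA0).injOn (Ioo_subset_Icc_self hs)
      (Ioo_subset_Icc_self ht) h1
  have hcov : Ioo 0 (orbHalf g σ A) ⊆ Prod.fst '' {p : ℝ × ℝ | p.1 ∈ univ ∧ p.2 ∈ J ∧
      orbCurve g σ A p.1 = c p.2 ∧ 2 * potG g ‖orbCurve g σ A p.1‖ ≠ E + E'} ∪
      {t | t ∈ Ioo 0 (orbHalf g σ A) ∧ 2 * potG g ‖orbCurve g σ A t‖ = E + E'} := by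
    intro t ht
    by_cases h1 : 2 * potG g ‖orbCurve g σ A t‖ = E + E'
    · exact Or.inr ⟨ht, h1⟩
    · obtain ⟨t', ht', heq⟩ := hsub (mem_range_self t)
      exact Or.inl ⟨(t, t'), ⟨mem_univ _, ht', heq.symm, h1⟩, rfl⟩
  have h0 := (((hcount.image _).union hex.countable).mono hcov).measure_zero
    MeasureTheory.volume
  rw [Real.volume_Ioo, sub_zero, ENNReal.ofReal_eq_zero] at h0
  linarith

/-- A solution of the same energy containing the trace of a closed explicit solution is a part
of a rotated copy. Since both traces are graphs in polar coordinates, they agree. -/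
lemma image_subset_of_range_subset (h : Admissible g σ) (hA : |A| < maxAmp g σ) (hA0 : 0 < A)
    {n : ℕ} (hn0 : n ≠ 0) (hn : n * orbTurn g σ A (orbHalf g σ A) = Real.pi)
    (hs : IsSolution g J c) (hsub : range (orbCurve g σ A) ⊆ c '' J) :
    c '' J ⊆ range (orbCurve g σ A) := by
  obtain ⟨ϑ, ha⟩ := hs.exists_isArc
  have hen : ∀ t ∈ J, energy g c ϑ t = energy g c ϑ 0 := fun t ht =>
    h.energy_eq hs.ordConnected ha ht hs.zero_mem
  have hE := h.energy_eq_of_range_subset hA hA0 ha hen hsub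
  have h0 : ∀ t ∈ J, c t ≠ 0 := by
    intro t ht hz
    have h1 := hen t ht
    rw [hE, energy, comoving, hz] at h1
    simp only [norm_zero, potG_zero, map_zero, mul_zero, zero_mul, Complex.zero_re, sub_zero] at h1
    linarith [h.amp_sq_lt hA]
  obtain ⟨x, α, hx⟩ := h.exists_rotation_orbCurve hA hA0 hs.isOpen hs.ordConnected hs.zero_mem ha
    h0 hE
  have hu := h.isFlowLine_orbU hA
  rintro _ ⟨t', ht', rfl⟩
  rw [hx t' ht']
  set t := t' + x
  have hpol : ∀ t, Complex.exp ((α : ℂ) * Complex.I) * orbCurve g σ A t = (‖orbU g σ A t‖ : ℂ) *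
      (-Complex.I * Complex.exp ((polarAngle g σ A t + α : ℝ) * Complex.I)) := by
    intro t
    rw [orbCurve_eq_polar, Complex.ofReal_add, add_mul, Complex.exp_add]
    ring
  obtain ⟨t₁, ht₁⟩ := h.polarAngle_surjective hA hn (polarAngle g σ A t + α)
  obtain ⟨t₂', ht₂', heq⟩ := hsub (mem_range_self t₁)
  rw [hx t₂' ht₂'] at heq
  set t₂ := t₂' + x
  obtain ⟨k, hk⟩ := exists_polarAngle_eq ⟨_, hu.norm_pos t₁, orbCurve_eq_polar t₁⟩
    ⟨_, hu.norm_pos t₂, heq.symm.trans (hpol t₂)⟩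
  have h2 : polarAngle g σ A t = polarAngle g σ A (t₂ + k * (n * (2 * orbHalf g σ A))) := by
    rw [h.polarAngle_add_length hA hn]
    linarith
  have h3 := (h.polarAngle_strictMono hA).injective h2
  refine ⟨t₁, ?_⟩
  rw [h3, (h.isClosedSolution_orbCurve hA hn0 hn).add_int_mul, heq]

lemma isJordanTrace_orbCurve (h : Admissible g σ) (hA : |A| < maxAmp g σ) (hA0 : 0 < A)
    {n : ℕ} (hn0 : n ≠ 0) (hn : n * orbTurn g σ A (orbHalf g σ A) = Real.pi) :
    IsJordanTrace g (range (orbCurve g σ A)) := by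
  refine ⟨⟨univ, orbCurve g σ A, ⟨h.isSolution_orbCurve hA, fun J' c' hs hsub => ?_⟩, image_univ⟩,
    (h.isClosedSolution_orbCurve hA hn0 hn).nonempty_homeomorph⟩
  rw [image_univ] at hsub ⊢
  exact hsub.antisymm (h.image_subset_of_range_subset hA hA0 hn0 hn hs hsub)

lemma turn_eq_of_netWinding (h : Admissible g σ) {s : ℝ} (hs : s ∈ Ioo 0 σ) {n : ℕ} (hn0 : n ≠ 0)
    (hw : netWinding g (s : ℂ) = (n : ℝ)⁻¹) :
    n * orbTurn g σ (ampOf g σ s) (orbHalf g σ (ampOf g σ s)) = Real.pi := by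
  rw [h.netWinding_eq_turn hs] at hw
  have hn : (n : ℝ) ≠ 0 := by exact_mod_cast hn0
  have hpi := Real.pi_ne_zero
  field_simp at hw
  linarith

/-- The radius `s` is the minimal distance of the trace to `0`, so that it is determined by the
rotation class. -/
lemma isLeast_norm_orbCurve (h : Admissible g σ) {s : ℝ} (hs : s ∈ Ioo 0 σ) :
    IsLeast (norm '' range (orbCurve g σ (ampOf g σ s))) s := by
  have hA := h.abs_ampOf_lt hs
  have hA0 := h.ampOf_pos hs
  have e : radR g σ (-ampOf g σ s) = s := by rw [ampOf, neg_neg, h.radR_rootV hs.1]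
  refine ⟨⟨_, mem_range_self 0, ?_⟩, ?_⟩
  · rw [norm_orbCurve, h.norm_orbU_zero hA, e]
  · rintro _ ⟨_, ⟨t, rfl⟩, rfl⟩
    have h0 := orb_range hA 0
    rw [Real.cos_zero, mul_one] at h0
    rw [norm_orbCurve, h.norm_orbU hA, orbR]
    conv_lhs => rw [← e]
    refine h.radR_strictMonoOn.monotoneOn h0 (orb_range hA _) ?_
    nlinarith [Real.cos_le_one (orbAngle g σ (ampOf g σ s) t)]

end Admissible

lemma norm_image_rotationClass {Γ Γ' : Set ℂ} (h : Γ' ∈ rotationClass Γ) : norm '' Γ' = norm '' Γ :=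
    by
  obtain ⟨α, rfl⟩ := h
  rw [image_image]
  simp [Complex.norm_exp_ofReal_mul_I]

namespace Admissible

lemma eq_of_rotationClass_eq (h : Admissible g σ) {s s' : ℝ} (hs : s ∈ Ioo 0 σ) (hs' : s' ∈ Ioo 0 σ)
    (he : rotationClass (range (orbCurve g σ (ampOf g σ s))) =
      rotationClass (range (orbCurve g σ (ampOf g σ s')))) : s = s' := by
  have h1 := norm_image_rotationClass (he ▸ mem_rotationClass_self _)
  have h2 := h.isLeast_norm_orbCurve hs
  rw [h1] at h2
  exact h2.unique (h.isLeast_norm_orbCurve hs')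

/-! ### Counting -/

/-- The non-circular Jordan solutions modulo rotations are parametrized by the radii `s` of net
winding `1 / n`, `n ≥ 2`. -/
lemma nonCircularJordanModRot_eq (h : Admissible g σ) : nonCircularJordanModRot g =
    (fun s => rotationClass (range (orbCurve g σ (ampOf g σ s)))) ''
      {s | s ∈ Ioo 0 σ ∧ ∃ n : ℕ, 2 ≤ n ∧ netWinding g (s : ℂ) = (n : ℝ)⁻¹} := by
  apply Subset.antisymm
  · rintro _ ⟨Γ, ⟨⟨⟨J, c, ⟨hs, -⟩, rfl⟩, ⟨e⟩⟩, hcirc⟩, rfl⟩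
    obtain ⟨ϑ, ha⟩ := hs.exists_isArc
    obtain ⟨c', ϑ', L, hC, hrange⟩ := exists_closedSolution hs.isOpen hs.ordConnected
      ⟨0, hs.zero_mem⟩ ha e
    rw [← hrange] at hcirc ⊢
    rcases h.classification_closed hC with h1 | ⟨n, hn, s, hs, hw, hrot⟩
    · exact absurd h1 hcirc
    · exact ⟨s, ⟨hs, n, hn, hw⟩, hrot.symm⟩
  · rintro _ ⟨s, ⟨hs, n, hn, hw⟩, rfl⟩
    have hn0 : n ≠ 0 := by omega
    exact ⟨_, ⟨h.isJordanTrace_orbCurve (h.abs_ampOf_lt hs) (h.ampOf_pos hs) hn0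
      (h.turn_eq_of_netWinding hs hn0 hw),
      h.not_isCircle_orbCurve (h.abs_ampOf_lt hs) (h.ampOf_pos hs)⟩, rfl⟩

/-- By monotonicity and continuity, the net winding takes the value `1 / n` if and only if it
lies strictly between the limits at the two ends. -/
lemma exists_netWinding_eq_iff (h : Admissible g σ)
    (hω : StrictAntiOn (fun s : ℝ => netWinding g (s : ℂ)) (Ioo 0 σ)) {ω₀ : EReal}
    (hlim : Tendsto (fun s : ℝ => ((netWinding g (s : ℂ) : ℝ) : EReal)) (𝓝[>] 0) (𝓝 ω₀))
    {n : ℕ} (hn : 0 < n) : (∃ s ∈ Ioo 0 σ, netWinding g (s : ℂ) = (n : ℝ)⁻¹) ↔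
      (((n : ℝ)⁻¹ : ℝ) : EReal) < ω₀ ∧ (n : ℝ) < √(σ * (g σ + σ * deriv g σ)) := by
  have hσ := h.rad_pos
  have hn' : (0 : ℝ) < n := by exact_mod_cast hn
  have hK : 0 < √(σ * (g σ + σ * deriv g σ)) :=
    Real.sqrt_pos.2 (mul_pos hσ (h.convex σ hσ))
  have hr := h.tendsto_netWinding_rad
  constructor
  · rintro ⟨s, hs, hw⟩
    constructor
    · have h1 : s / 2 ∈ Ioo 0 σ := ⟨by linarith [hs.1], by linarith [hs.1, hs.2]⟩
      have h2 : (((n : ℝ)⁻¹ : ℝ) : EReal) < ((netWinding g ((s / 2 : ℝ) : ℂ) : ℝ) : EReal) := by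
        rw [← hw, EReal.coe_lt_coe_iff]
        exact hω h1 hs (by linarith [hs.1])
      refine h2.trans_le (ge_of_tendsto hlim ?_)
      filter_upwards [Ioo_mem_nhdsGT h1.1] with x hx
      rw [EReal.coe_le_coe_iff]
      exact (hω ⟨hx.1, hx.2.trans h1.2⟩ h1 hx.2).le
    · have h1 : (s + σ) / 2 ∈ Ioo 0 σ := ⟨by linarith [hs.1], by linarith [hs.2]⟩
      have h2 : netWinding g (((s + σ) / 2 : ℝ) : ℂ) < (n : ℝ)⁻¹ := by
        rw [← hw]
        exact hω hs h1 (by linarith [hs.2])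
      have h3 : (√(σ * (g σ + σ * deriv g σ)))⁻¹ ≤ netWinding g (((s + σ) / 2 : ℝ) : ℂ) := by
        refine le_of_tendsto hr ?_
        filter_upwards [Ioo_mem_nhdsLT h1.2] with x hx
        exact (hω h1 ⟨h1.1.trans hx.1, hx.2⟩ hx.1).le
      exact (inv_lt_inv₀ hK hn').1 (h3.trans_lt h2)
  · rintro ⟨h1, h2⟩
    obtain ⟨a, ha, haσ⟩ := ((hlim.eventually_const_lt h1).and (Ioo_mem_nhdsGT hσ)).exists
    obtain ⟨b, hb, hbσ⟩ := ((hr.eventually_lt_const ((inv_lt_inv₀ hK hn').2 h2)).and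
      (Ioo_mem_nhdsLT hσ)).exists
    rw [EReal.coe_lt_coe_iff] at ha
    obtain ⟨s, hs, hw⟩ := isPreconnected_Ioo.intermediate_value hbσ haσ h.continuousOn_netWinding
      (show (n : ℝ)⁻¹ ∈ Icc _ _ from ⟨hb.le, ha.le⟩)
    exact ⟨s, hs, hw⟩

lemma exists_netWinding_limit (h : Admissible g σ)
    (hω : StrictAntiOn (fun s : ℝ => netWinding g (s : ℂ)) (Ioo 0 σ)) :
    ∃ ω₀ : EReal, 0 < ω₀ ∧
      Tendsto (fun s : ℝ => ((netWinding g (s : ℂ) : ℝ) : EReal)) (𝓝[>] 0) (𝓝 ω₀) := by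
  have hσ := h.rad_pos
  have hanti : AntitoneOn (fun s : ℝ => ((netWinding g (s : ℂ) : ℝ) : EReal)) (Ioo 0 σ) :=
    fun x hx y hy hxy => EReal.coe_le_coe_iff.2 (hω.antitoneOn hx hy hxy)
  have hmem : σ / 2 ∈ Ioo 0 σ := ⟨by linarith, by linarith⟩
  refine ⟨_, ?_, hanti.tendsto_nhdsWithin_Ioo_right ⟨_, hmem⟩ (OrderTop.bddAbove _)⟩
  exact (EReal.coe_pos.2 (h.netWinding_pos hmem)).trans_le (le_sSup ⟨_, hmem, rfl⟩)

lemma _root_.EReal.inv_lt_coe_iff {a : EReal} (ha : 0 < a) {x : ℝ} (hx : 0 < x) :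
    a⁻¹ < (x : EReal) ↔ ((x⁻¹ : ℝ) : EReal) < a := by
  induction a with
  | bot => simp at ha
  | top => simpa using hx
  | coe a =>
    have ha' : 0 < a := EReal.coe_pos.1 ha
    rw [← EReal.coe_inv, EReal.coe_lt_coe_iff, EReal.coe_lt_coe_iff]
    exact inv_lt_comm₀ ha' hx

/-- The count of Jordan solutions for normalised, hence positive, curvature functions. -/
theorem count (h : Admissible g σ)
    (hω : StrictAntiOn (fun s : ℝ => netWinding g (s : ℂ)) (Ioo 0 σ)) :
    ∃ ω₀ : EReal, 0 < ω₀ ∧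
      Tendsto (fun s : ℝ => ((netWinding g (s : ℂ) : ℝ) : EReal)) (𝓝[>] 0) (𝓝 ω₀) ∧
      (nonCircularJordanModRot g).encard = {n : ℕ | 2 ≤ n ∧ ω₀⁻¹ < ((n : ℝ) : EReal) ∧
        (n : ℝ) < √(σ * (g σ + σ * deriv g σ))}.encard := by
  obtain ⟨ω₀, hpos, hlim⟩ := h.exists_netWinding_limit hω
  refine ⟨ω₀, hpos, hlim, ?_⟩
  have hset : {n : ℕ | 2 ≤ n ∧ ω₀⁻¹ < ((n : ℝ) : EReal) ∧
        (n : ℝ) < √(σ * (g σ + σ * deriv g σ))} =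
      {n : ℕ | 2 ≤ n ∧ ∃ s ∈ Ioo 0 σ, netWinding g (s : ℂ) = (n : ℝ)⁻¹} := by
    ext n
    refine and_congr_right fun hn => ?_
    have hn0 : 0 < n := by omega
    rw [h.exists_netWinding_eq_iff hω hlim hn0, EReal.inv_lt_coe_iff hpos (by exact_mod_cast hn0)]
  -- The pairs `(n, s)` with net winding `1 / n` at `s` form a bijection.
  rw [hset, h.nonCircularJordanModRot_eq,
    InjOn.encard_image fun s hs s' hs' he => h.eq_of_rotationClass_eq hs.1 hs'.1 he]
  have himg : (fun s : ℝ => netWinding g (s : ℂ)) ''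
      {s | s ∈ Ioo 0 σ ∧ ∃ n : ℕ, 2 ≤ n ∧ netWinding g (s : ℂ) = (n : ℝ)⁻¹} =
      (fun n : ℕ => (n : ℝ)⁻¹) ''
        {n : ℕ | 2 ≤ n ∧ ∃ s ∈ Ioo 0 σ, netWinding g (s : ℂ) = (n : ℝ)⁻¹} := by
    apply Subset.antisymm
    · rintro _ ⟨s, ⟨hs, n, hn, hw⟩, rfl⟩
      exact ⟨n, ⟨hn, s, hs, hw⟩, hw.symm⟩
    · rintro _ ⟨n, ⟨hn, s, hs, hw⟩, rfl⟩
      exact ⟨s, ⟨hs, n, hn, hw⟩, hw⟩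
  rw [← InjOn.encard_image (hω.injOn.mono fun s hs => hs.1), himg,
    InjOn.encard_image fun n _ m _ hnm => Nat.cast_injective (inv_injective hnm)]

end Admissible

end PlanarCurvature

namespace PlanarCurvature

/-! ### Change of sign of the curvature function -/

variable {f : ℝ → ℝ} {J : Set ℝ} {c : ℝ → ℂ}

lemma conj_image_image (Γ : Set ℂ) : starRingEnd ℂ '' (starRingEnd ℂ '' Γ) = Γ := by
  rw [image_image]
  simp

lemma IsSolution.conj (hs : IsSolution f J c) :
    IsSolution (fun s => -f s) J (fun t => (starRingEnd ℂ) (c t)) := by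
  obtain ⟨ϑ, h1, h2, h3⟩ := hs.curvature
  refine ⟨hs.isOpen, hs.ordConnected, hs.zero_mem, Complex.conjCLE.contDiff.comp_contDiffOn
      hs.smooth,
    fun t => -ϑ t, h1.neg, fun t ht => ?_, fun t ht h0 => ?_⟩
  · have hd := ((hs.smooth.contDiffAt (hs.isOpen.mem_nhds ht)).differentiableAt
        (by simp)).hasDerivAt
    have := hd.star.deriv
    simp only [RCLike.star_def] at this
    rw [this, h2 t ht, conj_exp_mul_I]
    push_cast
    ring_nf
  · have h0' : c t ≠ 0 := fun h => h0 (by simp [h])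
    rw [deriv.fun_neg, h3 t ht h0', RCLike.norm_conj]

lemma IsMaximalSolution.conj (hm : IsMaximalSolution f J c) :
    IsMaximalSolution (fun s => -f s) J (fun t => (starRingEnd ℂ) (c t)) := by
  refine ⟨hm.1.conj, fun J' c' hs hsub => ?_⟩
  have hs' := hs.conj
  simp only [neg_neg] at hs'
  have e1 : (fun t => (starRingEnd ℂ) (c t)) '' J = starRingEnd ℂ '' (c '' J) := by
    rw [image_image]
  have e2 : (fun t => (starRingEnd ℂ) (c' t)) '' J' = starRingEnd ℂ '' (c' '' J') := by
    rw [image_image]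
  rw [e1] at hsub ⊢
  have h1 := hm.2 J' _ hs' (by
    rw [e2, ← conj_image_image (c '' J)]
    exact image_mono hsub)
  rw [h1, e2, conj_image_image]

lemma IsJordanTrace.conj {Γ : Set ℂ} (hΓ : IsJordanTrace f Γ) :
    IsJordanTrace (fun s => -f s) (starRingEnd ℂ '' Γ) := by
  obtain ⟨⟨J, c, hm, rfl⟩, ⟨e⟩⟩ := hΓ
  refine ⟨⟨J, _, hm.conj, by rw [image_image]⟩, ⟨?_⟩⟩
  exact (Complex.conjCLE.toHomeomorph.image (c '' J)).symm.trans e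

lemma IsCircle.conj {Γ : Set ℂ} (hΓ : IsCircle Γ) : IsCircle (starRingEnd ℂ '' Γ) := by
  obtain ⟨a, r, hr, rfl⟩ := hΓ
  refine ⟨(starRingEnd ℂ) a, r, hr, ?_⟩
  have := Complex.conjLIE.toIsometryEquiv.image_sphere a r
  exact this

lemma conj_image_rotationClass (Γ : Set ℂ) :
    (fun Γ => starRingEnd ℂ '' Γ) '' rotationClass Γ = rotationClass (starRingEnd ℂ '' Γ) := by
  have key : ∀ (α : ℝ) (Γ : Set ℂ),
      starRingEnd ℂ '' ((fun z : ℂ => Complex.exp ((α : ℂ) * Complex.I) * z) '' Γ) =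
        (fun z : ℂ => Complex.exp (((-α : ℝ) : ℂ) * Complex.I) * z) '' (starRingEnd ℂ '' Γ) := by
    intro α Γ
    rw [image_image, image_image]
    simp only [map_mul, conj_exp_mul_I, Complex.ofReal_neg, neg_mul]
  apply Subset.antisymm
  · rintro _ ⟨_, ⟨α, rfl⟩, rfl⟩
    exact ⟨-α, key α Γ⟩
  · rintro _ ⟨α, rfl⟩
    exact ⟨_, ⟨-α, rfl⟩, by simp only [key, neg_neg]⟩

lemma conj_mem_nonCircularJordanModRot {C : Set (Set ℂ)} (hC : C ∈ nonCircularJordanModRot f) :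
    (fun Γ => starRingEnd ℂ '' Γ) '' C ∈ nonCircularJordanModRot (fun s => -f s) := by
  obtain ⟨Γ, ⟨h1, h2⟩, rfl⟩ := hC
  refine ⟨starRingEnd ℂ '' Γ, ⟨h1.conj, fun h3 => h2 ?_⟩, (conj_image_rotationClass Γ).symm⟩
  rw [← conj_image_image Γ]
  exact h3.conj

/-- Complex conjugation exchanges the solutions of `κ = f(r)` and `κ = -f(r)`. -/
lemma encard_nonCircularJordanModRot_neg (f : ℝ → ℝ) :
    (nonCircularJordanModRot (fun s => -f s)).encard = (nonCircularJordanModRot f).encard := by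
  have hinv : Function.Involutive
      (fun C : Set (Set ℂ) => (fun Γ : Set ℂ => starRingEnd ℂ '' Γ) '' C) := by
    intro C
    simp only [image_image]
    simp
  rw [← hinv.injective.encard_image (nonCircularJordanModRot f)]
  congr 1
  apply Subset.antisymm
  · intro D hD
    have := conj_mem_nonCircularJordanModRot hD
    simp only [neg_neg] at this
    exact ⟨_, this, hinv D⟩
  · rintro _ ⟨C, hC, rfl⟩
    exact conj_mem_nonCircularJordanModRot hC

lemma IsFlowLine.neg_conj {u : ℝ → ℂ} (hu : IsFlowLine f u) :
    IsFlowLine (fun s => -f s) (fun t => -(starRingEnd ℂ) (u t)) := by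
  intro t
  refine ⟨by simpa using (hu t).1, (hu t).2.star.fun_neg.congr_deriv ?_⟩
  simp
  ring

lemma Admissible.netWinding_neg {g : ℝ → ℝ} {σ s : ℝ} (h : Admissible g σ) (hs : s ∈ Ioo 0 σ) :
    netWinding (fun s => -g s) ((-s : ℝ) : ℂ) = netWinding g (s : ℂ) := by
  have hA := h.abs_ampOf_lt hs
  have hu := h.isFlowLine_orbU hA
  have hu0 := h.orbU_ampOf_zero hs
  have hflow : flowLine g (s : ℂ) = orbU g σ (ampOf g σ s) := by rw [← hu0, h.flowLine_eq hu]
  have hv : flowLine (fun s => -g s) ((-s : ℝ) : ℂ) 0 = ((-s : ℝ) : ℂ) ∧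
      IsFlowLine (fun s => -g s) (flowLine (fun s => -g s) ((-s : ℝ) : ℂ)) :=
    Classical.epsilon_spec (p := fun v : ℝ → ℂ => v 0 = ((-s : ℝ) : ℂ) ∧
      IsFlowLine (fun s => -g s) v) ⟨_, by simp [hu0], hu.neg_conj⟩
  set v := flowLine (fun s => -g s) ((-s : ℝ) : ℂ) with hvdef
  set u := orbU g σ (ampOf g σ s) with hudef
  have hw := hv.2.neg_conj
  simp only [neg_neg] at hw
  have hvu : ∀ t, v t = -(starRingEnd ℂ) (u t) := by
    intro t
    have h1 := h.flowLine_eq hw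
    rw [hv.1] at h1
    simp only [Complex.ofReal_neg, map_neg, Complex.conj_ofReal, neg_neg] at h1
    rw [← hflow, h1]
    simp
  have hper : minPer (fun s => -g s) ((-s : ℝ) : ℂ) = minPer g (s : ℂ) := by
    rw [minPer, minPer, hflow, ← hvdef]
    congr 1
    ext t
    refine and_congr_right fun _ => ?_
    rw [hvu, Complex.ofReal_neg, neg_inj]
    constructor
    · intro h1
      rw [← Complex.conj_conj (u t), h1, Complex.conj_ofReal]
    · intro h1
      rw [h1, Complex.conj_ofReal]
  have horient : ∀ T, orientationSign v T = -orientationSign u T := by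
    intro T
    rw [orientationSign, orientationSign, ← Real.sign_neg, ← intervalIntegral.integral_neg]
    congr 2
    funext t
    have hd : deriv v t = -(starRingEnd ℂ) (deriv u t) := by
      rw [(hu t).2.deriv, show v = fun t => -(starRingEnd ℂ) (u t) from funext hvu,
        ← (hu t).2.deriv]
      exact (hu t).2.differentiableAt.hasDerivAt.star.fun_neg.deriv
    rw [hvu, hd]
    simp
    ring
  rw [netWinding, netWinding, hper, hflow, ← hvdef, horient]
  simp only [hvu, norm_neg, RCLike.norm_conj, intervalIntegral.integral_neg]
  ring

/-! ### Normalisation of the curvature function -/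

lemma ClassF.hasDerivAt_primF (hf : ClassF f) {s : ℝ} (hs : 0 < s) :
    HasDerivAt (primF f) (s * f s - 1) s := by
  have hc : ContinuousOn (fun u => u * f u - 1) (Ioi 0) :=
    (continuousOn_id.mul hf.smooth.continuousOn).sub continuousOn_const
  have hsub : uIcc 1 s ⊆ Ioi (0 : ℝ) := ordConnected_Ioi.uIcc_subset one_pos hs
  exact intervalIntegral.integral_hasDerivAt_right (hc.mono hsub).intervalIntegrable
    (hc.stronglyMeasurableAtFilter isOpen_Ioi _ hs) (hc.continuousAt (Ioi_mem_nhds hs))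

lemma ClassF.hasDerivAt (hf : ClassF f) {s : ℝ} (hs : 0 < s) : HasDerivAt f (deriv f s) s :=
  ((hf.smooth.contDiffAt (Ioi_mem_nhds hs)).differentiableAt (by simp)).hasDerivAt

lemma ClassF.iteratedDeriv_primF (hf : ClassF f) {s : ℝ} (hs : 0 < s) :
    iteratedDeriv 2 (primF f) s = f s + s * deriv f s := by
  rw [show (2 : ℕ) = 1 + 1 from rfl, iteratedDeriv_succ, iteratedDeriv_one]
  have h1 : deriv (primF f) =ᶠ[𝓝 s] fun s => s * f s - 1 := by
    filter_upwards [Ioi_mem_nhds hs] with x hx using (hf.hasDerivAt_primF hx).deriv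
  rw [h1.deriv_eq]
  simpa using (((hasDerivAt_id' s).fun_mul (hf.hasDerivAt hs)).sub_const 1).deriv

lemma ClassF.epsF_mul_pos (hf : ClassF f) {s : ℝ} (hs : 0 < s) :
    0 < epsF f * (f s + s * deriv f s) := by
  have hne : ∀ s ∈ Ioi (0 : ℝ), f s + s * deriv f s ≠ 0 := fun s hs h0 =>
    hf.ne_zero s hs (by rw [hf.iteratedDeriv_primF hs, h0, mul_zero])
  have hc : ContinuousOn (fun s => f s + s * deriv f s) (Ioi 0) :=
    hf.smooth.continuousOn.add (continuousOn_id.mul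
      (hf.smooth.continuousOn_deriv_of_isOpen isOpen_Ioi (by simp)))
  have h1 : (1 : ℝ) ∈ Ioi (0 : ℝ) := mem_Ioi.2 one_pos
  rw [epsF, hf.iteratedDeriv_primF one_pos]
  rcases lt_or_gt_of_ne (hne 1 h1) with hlt | hlt
  · rw [Real.sign_of_neg hlt, neg_one_mul, neg_pos]
    by_contra hcon
    obtain ⟨x, hx, hx0⟩ := isPreconnected_Ioi.intermediate_value h1 hs hc
      (show (0 : ℝ) ∈ Icc _ _ from ⟨hlt.le, not_lt.1 hcon⟩)
    exact hne x hx hx0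
  · rw [Real.sign_of_pos hlt, one_mul]
    by_contra hcon
    obtain ⟨x, hx, hx0⟩ := isPreconnected_Ioi.intermediate_value hs h1 hc
      (show (0 : ℝ) ∈ Icc _ _ from ⟨not_lt.1 hcon, hlt.le⟩)
    exact hne x hx hx0

lemma ClassF.epsF_eq (hf : ClassF f) : epsF f = 1 ∨ epsF f = -1 := by
  rcases Real.sign_apply_eq_of_ne_zero (iteratedDeriv 2 (primF f) 1) (fun h0 =>
    hf.ne_zero 1 one_pos (by rw [h0, mul_zero])) with h | h
  · exact Or.inr h
  · exact Or.inl h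

/-- The function `ε_f f` satisfies the normalised hypotheses. -/
lemma ClassFStar.admissible (hf : ClassFStar f) :
    Admissible (fun s => epsF f * f s) (radS f) := by
  obtain ⟨hF, a, b, ha, hb, ha1, hb1⟩ := hf
  have hε : epsF f * epsF f = 1 := by rcases hF.epsF_eq with h | h <;> rw [h] <;> norm_num
  have hε0 : epsF f ≠ 0 := fun h0 => by simp [h0] at hε
  set g : ℝ → ℝ := fun s => epsF f * f s with hg
  have hsm : ContDiffOn ℝ ∞ g (Ioi 0) := contDiffOn_const.mul hF.smooth
  have hd : ∀ s, 0 < s → HasDerivAt g (epsF f * deriv f s) s :=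
    fun s hs => (hF.hasDerivAt hs).const_mul _
  have hconv : ∀ s, 0 < s → 0 < g s + s * deriv g s := by
    intro s hs
    rw [(hd s hs).deriv]
    have := hF.epsF_mul_pos hs
    linarith [show epsF f * f s + s * (epsF f * deriv f s) =
      epsF f * (f s + s * deriv f s) by ring]
  have hmulc : ContinuousOn (fun s => s * g s) (Ioi 0) := continuousOn_id.mul hsm.continuousOn
  have hmono : StrictMonoOn (fun s => s * g s) (Ioi 0) := by
    apply strictMonoOn_of_deriv_pos (convex_Ioi 0) hmulc
    intro s hs
    rw [interior_Ioi] at hs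
    have h1 : HasDerivAt (fun s => s * g s) (g s + s * deriv g s) s := by
      have := (hasDerivAt_id' s).fun_mul (hd s hs)
      rw [← (hd s hs).deriv] at this
      simpa using this
    rw [h1.deriv]
    exact hconv s hs
  have hcomm : ∀ s, epsF f * s * f s = s * g s := fun s => by rw [hg]; ring
  simp only [hcomm] at ha hb
  obtain ⟨x, hx, hx0⟩ := ((ha.eventually_lt_const ha1).and self_mem_nhdsWithin).exists
  obtain ⟨y, hy, hy0⟩ := ((hb.eventually_const_lt hb1).and (eventually_gt_atTop 0)).exists
  have hx0 : 0 < x := hx0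
  have hx1 : x * g x < 1 := by exact_mod_cast hx
  have hy1 : 1 < y * g y := by exact_mod_cast hy
  obtain ⟨σ, hσ, hσ1⟩ := isPreconnected_Ioi.intermediate_value (mem_Ioi.2 hx0) (mem_Ioi.2 hy0) hmulc
    (show (1 : ℝ) ∈ Icc _ _ from ⟨hx1.le, hy1.le⟩)
  have hσ : 0 < σ := hσ
  have hrad : radS f = σ := by
    have : {s : ℝ | 0 < s ∧ s * f s = epsF f} = {σ} := by
      ext s
      constructor
      · rintro ⟨h1, h2⟩
        refine hmono.injOn h1 hσ ?_
        simp only at hσ1 ⊢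
        rw [hσ1, hg]
        linear_combination (epsF f) * h2 + hε
      · rintro rfl
        refine ⟨hσ, ?_⟩
        simp only [hg] at hσ1
        linear_combination (epsF f) * hσ1 - (s * f s) * hε
    rw [radS, this, csInf_singleton]
  have hne : ∀ s, 0 < s → g s ≠ 0 := fun s hs h0 => hF.ne_zero s hs (by
    rw [(mul_eq_zero.1 h0).resolve_left hε0]; ring)
  have hgy : 0 < g y := by
    by_contra hcon
    nlinarith [not_lt.1 hcon]
  refine ⟨hsm, fun s hs => ?_, fun s hs => ?_, hconv, hrad ▸ hσ, by rw [hrad]; exact hσ1⟩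
  · by_contra hcon
    obtain ⟨z, hz, hz0⟩ := isPreconnected_Ioi.intermediate_value (mem_Ioi.2 hs) (mem_Ioi.2 hy0)
      hsm.continuousOn (show (0 : ℝ) ∈ Icc _ _ from ⟨not_lt.1 hcon, hgy.le⟩)
    exact hne z hz hz0
  · rw [(hd s hs).deriv]
    exact mul_ne_zero hε0 fun h0 => hF.ne_zero s hs (by rw [h0]; ring)

end PlanarCurvature

theorem mainTheorem5 (f : ℝ → ℝ) (hf : PlanarCurvature.ClassFStar f)
    (hω : StrictAntiOn
      (fun s : ℝ => PlanarCurvature.netWinding f ((PlanarCurvature.epsF f * s : ℝ) : ℂ))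
      (Set.Ioo 0 (PlanarCurvature.radS f))) :
    ∃ ω₀ : EReal, 0 < ω₀ ∧
      Filter.Tendsto
        (fun s : ℝ =>
          ((PlanarCurvature.netWinding f ((PlanarCurvature.epsF f * s : ℝ) : ℂ) : ℝ) : EReal))
        (𝓝[>] 0) (𝓝 ω₀) ∧
      (PlanarCurvature.nonCircularJordanModRot f).encard =
        {n : ℕ | 2 ≤ n ∧ ω₀⁻¹ < ((n : ℝ) : EReal) ∧
          (n : ℝ) < Real.sqrt (PlanarCurvature.epsF f * PlanarCurvature.radS f *
            iteratedDeriv 2 (PlanarCurvature.primF f) (PlanarCurvature.radS f))}.encard := by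
  have h := hf.admissible
  have hσ := h.rad_pos
  have hK : PlanarCurvature.epsF f * PlanarCurvature.radS f * iteratedDeriv 2
      (PlanarCurvature.primF f) (PlanarCurvature.radS f) =
      PlanarCurvature.radS f * (PlanarCurvature.epsF f * f (PlanarCurvature.radS f) +
          PlanarCurvature.radS f * deriv (fun s => PlanarCurvature.epsF f * f s)
              (PlanarCurvature.radS f)) := by
    rw [hf.1.iteratedDeriv_primF hσ, ((hf.1.hasDerivAt hσ).const_mul
        (PlanarCurvature.epsF f)).deriv]
    ring
  rw [hK]
  rcases hf.1.epsF_eq with hε | hε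
  · simp only [hε, one_mul] at h hω ⊢
    exact h.count hω
  · simp only [hε, neg_one_mul] at h hω ⊢
    have hw : ∀ s ∈ Ioo 0 (PlanarCurvature.radS f), PlanarCurvature.netWinding f ((-s : ℝ) : ℂ) =
        PlanarCurvature.netWinding (fun s => -f s) (s : ℂ) := by
      intro s hs
      have := h.netWinding_neg hs
      simpa only [neg_neg] using this
    obtain ⟨ω₀, h1, h2, h3⟩ := h.count fun x hx y hy hxy => by
      have h1 := hω hx hy hxy
      simp only [hw x hx, hw y hy] at h1
      exact h1
    refine ⟨ω₀, h1, h2.congr' ?_, ?_⟩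
    · filter_upwards [Ioo_mem_nhdsGT hσ] with s hs
      rw [hw s hs]
    · rw [← h3, PlanarCurvature.encard_nonCircularJordanModRot_neg]
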